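/- Let $a>0$ and let $v_0:\mathbb R^2\to(-\infty,0]$ be bounded, measurable and radial, with $v_0(x)=0$ for $|x|>a$ and (essential) minimum $v_{\min}<0$. For $\lambda>0$ consider on $L^2(\mathbb R^2)$ the self-adjoint one-well magnetic Hamiltonian $$h^\lambda=(P-\lambda Ax)^2+\lambda^2v_0(x),\qquad P=\tfrac1i\nabla,\quad Ax=\tfrac12\,e_3\wedge x=\tfrac12(-x_2,x_1),$$ and let $(\varphi_0^\lambda,e_0^\lambda)$ be its $L^2$-normalized ground state eigenpair, $e_0^\lambda=\min\operatorname{spec}h^\lambda$. Assume that for all sufficiently large $\lambda$ the ground state $\varphi_0^\lambda$ is a radial function, and that there is $C_{\rm gap}>0$ such that for all sufficiently large $\lambda$, $\langle\psi,(h^\lambda-e_0^\lambda)\psi\rangle\ge C_{\rm gap}\|\psi\|^2$ for every $\psi\in\operatorname{dom}(h^\lambda)$ orthogonal to $\varphi_0^\lambda$. Then there are constants $\mu_0,\mu_1,\lambda_\star,K>0$, depending only on $v_0$ and $a$, such that for every $\lambda>\lambda_\star$ the following holds. After multiplication by a constant phase (and the choice of the continuous representative), $\varphi_0^\lambda$ is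 continuous, radial and strictly positive on $\mathbb R^2$, and: (i) for all $|z|>a$, $$K^{-1}\lambda^{-1}\exp\Big(-\big(\tfrac14+\mu_0\big)\lambda\big((|z|^2-a^2)+\mu_1\big)\Big)\le\varphi_0^\lambda(z)\le K\sqrt\lambda\,\exp\Big(-\tfrac14\lambda(|z|^2-a^2)\Big);$$ (ii) with $\alpha=(\lambda-e_0^\lambda)/(2\lambda)$, one has $\alpha>0$ and there is a constant $C_\lambda>0$, independent of $z$, such that for all $|z|>a$ $$\varphi_0^\lambda(z)=C_\lambda\,e^{-\frac14\lambda|z|^2}\int_0^\infty e^{-\frac12\lambda|z|^2t}\,t^{\alpha-1}(1+t)^{-\alpha}\,dt ,$$ where the integral converges, and $$K^{-1}\exp\Big(-2\lambda\big(|v_{\min}|/2\big)^{3/4}a^{-3/2}|z|^2\Big)\le\frac{\varphi_0^\lambda(z)}{\frac{C_\lambda}{\sqrt\lambda}\exp\left(-\frac14\lambda|z|^2\right)}\le K .$$ -/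

import Mathlib

open MeasureTheory Filter
open scoped ContDiff ComplexConjugate

noncomputable section

namespace MagneticWell

/-- The Euclidean plane. -/
abbrev Plane := EuclideanSpace ℝ (Fin 2)

/-- The symmetric-gauge vector potential `A x = (1/2) e₃ ∧ x = (1/2) (-x₂, x₁)` of a unit
constant magnetic field. -/
def vecPot (x : Plane) : Plane := !₂[-(x 1) / 2, x 0 / 2]

/-- The `j`-th component of the magnetic momentum `P - b A x`, with `P = -i ∇`. -/
def magMomentum (b : ℝ) (j : Fin 2) (f : Plane → ℂ) : Plane → ℂ := fun x =>
  -Complex.I * fderiv ℝ f x (EuclideanSpace.single j 1) - ((b * vecPot x j : ℝ) : ℂ) * f x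

/-- The differential expression `(P - b A x)² + lam² v` (meaningful on smooth functions). -/
def oneWell (lam b : ℝ) (v : Plane → ℝ) (f : Plane → ℂ) : Plane → ℂ := fun x =>
  ∑ j : Fin 2, magMomentum b j (magMomentum b j f) x + ((lam ^ 2 * v x : ℝ) : ℂ) * f x

/-- The `L²` inner product on complex functions, linear in the second variable. -/
def innerL2 (f g : Plane → ℂ) : ℂ := ∫ x, conj (f x) * g x

/-- `IsImage lam b v ψ g`: `ψ` is in the domain of the self-adjoint operator
`h = (P - b A x)² + lam² v` on `L²(ℝ²)` and `h ψ = g`.  For bounded `v` the operator is essentially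
self-adjoint on `C_c^∞`, so `h` is the adjoint of its restriction to `C_c^∞`: its domain consists of
the `ψ ∈ L²` for which the distribution `h ψ` lies in `L²`. -/
def IsImage (lam b : ℝ) (v : Plane → ℝ) (ψ g : Plane → ℂ) : Prop :=
  MemLp ψ 2 volume ∧ MemLp g 2 volume ∧
    ∀ η : Plane → ℂ, ContDiff ℝ ∞ η → HasCompactSupport η →
      innerL2 (oneWell lam b v η) ψ = innerL2 η g

/-- `φ` is an `L²`-normalized ground state of `h = (P - b A x)² + lam² v` with energy `e`:
`h φ = e φ`, and `e` is the bottom of the spectrum, `⟨ψ, h ψ⟩ ≥ e ‖ψ‖²` on the domain of `h`. -/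
structure IsGroundState (lam b : ℝ) (v : Plane → ℝ) (e : ℝ) (φ : Plane → ℂ) : Prop where
  eigen : IsImage lam b v φ (fun x => (e : ℂ) * φ x)
  normalized : ∫ x, ‖φ x‖ ^ 2 = 1
  bottom : ∀ ψ g : Plane → ℂ, IsImage lam b v ψ g →
    e * ∫ x, ‖ψ x‖ ^ 2 ≤ (innerL2 ψ g).re

/-- A bounded radial well `v ≤ 0`, not almost everywhere zero, supported in the disc of
radius `a` about the origin. -/
structure IsRadialWell (v : Plane → ℝ) (a : ℝ) : Prop where
  radius_pos : 0 < a
  measurable : Measurable v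
  nonpos : ∀ x, v x ≤ 0
  bounded : ∃ M : ℝ, ∀ x, -M ≤ v x
  radial : ∀ x y, ‖x‖ = ‖y‖ → v x = v y
  support : Function.support v ⊆ Metric.closedBall 0 a
  min_neg : essInf v volume < 0

/-- For `b = lam` large, the ground state is (almost everywhere equal to) a radial function. -/
def RadialGroundState (v : Plane → ℝ) : Prop :=
  ∀ᶠ lam : ℝ in atTop, ∀ (e : ℝ) (φ : Plane → ℂ), IsGroundState lam lam v e φ →
    ∃ f : ℝ → ℂ, φ =ᵐ[volume] fun x => f ‖x‖

/-- For `b = lam` large, there is a spectral gap above the ground state energy that is bounded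
below independently of `lam`. -/
def SpectralGap (v : Plane → ℝ) : Prop :=
  ∃ Cgap : ℝ, 0 < Cgap ∧ ∀ᶠ lam : ℝ in atTop,
    ∀ (e : ℝ) (φ : Plane → ℂ), IsGroundState lam lam v e φ →
      ∀ ψ g : Plane → ℂ, IsImage lam lam v ψ g → innerL2 φ ψ = 0 →
        Cgap * ∫ x, ‖ψ x‖ ^ 2 ≤ (innerL2 ψ (fun x => g x - (e : ℂ) * ψ x)).re

/-- The unnormalized decaying exterior solution: for `α > 0`,
`exp(-lam r²/4) ∫₀^∞ exp(-lam r² t/2) t^(α-1) (1+t)^(-α) dt`. -/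
def exteriorProfile (lam α r : ℝ) : ℝ :=
  Real.exp (-(lam * r ^ 2 / 4)) *
    ∫ t in Set.Ioi (0 : ℝ), Real.exp (-(lam * r ^ 2 * t / 2)) * t ^ (α - 1) * (1 + t) ^ (-α)

end MagneticWell

end

/-! In the variable s = |x|² planar Lebesgue measure becomes π ds on the half line, and on radial
functions h - e becomes four times χ ↦ -(s χ')' + q χ with q = (lam² s/4 + lam² v - e)/4. A radial
ground state is therefore an L² weak solution of a singular Sturm–Liouville equation. The test
functions need not vanish at s = 0, so the weak equation also carries the boundary condition: the
flux p = s φ' vanishes at the origin. This makes the solution unique up to a factor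
(`RadialSol.eq_zero`), so the real and imaginary parts of the ground state are proportional and a
constant phase makes it real (`exists_radialSol`, `exists_phase`). Minimality of e makes the
quadratic form nonnegative, which forces Cauchy data to vanish at any zero and so excludes zeros
(`RadialSol.pos`).

Two energy bounds control the exponent α = (lam - e)/(2 lam). A bump at a Lebesgue point of the
well, modulated by a gauge phase, gives e ≤ -lam, that is α ≥ 1 (`eventually_energy_le`). If e were
below lam² v_min, then q ≥ 0 almost everywhere and φ would be nondecreasing, hence not square
integrable; so α ≤ 1/2 + lam |v_min|/2 (`essInf_le_energy`).

Outside the well q is explicit and nonnegative, and exp(-lam s/4) times the Laplace integral of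
t^(α-1) (1+t)^(-α) is a decaying solution by Kummer's equation (`laplaceMoment_relation`). The
Wronskian of two positive exterior solutions that do not blow up vanishes, so φ is a multiple of
this one (`ExteriorSol.proportional`). For α ≥ 1 the kernel is at most 1, which bounds the integral
above; one window in t bounds it below (`laplaceMoment_zero_ge`).

It remains to bound φ at the edge s₁ = a². There φ varies on the scale 1/lam, so normalization gives
φ(s₁) ≤ const √lam (`WellSol.boundary_le`). Conversely, a backward Grönwall estimate bounds φ inside
by exp(const lam) φ(s₁), while outside φ decays; normalization then bounds φ(s₁) below by exp(-const
lam) (`WellSol.boundary_ge`). -/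

namespace MagneticWell

open Set

/-! ### Polar coordinates in the squared radius -/

section Polar

variable {F : Type*} [NormedAddCommGroup F] [NormedSpace ℝ F]

/-- In the plane 2π r dr = π d(r²): the radial weight disappears in the squared radius, which is why
s = |x|² is the variable throughout. -/
lemma integral_normSq (h : ℝ → F) :
    ∫ x : Plane, h (‖x‖ ^ 2) = Real.pi • ∫ s in Ioi (0 : ℝ), h s := by
  rw [integral_fun_norm_addHaar volume (fun r => h (r ^ 2)),
    ← integral_comp_rpow_Ioi_of_pos (g := h) (p := 2) two_pos]
  simp only [finrank_euclideanSpace, Fintype.card_fin, Measure.real,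
    EuclideanSpace.volume_ball_fin_two]
  have : ∀ x : ℝ, ((2 : ℝ) * x ^ ((2 : ℝ) - 1)) • h (x ^ (2 : ℝ)) = (2 : ℝ) • (x • h (x ^ 2)) := by
    intro x
    rw [smul_smul]
    norm_num
  simp only [this]
  rw [integral_smul]
  simp [smul_smul, ← Nat.cast_smul_eq_nsmul ℝ, mul_comm, Real.pi_pos.le]

lemma integrable_normSq {h : ℝ → F} :
    Integrable (fun x : Plane => h (‖x‖ ^ 2)) ↔ IntegrableOn h (Ioi (0 : ℝ)) := by
  rw [integrable_fun_norm_addHaar volume (f := fun r => h (r ^ 2)),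
    ← integrableOn_Ioi_comp_rpow_iff' h (p := 2) two_ne_zero]
  refine integrableOn_congr_fun (fun x _ => ?_) measurableSet_Ioi
  norm_num [finrank_euclideanSpace]

/-- A nonnegative integrable function vanishes almost everywhere exactly when its integral does;
apply this to the indicator of the failure of `P`. Whichever side is assumed makes the indicator a
null function, hence integrable, so `P` need not be measurable. -/
lemma ae_normSq_iff {P : ℝ → Prop} :
    (∀ᵐ x : Plane, P (‖x‖ ^ 2)) ↔ ∀ᵐ s ∂volume.restrict (Ioi (0 : ℝ)), P s := by
  classical
  set h : ℝ → ℝ := fun s => if P s then 0 else 1 with hh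
  have hP : ∀ s, P s ↔ h s = 0 := by
    intro s; by_cases hs : P s <;> simp [hh, hs]
  have h0 : ∀ s, 0 ≤ h s := by
    intro s; by_cases hs : P s <;> simp [hh, hs]
  simp only [hP]
  constructor
  · intro H
    have hi : Integrable (fun x : Plane => h (‖x‖ ^ 2)) :=
      (integrable_zero Plane ℝ volume).congr (by filter_upwards [H] with x hx using hx.symm)
    have hz : ∫ x : Plane, h (‖x‖ ^ 2) = 0 := by
      rw [integral_congr_ae H]; simp
    rw [integral_normSq, smul_eq_zero, or_iff_right Real.pi_pos.ne'] at hz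
    exact (integral_eq_zero_iff_of_nonneg (fun s => h0 s) (integrable_normSq.1 hi)).1 hz
  · intro H
    have hi : IntegrableOn h (Ioi (0 : ℝ)) :=
      (integrable_zero ℝ ℝ _).congr (by filter_upwards [H] with x hx using hx.symm)
    have hz : ∫ x : Plane, h (‖x‖ ^ 2) = 0 := by
      rw [integral_normSq, integral_congr_ae H]; simp
    exact (integral_eq_zero_iff_of_nonneg (fun x => h0 _) (integrable_normSq.2 hi)).1 hz

end Polar

/-! ### Symmetry of the magnetic momenta -/

section Momentum

lemma contDiff_vecPot (j : Fin 2) : ContDiff ℝ ∞ (fun x : Plane => vecPot x j) := by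
  fin_cases j
  · have : (fun x : Plane => vecPot x 0) = fun x => -(x 1) / 2 := by ext x; simp [vecPot]
    simp only [Fin.zero_eta, this]; fun_prop
  · have : (fun x : Plane => vecPot x 1) = fun x => (x 0) / 2 := by ext x; simp [vecPot]
    simp only [Fin.mk_one, this]; fun_prop

lemma contDiff_partial {f : Plane → ℂ} (hf : ContDiff ℝ ∞ f) (w : Plane) :
    ContDiff ℝ ∞ (fun x => fderiv ℝ f x w) :=
  (hf.fderiv_right (m := ∞) (by simp)).clm_apply contDiff_const

lemma contDiff_magMomentum {f : Plane → ℂ} (hf : ContDiff ℝ ∞ f) (b : ℝ) (j : Fin 2) :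
    ContDiff ℝ ∞ (magMomentum b j f) := by
  have h1 := contDiff_partial hf (EuclideanSpace.single j 1)
  have h2 : ContDiff ℝ ∞ (fun x : Plane => ((b * vecPot x j : ℝ) : ℂ)) :=
    Complex.ofRealCLM.contDiff.comp (contDiff_const.mul (contDiff_vecPot j))
  exact (contDiff_const.mul h1).sub (h2.mul hf)

lemma hasCompactSupport_partial {f : Plane → ℂ} (hf : HasCompactSupport f) (w : Plane) :
    HasCompactSupport (fun x => fderiv ℝ f x w) := hf.fderiv_apply (𝕜 := ℝ) w

lemma hasCompactSupport_magMomentum {f : Plane → ℂ} (hf : HasCompactSupport f) (b : ℝ)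
    (j : Fin 2) : HasCompactSupport (magMomentum b j f) :=
  ((hasCompactSupport_partial hf _).mul_left (f := fun _ => -Complex.I)).sub
    (hf.mul_left (f := fun x : Plane => ((b * vecPot x j : ℝ) : ℂ)))

lemma fderiv_conj {f : Plane → ℂ} (hf : Differentiable ℝ f) (x w : Plane) :
    fderiv ℝ (fun y => conj (f y)) x w = conj (fderiv ℝ f x w) := by
  have := (Complex.conjCLE.toContinuousLinearMap.hasFDerivAt.comp x (hf x).hasFDerivAt).fderiv
  change fderiv ℝ (fun y => conj (f y)) x = _ at this
  rw [this]; simp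

/-- Integration by parts, with the factor -i compensating the sign and the vector potential real.
Compact support of one factor is enough. -/
lemma innerL2_magMomentum {f g : Plane → ℂ} (hf : ContDiff ℝ ∞ f) (hg : ContDiff ℝ ∞ g)
    (hfc : HasCompactSupport f) (b : ℝ) (j : Fin 2) :
    innerL2 (magMomentum b j f) g = innerL2 f (magMomentum b j g) := by
  set w : Plane := EuclideanSpace.single j 1 with hw
  have hfd := hf.differentiable (by simp)
  have hgd := hg.differentiable (by simp)
  have hcc : ContDiff ℝ ∞ (fun y => conj (f y)) := Complex.conjCLE.contDiff.comp hf
  have hcs : HasCompactSupport (fun y => conj (f y)) := hfc.comp_left (g := conj) (by simp)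
  have hpf := contDiff_partial hf w
  have hpg := contDiff_partial hg w
  have hcp : ContDiff ℝ ∞ (fun y => conj (fderiv ℝ f y w)) := Complex.conjCLE.contDiff.comp hpf
  have hcps : HasCompactSupport (fun y => conj (fderiv ℝ f y w)) :=
    (hasCompactSupport_partial hfc w).comp_left (g := conj) (by simp)
  have hA : ContDiff ℝ ∞ (fun x : Plane => ((b * vecPot x j : ℝ) : ℂ)) :=
    Complex.ofRealCLM.contDiff.comp (contDiff_const.mul (contDiff_vecPot j))
  have i1 : Integrable (fun x => conj (fderiv ℝ f x w) * g x) :=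
    (hcp.continuous.mul hg.continuous).integrable_of_hasCompactSupport (hcps.mul_right)
  have i2 : Integrable (fun x => conj (f x) * fderiv ℝ g x w) :=
    (hcc.continuous.mul hpg.continuous).integrable_of_hasCompactSupport (hcs.mul_right)
  have i3 : Integrable (fun x => conj (f x) * g x) :=
    (hcc.continuous.mul hg.continuous).integrable_of_hasCompactSupport (hcs.mul_right)
  have i4 : Integrable (fun x => conj (f x) * (((b * vecPot x j : ℝ) : ℂ) * g x)) :=
    (hcc.continuous.mul (hA.continuous.mul hg.continuous)).integrable_of_hasCompactSupport
      (hcs.mul_right)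
  have key := integral_mul_fderiv_eq_neg_fderiv_mul_of_integrable (μ := volume)
    (f := fun y => conj (f y)) (g := g) (v := w) (by simpa only [fderiv_conj hfd] using i1) i2 i3
    (fun x _ => hcc.differentiable (by simp) x) (fun x _ => hgd x)
  simp only [fderiv_conj hfd] at key
  unfold innerL2
  have e1 : ∀ x, conj (magMomentum b j f x) * g x
      = Complex.I * (conj (fderiv ℝ f x w) * g x)
        - conj (f x) * (((b * vecPot x j : ℝ) : ℂ) * g x) := by
    intro x
    simp only [magMomentum, map_sub, map_mul, map_neg, Complex.conj_I, Complex.conj_ofReal]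
    ring
  have e2 : ∀ x, conj (f x) * magMomentum b j g x
      = -Complex.I * (conj (f x) * fderiv ℝ g x w)
        - conj (f x) * (((b * vecPot x j : ℝ) : ℂ) * g x) := by
    intro x
    simp only [magMomentum]
    ring
  simp only [e1, e2]
  rw [integral_sub (i1.const_mul _) i4, integral_sub (i2.const_mul _) i4, integral_const_mul,
    integral_const_mul, key]
  ring

end Momentum

/-! ### The operator and its quadratic form on test functions -/

section Smooth

variable {lam b : ℝ} {v : Plane → ℝ} {η ψ : Plane → ℂ}

lemma memLp_of_smooth (hη : Continuous η) (hηc : HasCompactSupport η) : MemLp η 2 volume :=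
  hη.memLp_of_hasCompactSupport hηc

lemma memLp_potential_mul (hv : Measurable v) (hb : ∃ M, ∀ x, |v x| ≤ M) (lam : ℝ)
    (hη : MemLp η 2 volume) : MemLp (fun x => ((lam ^ 2 * v x : ℝ) : ℂ) * η x) 2 volume := by
  obtain ⟨M, hM⟩ := hb
  refine hη.of_le_mul (c := lam ^ 2 * M) ?_ (ae_of_all _ fun x => ?_)
  · exact (Complex.measurable_ofReal.comp (hv.const_mul _)).aestronglyMeasurable.mul hη.1
  · rw [norm_mul, Complex.norm_real, Real.norm_eq_abs, abs_mul, abs_of_nonneg (sq_nonneg lam)]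
    gcongr
    exact hM x

lemma memLp_oneWell (hv : Measurable v) (hb : ∃ M, ∀ x, |v x| ≤ M) (hη : ContDiff ℝ ∞ η)
    (hηc : HasCompactSupport η) : MemLp (oneWell lam b v η) 2 volume := by
  have h1 : MemLp (fun x => ∑ j : Fin 2, magMomentum b j (magMomentum b j η) x) 2 volume := by
    refine memLp_finsetSum _ fun j _ => memLp_of_smooth ?_ ?_
    · exact (contDiff_magMomentum (contDiff_magMomentum hη b j) b j).continuous
    · exact hasCompactSupport_magMomentum (hasCompactSupport_magMomentum hηc b j) b j
  exact h1.add (memLp_potential_mul hv hb lam (memLp_of_smooth hη.continuous hηc))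

lemma innerL2_finset_sum_right {ι : Type*} (s : Finset ι) {f : Plane → ℂ} {g : ι → Plane → ℂ}
    (h : ∀ i ∈ s, Integrable (fun x => conj (f x) * g i x)) :
    innerL2 f (fun x => ∑ i ∈ s, g i x) = ∑ i ∈ s, innerL2 f (g i) := by
  simp only [innerL2, Finset.mul_sum]
  exact integral_finsetSum s h

lemma integrable_conj_mul {f g : Plane → ℂ} (hf : MemLp f 2 volume) (hg : MemLp g 2 volume) :
    Integrable (fun x => conj (f x) * g x) := by
  have hf' : MemLp (fun x => conj (f x)) 2 volume := hf.star
  exact hf'.integrable_mul hg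

lemma innerL2_conj_symm (f g : Plane → ℂ) : innerL2 f g = conj (innerL2 g f) := by
  unfold innerL2
  rw [← integral_conj]
  simp [mul_comm]

/-- The sesquilinear form of the operator on smooth compactly supported functions. -/
lemma innerL2_oneWell (hv : Measurable v) (hb : ∃ M, ∀ x, |v x| ≤ M)
    (hη : ContDiff ℝ ∞ η) (hηc : HasCompactSupport η)
    (hψ : ContDiff ℝ ∞ ψ) (hψc : HasCompactSupport ψ) :
    innerL2 η (oneWell lam b v ψ) = ∑ j : Fin 2, innerL2 (magMomentum b j η) (magMomentum b j ψ)
      + ∫ x, conj (η x) * (((lam ^ 2 * v x : ℝ) : ℂ) * ψ x) := by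
  have h2 := memLp_of_smooth hη.continuous hηc
  have hj : ∀ j, MemLp (magMomentum b j (magMomentum b j ψ)) 2 volume := fun j =>
    memLp_of_smooth (contDiff_magMomentum (contDiff_magMomentum hψ b j) b j).continuous
      (hasCompactSupport_magMomentum (hasCompactSupport_magMomentum hψc b j) b j)
  have hp := memLp_potential_mul hv hb lam (memLp_of_smooth hψ.continuous hψc)
  have : innerL2 η (oneWell lam b v ψ)
      = innerL2 η (fun x => ∑ j : Fin 2, magMomentum b j (magMomentum b j ψ) x)
        + ∫ x, conj (η x) * (((lam ^ 2 * v x : ℝ) : ℂ) * ψ x) := by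
    unfold innerL2 oneWell
    rw [← integral_add (integrable_conj_mul h2 (memLp_finsetSum _ fun j _ => hj j))
      (integrable_conj_mul h2 hp)]
    simp only [mul_add]
  rw [this, innerL2_finset_sum_right _ fun j _ => integrable_conj_mul h2 (hj j)]
  congr 1
  refine Finset.sum_congr rfl fun j _ => ?_
  rw [innerL2_magMomentum hη (contDiff_magMomentum hψ b j) hηc]

/-- The sesquilinear form of `innerL2_oneWell` is Hermitian, so the differential expression is
symmetric on test functions. This admits test functions as trial states in the variational
characterization of `e`. -/
lemma isImage_of_smooth (hv : Measurable v) (hb : ∃ M, ∀ x, |v x| ≤ M)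
    (hψ : ContDiff ℝ ∞ ψ) (hψc : HasCompactSupport ψ) :
    IsImage lam b v ψ (oneWell lam b v ψ) := by
  refine ⟨memLp_of_smooth hψ.continuous hψc, memLp_oneWell hv hb hψ hψc, fun η hη hηc => ?_⟩
  rw [innerL2_conj_symm, innerL2_oneWell hv hb hψ hψc hη hηc,
    innerL2_oneWell hv hb hη hηc hψ hψc, map_add, map_sum]
  congr 1
  · exact Finset.sum_congr rfl fun j _ => (innerL2_conj_symm _ _).symm
  · rw [← integral_conj]
    congr 1
    ext x
    simp only [map_mul, Complex.conj_conj, Complex.conj_ofReal]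
    ring

lemma re_innerL2_self (f : Plane → ℂ) : (innerL2 f f).re = ∫ x, ‖f x‖ ^ 2 := by
  have : innerL2 f f = ((∫ x, ‖f x‖ ^ 2 : ℝ) : ℂ) := by
    unfold innerL2
    rw [← integral_complex_ofReal]
    congr 1; ext x
    rw [mul_comm, Complex.mul_conj, Complex.normSq_eq_norm_sq]
  rw [this, Complex.ofReal_re]

lemma re_innerL2_oneWell (hv : Measurable v) (hb : ∃ M, ∀ x, |v x| ≤ M)
    (hη : ContDiff ℝ ∞ η) (hηc : HasCompactSupport η) :
    (innerL2 η (oneWell lam b v η)).re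
      = ∑ j : Fin 2, (∫ x, ‖magMomentum b j η x‖ ^ 2) + lam ^ 2 * ∫ x, v x * ‖η x‖ ^ 2 := by
  rw [innerL2_oneWell hv hb hη hηc hη hηc, Complex.add_re, Complex.re_sum]
  simp only [re_innerL2_self]
  congr 1
  have : ∀ x, conj (η x) * (((lam ^ 2 * v x : ℝ) : ℂ) * η x)
      = ((lam ^ 2 * (v x * ‖η x‖ ^ 2) : ℝ) : ℂ) := by
    intro x
    have := Complex.mul_conj (η x)
    rw [Complex.normSq_eq_norm_sq] at this
    push_cast at this ⊢
    linear_combination ((lam : ℂ) ^ 2 * v x) * this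
  simp only [this]
  rw [integral_complex_ofReal, Complex.ofReal_re, integral_const_mul]

end Smooth

end MagneticWell

namespace MagneticWell

open Set Topology

/-! ### The operator on radial functions -/

section Radial

/-- The components of the vector potential as linear functionals. -/
noncomputable def vecPotL (j : Fin 2) : Plane →L[ℝ] ℝ :=
  ![-(1 / 2 : ℝ) • EuclideanSpace.proj 1, (1 / 2 : ℝ) • EuclideanSpace.proj 0] j

lemma vecPotL_apply (j : Fin 2) (x : Plane) : vecPotL j x = vecPot x j := by
  fin_cases j <;> simp [vecPotL, vecPot] <;> ring

lemma vecPot_single (j : Fin 2) : vecPot (EuclideanSpace.single j (1 : ℝ)) j = 0 := by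
  fin_cases j <;> simp [vecPot]

lemma hasFDerivAt_mul_comp_normSq (L : Plane →L[ℝ] ℝ) {ρ : ℝ → ℝ} {x : Plane}
    (hρ : DifferentiableAt ℝ ρ (‖x‖ ^ 2)) :
    HasFDerivAt (fun y : Plane => L y * ρ (‖y‖ ^ 2))
      (L x • (deriv ρ (‖x‖ ^ 2) • ((2 : ℝ) • innerSL ℝ x)) + ρ (‖x‖ ^ 2) • L) x := by
  have h1 : HasFDerivAt (fun y : Plane => ‖y‖ ^ 2) ((2 : ℝ) • innerSL ℝ x) x :=
    by
    have := (hasStrictFDerivAt_norm_sq x).hasFDerivAt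
    rwa [← Nat.cast_smul_eq_nsmul ℝ, Nat.cast_ofNat] at this
  exact L.hasFDerivAt.mul (hρ.hasDerivAt.comp_hasFDerivAt x h1)

lemma hasFDerivAt_comp_normSq {ρ : ℝ → ℝ} {x : Plane} (hρ : DifferentiableAt ℝ ρ (‖x‖ ^ 2)) :
    HasFDerivAt (fun y : Plane => ρ (‖y‖ ^ 2))
      (deriv ρ (‖x‖ ^ 2) • ((2 : ℝ) • innerSL ℝ x)) x := by
  have h1 : HasFDerivAt (fun y : Plane => ‖y‖ ^ 2) ((2 : ℝ) • innerSL ℝ x) x :=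
    by
    have := (hasStrictFDerivAt_norm_sq x).hasFDerivAt
    rwa [← Nat.cast_smul_eq_nsmul ℝ, Nat.cast_ofNat] at this
  exact hρ.hasDerivAt.comp_hasFDerivAt x h1

/-- The momentum of a real radial function has the form f + i g, with f and g real and each a linear
functional times a radial function. This formula can therefore be applied again to obtain the
squared momentum. -/
lemma magMomentum_ofReal_add_I {f g : Plane → ℝ} {f' g' : Plane →L[ℝ] ℝ} {x : Plane}
    (hf : HasFDerivAt f f' x) (hg : HasFDerivAt g g' x) (b : ℝ) (j : Fin 2) :
    magMomentum b j (fun y => (f y : ℂ) + Complex.I * (g y : ℂ)) x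
      = ((g' (EuclideanSpace.single j 1) - b * vecPot x j * f x : ℝ) : ℂ)
        + Complex.I * ((-f' (EuclideanSpace.single j 1) - b * vecPot x j * g x : ℝ) : ℂ) := by
  have h1 : HasFDerivAt (fun y => ((f y : ℝ) : ℂ)) (Complex.ofRealCLM.comp f') x :=
    Complex.ofRealCLM.hasFDerivAt.comp x hf
  have h2 : HasFDerivAt (fun y => ((g y : ℝ) : ℂ)) (Complex.ofRealCLM.comp g') x :=
    Complex.ofRealCLM.hasFDerivAt.comp x hg
  have h3 := (h1.add (h2.const_mul Complex.I)).fderiv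
  change fderiv ℝ (fun y => (f y : ℂ) + Complex.I * (g y : ℂ)) x = _ at h3
  rw [magMomentum, h3]
  simp only [add_apply, FunLike.coe_smul, ContinuousLinearMap.coe_comp, Pi.smul_apply,
    Function.comp_apply, Complex.ofRealCLM_apply, smul_eq_mul]
  push_cast
  linear_combination (-(g' (EuclideanSpace.single j 1) : ℂ)) * Complex.I_sq

lemma magMomentum_radial {χ : ℝ → ℝ} (hχ : ContDiff ℝ ∞ χ) (b : ℝ) (j : Fin 2) :
    magMomentum b j (fun x => ((χ (‖x‖ ^ 2) : ℝ) : ℂ)) = fun x =>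
      ((((-b) • vecPotL j) x * χ (‖x‖ ^ 2) : ℝ) : ℂ)
        + Complex.I * ((((-2 : ℝ) • (EuclideanSpace.proj j : Plane →L[ℝ] ℝ)) x
          * deriv χ (‖x‖ ^ 2) : ℝ) : ℂ) := by
  ext x
  have h := magMomentum_ofReal_add_I (hasFDerivAt_comp_normSq (x := x)
    (hχ.differentiable (by simp) _)) (hasFDerivAt_const (0 : ℝ) x) b j
  simp only [Complex.ofReal_zero, mul_zero, add_zero] at h
  rw [h]
  simp [vecPotL_apply, inner]
  ring

lemma sum_sq_vecPot (x : Plane) : ∑ j : Fin 2, vecPot x j ^ 2 = ‖x‖ ^ 2 / 4 := by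
  rw [EuclideanSpace.norm_sq_eq]
  simp [vecPot, Fin.sum_univ_two]
  ring

lemma oneWell_radial {χ : ℝ → ℝ} (hχ : ContDiff ℝ ∞ χ) (lam b : ℝ) (v : Plane → ℝ) (x : Plane) :
    oneWell lam b v (fun x => ((χ (‖x‖ ^ 2) : ℝ) : ℂ)) x
      = ((-4 * (‖x‖ ^ 2 * deriv (deriv χ) (‖x‖ ^ 2) + deriv χ (‖x‖ ^ 2))
          + (b ^ 2 * ‖x‖ ^ 2 / 4 + lam ^ 2 * v x) * χ (‖x‖ ^ 2) : ℝ) : ℂ) := by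
  have hχ' : ContDiff ℝ ∞ (deriv χ) := by
    simpa using (contDiff_infty_iff_deriv.1 hχ).2
  have h2 : ∀ j, magMomentum b j (magMomentum b j (fun x => ((χ (‖x‖ ^ 2) : ℝ) : ℂ))) x
      = ((-2 * deriv χ (‖x‖ ^ 2) - 4 * x j ^ 2 * deriv (deriv χ) (‖x‖ ^ 2)
          + b ^ 2 * vecPot x j ^ 2 * χ (‖x‖ ^ 2) : ℝ) : ℂ)
        + Complex.I * ((4 * b * (vecPot x j * x j) * deriv χ (‖x‖ ^ 2) : ℝ) : ℂ) := by
    intro j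
    rw [magMomentum_radial hχ, magMomentum_ofReal_add_I
      (hasFDerivAt_mul_comp_normSq _ (hχ.differentiable (by simp) _))
      (hasFDerivAt_mul_comp_normSq _ (hχ'.differentiable (by simp) _))]
    have := vecPot_single j
    simp only [EuclideanSpace.single] at this
    simp [vecPotL_apply, EuclideanSpace.inner_single_right, vecPot_single]
    ring
  rw [oneWell]
  simp only [h2, Fin.sum_univ_two]
  have hs := sum_sq_vecPot x
  have hn := EuclideanSpace.norm_sq_eq x
  simp only [Fin.sum_univ_two, Real.norm_eq_abs, sq_abs] at hs hn
  -- The vector potential is tangential, so the imaginary cross terms (the angular momentum part)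
  -- cancel on radial functions.
  have ho : vecPot x 0 * x 0 + vecPot x 1 * x 1 = 0 := by simp [vecPot]; ring
  have hs' : ((vecPot x 0 : ℝ) : ℂ) ^ 2 + ((vecPot x 1 : ℝ) : ℂ) ^ 2 = ((‖x‖ : ℝ) : ℂ) ^ 2 / 4 := by
    exact_mod_cast congrArg (fun r : ℝ => (r : ℂ)) hs
  have hn' : ((‖x‖ : ℝ) : ℂ) ^ 2 = ((x 0 : ℝ) : ℂ) ^ 2 + ((x 1 : ℝ) : ℂ) ^ 2 := by
    exact_mod_cast congrArg (fun r : ℝ => (r : ℂ)) hn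
  have ho' : ((vecPot x 0 : ℝ) : ℂ) * ((x 0 : ℝ) : ℂ) + ((vecPot x 1 : ℝ) : ℂ) * ((x 1 : ℝ) : ℂ)
      = 0 := by
    rw [← Complex.ofReal_mul, ← Complex.ofReal_mul, ← Complex.ofReal_add, ho, Complex.ofReal_zero]
  push_cast
  linear_combination ((b : ℂ) ^ 2 * χ (‖x‖ ^ 2)) * hs' + (4 * ((deriv (deriv χ) (‖x‖ ^ 2) : ℝ) : ℂ)) * hn'
    + (4 * Complex.I * b * ((deriv χ (‖x‖ ^ 2) : ℝ) : ℂ)) * ho'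

lemma contDiff_radial {χ : ℝ → ℝ} (hχ : ContDiff ℝ ∞ χ) :
    ContDiff ℝ ∞ (fun x : Plane => ((χ (‖x‖ ^ 2) : ℝ) : ℂ)) :=
  Complex.ofRealCLM.contDiff.comp (hχ.comp (contDiff_norm_sq ℝ))

lemma hasCompactSupport_radial {χ : ℝ → ℝ} (hχ : HasCompactSupport χ) :
    HasCompactSupport (fun x : Plane => ((χ (‖x‖ ^ 2) : ℝ) : ℂ)) := by
  obtain ⟨R, hR⟩ := hχ.isCompact.isBounded.subset_closedBall 0
  refine HasCompactSupport.of_support_subset_isCompact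
    (isCompact_closedBall (0 : Plane) (R + 1)) fun x hx => ?_
  have h1 : ‖x‖ ^ 2 ∈ tsupport χ := subset_tsupport _ (by
    intro h; apply hx; simp [h])
  have h2 := hR h1
  simp only [mem_closedBall_zero_iff, Real.norm_eq_abs, abs_of_nonneg (sq_nonneg ‖x‖)] at h2 ⊢
  nlinarith [sq_nonneg (‖x‖ - 1), norm_nonneg x]

end Radial

/-! ### Gauge phases for trial functions -/

section Trial

/-- Modulating a real function by the gauge phase at `x₀` recentres the vector potential. -/
lemma norm_sq_magMomentum_gauge (lam : ℝ) (x₀ : Plane) {χ : Plane → ℝ} (hχ : ContDiff ℝ ∞ χ)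
    (j : Fin 2) (x : Plane) :
    ‖magMomentum lam j (fun y => Complex.exp (((lam * inner ℝ (vecPot x₀) y : ℝ) : ℂ) * Complex.I)
        * (χ y : ℂ)) x‖ ^ 2
      = (fderiv ℝ χ x (EuclideanSpace.single j 1)) ^ 2
        + lam ^ 2 * ((vecPot x₀ j - vecPot x j) ^ 2 * χ x ^ 2) := by
  have h1 : HasFDerivAt (fun y : Plane => ((lam * inner ℝ (vecPot x₀) y : ℝ) : ℂ) * Complex.I)
      (((Complex.ofRealCLM.comp (lam • innerSL ℝ (vecPot x₀)))).smulRight Complex.I) x := by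
    have := ((Complex.ofRealCLM.comp (lam • innerSL ℝ (vecPot x₀)))).smulRight Complex.I
      |>.hasFDerivAt (x := x)
    refine this.congr_of_eventuallyEq (Eventually.of_forall fun y => ?_)
    simp
  have h2 : HasFDerivAt (fun y => ((χ y : ℝ) : ℂ)) (Complex.ofRealCLM.comp (fderiv ℝ χ x)) x :=
    Complex.ofRealCLM.hasFDerivAt.comp x (hχ.differentiable (by simp) x).hasFDerivAt
  have h3 := (h1.cexp.mul h2).fderiv
  change fderiv ℝ (fun y => Complex.exp (((lam * inner ℝ (vecPot x₀) y : ℝ) : ℂ) * Complex.I)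
        * (χ y : ℂ)) x = _ at h3
  have key : magMomentum lam j (fun y => Complex.exp (((lam * inner ℝ (vecPot x₀) y : ℝ) : ℂ)
        * Complex.I) * (χ y : ℂ)) x
      = Complex.exp (((lam * inner ℝ (vecPot x₀) x : ℝ) : ℂ) * Complex.I) *
        (((lam * (vecPot x₀ j - vecPot x j) * χ x : ℝ) : ℂ)
          + ((-fderiv ℝ χ x (EuclideanSpace.single j 1) : ℝ) : ℂ) * Complex.I) := by
    rw [magMomentum, h3]
    simp [EuclideanSpace.inner_single_right]
    linear_combination (-(Complex.exp (lam * inner ℝ (vecPot x₀) x * Complex.I)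
      * lam * vecPot x₀ j * χ x)) * Complex.I_sq
  rw [key, norm_mul, Complex.norm_exp_ofReal_mul_I, one_mul, ← Complex.normSq_eq_norm_sq,
    Complex.normSq_add_mul_I]
  ring

end Trial

end MagneticWell

namespace MagneticWell

open Set Topology

/-! ### A trial state with energy below -lam -/

section Trial

lemma IsRadialWell.abs_bounded {v : Plane → ℝ} {a : ℝ} (hv : IsRadialWell v a) :
    ∃ M, ∀ x, |v x| ≤ M := by
  obtain ⟨M, hM⟩ := hv.bounded
  exact ⟨M, fun x => abs_le.2 ⟨hM x, by have := hM x; have := hv.nonpos x; linarith⟩⟩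

lemma hasCompactSupport_sq {f : Plane → ℝ} (hf : HasCompactSupport f) :
    HasCompactSupport (fun x => f x ^ 2) :=
  hf.comp_left (g := fun t : ℝ => t ^ 2) (by simp)

/-- Arithmetic for the pointwise estimate in `exists_trial_bump`: t = |x₀ - x|² ≤ R = r², y = v x, z
= v x₀, n = |v x - v x₀| and k = χ(x)² ≤ 1. -/
lemma bump_bound {t R y z n k : ℝ} (h1 : t ≤ R) (h2 : 0 ≤ k) (h4 : y - z ≤ n)
    (h5 : n * k ≤ n * 1) : (t / 4 + y) * k ≤ (R / 4 + z) * k + n := by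
  have := mul_le_mul_of_nonneg_right h4 h2
  have := mul_le_mul_of_nonneg_right h1 h2
  linarith

lemma exists_bump (x₀ : Plane) {r : ℝ} (hr : 0 < r) :
    ∃ χ : Plane → ℝ, ContDiff ℝ ∞ χ ∧ HasCompactSupport χ ∧ (∀ x, 0 ≤ χ x) ∧ (∀ x, χ x ≤ 1) ∧
      (∀ x ∈ Metric.closedBall x₀ (r / 2), χ x = 1) ∧
      ∀ x, x ∉ Metric.closedBall x₀ r → χ x = 0 := by
  let χ : ContDiffBump x₀ := ⟨r / 2, r, by positivity, by linarith⟩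
  refine ⟨χ, χ.contDiff, χ.hasCompactSupport, fun x => χ.nonneg, fun x => χ.le_one,
    fun x hx => χ.one_of_mem_closedBall hx, fun x hx => χ.zero_of_le_dist ?_⟩
  rw [Metric.mem_closedBall, not_le] at hx
  exact hx.le

/-- With c half the depth of the well, v < -c holds on a set of positive measure, so at some
Lebesgue point of v. A small ball about it has small mean oscillation, and r² < c keeps the magnetic
cost r²/4 below c/4. -/
lemma exists_deep_ball {v : Plane → ℝ} {a : ℝ} (hv : IsRadialWell v a) :
    ∃ (x₀ : Plane) (r c : ℝ), 0 < r ∧ 0 < c ∧ r ^ 2 < c ∧ v x₀ < -c ∧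
      (⨍ y in Metric.closedBall x₀ r, ‖v y - v x₀‖) < c / 16 := by
  obtain ⟨M, hM⟩ := hv.bounded
  have hM' : ∀ x, ‖v x‖ ≤ M := fun x => by
    rw [Real.norm_eq_abs, abs_le]; exact ⟨hM x, by have := hM x; have := hv.nonpos x; linarith⟩
  set c : ℝ := -essInf v volume / 2 with hc
  have hcpos : 0 < c := by have := hv.min_neg; simp only [hc]; linarith
  have hli : LocallyIntegrable v volume := by
    intro x
    refine ⟨Metric.ball x 1, Metric.ball_mem_nhds x one_pos, ?_⟩
    exact Measure.integrableOn_of_bounded (M := M) measure_ball_lt_top.ne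
      hv.measurable.aestronglyMeasurable (ae_of_all _ hM')
  have hae := (Besicovitch.vitaliFamily (volume : Measure Plane)).ae_tendsto_average_norm_sub hli
  have hfreq : ∃ᵐ x ∂(volume : Measure Plane), v x < -c := by
    intro hcon
    have : -c ≤ essInf v volume := by
      refine le_essInf_of_ae_le _ (by filter_upwards [hcon] with x hx using not_lt.1 hx) ?_
      exact (isBoundedUnder_of ⟨0, hv.nonpos⟩ : IsBoundedUnder (· ≤ ·) (ae volume) v).isCoboundedUnder_ge
    simp only [hc] at this
    have := hv.min_neg
    linarith
  obtain ⟨x₀, hx₀, hlim⟩ := (hfreq.and_eventually hae).exists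
  have hlim' := hlim.comp (Besicovitch.tendsto_filterAt volume x₀)
  have hev : ∀ᶠ r in 𝓝[>] (0 : ℝ), (⨍ y in Metric.closedBall x₀ r, ‖v y - v x₀‖) < c / 16 :=
    hlim'.eventually (gt_mem_nhds (by positivity))
  have hr2 : ∀ᶠ r in 𝓝[>] (0 : ℝ), r ^ 2 < c := by
    have : Tendsto (fun r : ℝ => r ^ 2) (𝓝[>] 0) (𝓝 (0 ^ 2)) :=
      ((continuous_pow 2).tendsto 0).mono_left nhdsWithin_le_nhds
    exact this.eventually (gt_mem_nhds (by simpa using hcpos))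
  obtain ⟨r, ⟨hr1, hr2⟩, hr⟩ := ((hev.and hr2).and self_mem_nhdsWithin).exists
  exact ⟨x₀, r, c, hr, hcpos, hr2, hx₀, hr1⟩

/-- The second integral is the lam² coefficient of the energy of a bump recentred at x₀: the squared
vector potential |x₀ - x|²/4 plus the well. It is negative because the bump sits where the well is
deeper than the magnetic cost. -/
lemma exists_trial_bump {v : Plane → ℝ} {a : ℝ} (hv : IsRadialWell v a) :
    ∃ (x₀ : Plane) (χ : Plane → ℝ), ContDiff ℝ ∞ χ ∧ HasCompactSupport χ ∧ 0 < ∫ x, χ x ^ 2 ∧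
      ∫ x, (‖x₀ - x‖ ^ 2 / 4 + v x) * χ x ^ 2 < 0 := by
  obtain ⟨M, hM'⟩ := hv.abs_bounded
  obtain ⟨x₀, r, c, hr, hcpos, hr2, hx₀, hr1⟩ := exists_deep_ball hv
  obtain ⟨χ, hχc, hχs, hχn, hχl, hχ1, hχ0⟩ := exists_bump x₀ hr
  obtain ⟨B, hB⟩ : ∃ B, B = Metric.closedBall x₀ r := ⟨_, rfl⟩
  obtain ⟨m, hm⟩ : ∃ m, m = volume.real B := ⟨_, rfl⟩
  rw [← hB] at hr1 hχ0
  have hBm : MeasurableSet B := hB ▸ measurableSet_closedBall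
  have hBf : volume B ≠ ⊤ := hB ▸ measure_closedBall_lt_top.ne
  have hmv : m = r ^ 2 * Real.pi := by
    rw [hm, hB, Measure.real, EuclideanSpace.volume_closedBall_fin_two]
    simp [Real.pi_pos.le, hr.le]
  have hmpos : 0 < m := by rw [hmv]; positivity
  have hi2 : Integrable (fun x => χ x ^ 2) volume :=
    (hχc.continuous.pow 2).integrable_of_hasCompactSupport (hasCompactSupport_sq hχs)
  -- The bump equals 1 on the ball of half the radius, which has a quarter of the area m.
  have hlow : m / 4 ≤ ∫ x, χ x ^ 2 := by
    have h1 : ∫ x in Metric.closedBall x₀ (r / 2), χ x ^ 2 = m / 4 := by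
      rw [setIntegral_congr_fun (g := fun _ => (1 : ℝ)) measurableSet_closedBall
        (fun x hx => by simp [hχ1 x hx])]
      rw [setIntegral_const, Measure.real, EuclideanSpace.volume_closedBall_fin_two, hmv]
      simp [Real.pi_pos.le, (half_pos hr).le]
      ring
    rw [← h1]
    exact setIntegral_le_integral hi2 (ae_of_all _ fun x => sq_nonneg _)
  have hpos : 0 < ∫ x, χ x ^ 2 := lt_of_lt_of_le (by positivity) hlow
  refine ⟨x₀, χ, hχc, hχs, hpos, ?_⟩
  have hIB : IntegrableOn (fun y => ‖v y - v x₀‖) B volume := by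
    refine Measure.integrableOn_of_bounded (M := M + M) hBf
      ((hv.measurable.sub_const _).norm.aestronglyMeasurable) (ae_of_all _ fun x => ?_)
    rw [norm_norm]
    exact (norm_sub_le _ _).trans (add_le_add (hM' _) (hM' _))
  have havg : ∫ y in B, ‖v y - v x₀‖ < c / 16 * m := by
    rw [setAverage_eq, smul_eq_mul, ← hm, inv_mul_lt_iff₀ hmpos] at hr1
    linarith
  have hint1 : Integrable (fun x => (r ^ 2 / 4 + v x₀) * χ x ^ 2) := hi2.const_mul _
  have hint2 : Integrable (B.indicator fun y => ‖v y - v x₀‖) :=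
    hIB.integrable_indicator hBm
  have hle : ∀ x, (‖x₀ - x‖ ^ 2 / 4 + v x) * χ x ^ 2
      ≤ (r ^ 2 / 4 + v x₀) * χ x ^ 2 + B.indicator (fun y => ‖v y - v x₀‖) x := by
    intro x
    by_cases hx : x ∈ B
    · rw [indicator_of_mem hx]
      have h1 : ‖x₀ - x‖ ^ 2 ≤ r ^ 2 := by
        rw [hB, Metric.mem_closedBall, dist_comm, dist_eq_norm] at hx
        gcongr
      have h2 : 0 ≤ χ x ^ 2 := sq_nonneg _
      have h3 : χ x ^ 2 ≤ 1 := pow_le_one₀ (hχn x) (hχl x)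
      have h4 : v x - v x₀ ≤ ‖v x - v x₀‖ := le_abs_self _
      have h5 : ‖v x - v x₀‖ * χ x ^ 2 ≤ ‖v x - v x₀‖ * 1 := by gcongr
      exact bump_bound h1 h2 h4 h5
    · rw [indicator_of_notMem hx, hχ0 x hx]; simp
  have hint0 : Integrable (fun x => (‖x₀ - x‖ ^ 2 / 4 + v x) * χ x ^ 2) := by
    have e : ∀ x, (‖x₀ - x‖ ^ 2 / 4 + v x) * χ x ^ 2
        = ‖x₀ - x‖ ^ 2 / 4 * χ x ^ 2 + v x * χ x ^ 2 := fun x => by ring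
    simp only [e]
    refine Integrable.add ?_ ?_
    · refine Continuous.integrable_of_hasCompactSupport ?_ ?_
      · have := hχc.continuous; fun_prop
      · exact (hasCompactSupport_sq hχs).mul_left
          (f := fun x : Plane => ‖x₀ - x‖ ^ 2 / 4)
    · exact hi2.bdd_mul hv.measurable.aestronglyMeasurable (ae_of_all _ hM')
  have h1 := integral_mono hint0 (hint1.add hint2) hle
  simp only [Pi.add_apply] at h1
  rw [integral_add hint1 hint2, integral_const_mul,
    integral_indicator hBm] at h1
  have h2 : (r ^ 2 / 4 + v x₀) * ∫ x, χ x ^ 2 ≤ (r ^ 2 / 4 + v x₀) * (m / 4) :=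
    mul_le_mul_of_nonpos_left hlow (by linarith)
  -- The total is at most -(3c/4)(m/4) from the frozen coefficient plus less than c m/16 from the
  -- oscillation, hence below -c m/8.
  have h3 : (r ^ 2 / 4 + v x₀) * (m / 4) ≤ (-(3 * c / 4)) * (m / 4) := by
    apply mul_le_mul_of_nonneg_right _ (by positivity); linarith
  have h4 : 0 < c * m := by positivity
  have h5 : -(3 * c / 4) * (m / 4) + c / 16 * m < 0 := by linarith
  exact h1.trans_lt ((add_lt_add_of_le_of_lt (h2.trans h3) havg).trans h5)

lemma sum_sq_vecPot_sub (x y : Plane) :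
    ∑ j : Fin 2, (vecPot x j - vecPot y j) ^ 2 = ‖x - y‖ ^ 2 / 4 := by
  rw [← sum_sq_vecPot]
  simp [vecPot, Fin.sum_univ_two]
  ring

/-- For strong fields the ground state energy lies far below zero. -/
theorem eventually_energy_le {v : Plane → ℝ} {a : ℝ} (hv : IsRadialWell v a) :
    ∀ᶠ lam : ℝ in atTop, ∀ (e : ℝ) (φ : Plane → ℂ), IsGroundState lam lam v e φ → e ≤ -lam := by
  obtain ⟨x₀, χ, hχ, hχc, hpos, hneg⟩ := exists_trial_bump hv
  set N := ∫ x, χ x ^ 2 with hN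
  set I := ∫ x, (‖x₀ - x‖ ^ 2 / 4 + v x) * χ x ^ 2 with hI
  set T := ∑ j : Fin 2, ∫ x, (fderiv ℝ χ x (EuclideanSpace.single j 1)) ^ 2 with hT
  have hvb := hv.abs_bounded
  have hbound : ∀ lam e φ, IsGroundState lam lam v e φ → e * N ≤ T + lam ^ 2 * I := by
    intro lam e φ hgs
    -- The phase shifts the vector potential by its value at x₀, so the energy of η is T + lam² I,
    -- where T does not depend on lam and I < 0.
    set η : Plane → ℂ := fun y =>
      Complex.exp (((lam * inner ℝ (vecPot x₀) y : ℝ) : ℂ) * Complex.I) * (χ y : ℂ) with hη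
    have hηs : ContDiff ℝ ∞ η := by
      refine ContDiff.mul ?_ (Complex.ofRealCLM.contDiff.comp hχ)
      refine ContDiff.cexp (ContDiff.mul ?_ contDiff_const)
      exact Complex.ofRealCLM.contDiff.comp (contDiff_const.mul (contDiff_const.inner ℝ contDiff_id))
    have hηc : HasCompactSupport η :=
      (hχc.comp_left (g := fun t : ℝ => (t : ℂ)) (by simp)).mul_left
    have hnorm : ∀ x, ‖η x‖ ^ 2 = χ x ^ 2 := by
      intro x
      simp only [hη, norm_mul, Complex.norm_exp_ofReal_mul_I, one_mul, Complex.norm_real,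
        Real.norm_eq_abs, sq_abs]
    have h := hgs.bottom η _ (isImage_of_smooth hv.measurable hvb hηs hηc)
    rw [re_innerL2_oneWell hv.measurable hvb hηs hηc] at h
    simp only [hnorm] at h
    have hcs2 := hasCompactSupport_sq hχc
    have hd : ∀ j : Fin 2, Integrable
        (fun x => (fderiv ℝ χ x (EuclideanSpace.single j 1)) ^ 2) := by
      intro j
      have hc : ContDiff ℝ ∞ (fun x => fderiv ℝ χ x (EuclideanSpace.single j 1)) :=
        (hχ.fderiv_right (m := ∞) (by simp)).clm_apply contDiff_const
      have hs : HasCompactSupport (fun x => fderiv ℝ χ x (EuclideanSpace.single j 1)) :=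
        hχc.fderiv_apply (𝕜 := ℝ) _
      exact (hc.continuous.pow 2).integrable_of_hasCompactSupport (hasCompactSupport_sq hs)
    have hAi : ∀ j : Fin 2, Integrable (fun x => (vecPot x₀ j - vecPot x j) ^ 2 * χ x ^ 2) := by
      intro j
      refine Continuous.integrable_of_hasCompactSupport ?_
        (hcs2.mul_left (f := fun x => (vecPot x₀ j - vecPot x j) ^ 2))
      exact ((continuous_const.sub (contDiff_vecPot j).continuous).pow 2).mul
        (hχ.continuous.pow 2)
    have hk : ∀ j : Fin 2, ∫ x, ‖magMomentum lam j η x‖ ^ 2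
        = (∫ x, (fderiv ℝ χ x (EuclideanSpace.single j 1)) ^ 2)
          + lam ^ 2 * ∫ x, (vecPot x₀ j - vecPot x j) ^ 2 * χ x ^ 2 := by
      intro j
      simp only [hη, norm_sq_magMomentum_gauge lam x₀ hχ]
      rw [integral_add (hd j) ((hAi j).const_mul _), integral_const_mul]
    have hvi : Integrable (fun x => v x * χ x ^ 2) := by
      obtain ⟨M, hM⟩ := hvb
      exact ((hχ.continuous.pow 2).integrable_of_hasCompactSupport hcs2).bdd_mul
        hv.measurable.aestronglyMeasurable (ae_of_all _ hM)
    have hIe : I = ∑ j : Fin 2, (∫ x, (vecPot x₀ j - vecPot x j) ^ 2 * χ x ^ 2)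
        + ∫ x, v x * χ x ^ 2 := by
      rw [← integral_finsetSum _ fun j _ => hAi j,
        ← integral_add (integrable_finsetSum _ fun j _ => hAi j) hvi]
      simp only [hI, ← Finset.sum_mul, sum_sq_vecPot_sub, ← add_mul]
    rw [hIe]
    simp only [hk, Finset.sum_add_distrib, ← Finset.mul_sum] at h
    linarith
  -- Once lam (lam (-I) - N) ≥ T, the bound T + lam² I is at most -lam N, which gives e ≤ -lam.
  have hlim : Tendsto (fun lam : ℝ => lam * (lam * (-I) - N)) atTop atTop :=
    tendsto_id.atTop_mul_atTop₀ (tendsto_atTop_add_const_right _ _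
      (tendsto_id.atTop_mul_const (neg_pos.2 hneg)))
  filter_upwards [hlim.eventually_ge_atTop T] with lam hlam e φ hgs
  have := hbound lam e φ hgs
  by_contra hcon
  push Not at hcon
  have := mul_lt_mul_of_pos_right hcon hpos
  nlinarith

end Trial

end MagneticWell

namespace MagneticWell

open Set Topology

/-! ### Reduction to the half line -/

section Reduction

/-- The profile of a radial function as a function of `s = ‖x‖²`. -/
noncomputable def profile (v : Plane → ℝ) (s : ℝ) : ℝ :=
  v (√s • EuclideanSpace.single 0 1)

/-- The coefficient `q` of the reduced radial equation `(s φ')' = q φ` in `s = ‖x‖²`. -/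
noncomputable def radialCoeff (lam e : ℝ) (v : Plane → ℝ) (s : ℝ) : ℝ :=
  (lam ^ 2 * s / 4 + lam ^ 2 * profile v s - e) / 4

lemma measurable_profile {v : Plane → ℝ} (hv : Measurable v) : Measurable (profile v) :=
  hv.comp (by fun_prop)

lemma measurable_radialCoeff {v : Plane → ℝ} (hv : Measurable v) (lam e : ℝ) :
    Measurable (radialCoeff lam e v) := by
  have := measurable_profile hv
  unfold radialCoeff
  fun_prop

lemma profile_normSq {v : Plane → ℝ} (hv : ∀ x y, ‖x‖ = ‖y‖ → v x = v y) (x : Plane) :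
    profile v (‖x‖ ^ 2) = v x := by
  refine hv _ _ ?_
  rw [norm_smul, Real.sqrt_sq (norm_nonneg x)]
  simp

variable {lam e a : ℝ} {v : Plane → ℝ} {ψ : Plane → ℂ}

/-- The action of the radial operator on a test function. -/
noncomputable def radialOp (q χ : ℝ → ℝ) (s : ℝ) : ℝ :=
  -(s * deriv (deriv χ) s + deriv χ s) + q s * χ s

lemma oneWell_radial_sub (hv : ∀ x y, ‖x‖ = ‖y‖ → v x = v y) {χ : ℝ → ℝ} (hχ : ContDiff ℝ ∞ χ)
    (lam e : ℝ) (x : Plane) :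
    oneWell lam lam v (fun x => ((χ (‖x‖ ^ 2) : ℝ) : ℂ)) x - e * ((χ (‖x‖ ^ 2) : ℝ) : ℂ)
      = ((4 * radialOp (radialCoeff lam e v) χ (‖x‖ ^ 2) : ℝ) : ℂ) := by
  rw [oneWell_radial hχ, radialOp, radialCoeff, profile_normSq hv]
  push_cast
  ring

/-- Only radial test functions are needed, and they turn the eigenvalue equation into an identity on
the half line. Since χ is free at s = 0, the identity also encodes the vanishing of the flux there
and so excludes the logarithmic solution. -/
lemma weak_radial (hv : IsRadialWell v a) (hgs : IsGroundState lam lam v e ψ) {g : ℝ → ℂ}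
    (hg : ψ =ᵐ[volume] fun x => g (‖x‖ ^ 2)) {χ : ℝ → ℝ} (hχ : ContDiff ℝ ∞ χ)
    (hχc : HasCompactSupport χ) :
    IntegrableOn (fun s => (radialOp (radialCoeff lam e v) χ s : ℂ) * g s) (Ioi 0) ∧
      ∫ s in Ioi (0 : ℝ), (radialOp (radialCoeff lam e v) χ s : ℂ) * g s = 0 := by
  set η : Plane → ℂ := fun x => ((χ (‖x‖ ^ 2) : ℝ) : ℂ) with hη
  have hηs : ContDiff ℝ ∞ η := contDiff_radial hχ
  have hηc : HasCompactSupport η := hasCompactSupport_radial hχc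
  obtain ⟨h1, h2, h3⟩ := hgs.eigen
  have h4 := h3 η hηs hηc
  have i1 := integrable_conj_mul (memLp_oneWell (lam := lam) (b := lam) hv.measurable
    hv.abs_bounded hηs hηc) h1
  have i2 := integrable_conj_mul (memLp_of_smooth hηs.continuous hηc) h2
  have key : (fun x => conj (oneWell lam lam v η x) * ψ x - conj (η x) * (e * ψ x))
      =ᵐ[volume] fun x => (fun s => (4 : ℝ) •
        ((radialOp (radialCoeff lam e v) χ s : ℂ) * g s)) (‖x‖ ^ 2) := by
    filter_upwards [hg] with x hx
    have h5 := congrArg conj (oneWell_radial_sub hv.radial hχ lam e x)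
    simp only [map_sub, map_mul, Complex.conj_ofReal] at h5
    rw [hx]
    have h6 : conj (η x) = ((χ (‖x‖ ^ 2) : ℝ) : ℂ) := Complex.conj_ofReal _
    rw [h6, Complex.real_smul]
    push_cast at h5 ⊢
    linear_combination g (‖x‖ ^ 2) * h5
  have hint := (i1.sub i2).congr key
  have hz := integral_congr_ae key
  have h4' : (∫ x, conj (oneWell lam lam v η x) * ψ x) = ∫ x, conj (η x) * (e * ψ x) := h4
  rw [integral_sub i1 i2, sub_eq_zero.2 h4',
    integral_normSq (fun s => (4 : ℝ) • ((radialOp (radialCoeff lam e v) χ s : ℂ) * g s))] at hz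
  rw [integrable_normSq (h := fun s => (4 : ℝ) • ((radialOp (radialCoeff lam e v) χ s : ℂ) * g s))]
    at hint
  refine ⟨(integrable_smul_iff (four_ne_zero : (4 : ℝ) ≠ 0) _).1 hint, ?_⟩
  rw [integral_smul, eq_comm, smul_eq_zero, or_iff_right Real.pi_pos.ne', smul_eq_zero,
    or_iff_right (by norm_num)] at hz
  exact hz

lemma weak_radial_re (hv : IsRadialWell v a) (hgs : IsGroundState lam lam v e ψ) {g : ℝ → ℂ}
    (hg : ψ =ᵐ[volume] fun x => g (‖x‖ ^ 2)) {χ : ℝ → ℝ} (hχ : ContDiff ℝ ∞ χ)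
    (hχc : HasCompactSupport χ) :
    ∫ s in Ioi (0 : ℝ), radialOp (radialCoeff lam e v) χ s * (g s).re = 0 := by
  obtain ⟨h1, h2⟩ := weak_radial hv hgs hg hχ hχc
  have := Complex.reCLM.integral_comp_comm h1
  rw [h2] at this
  simpa using this

lemma weak_radial_im (hv : IsRadialWell v a) (hgs : IsGroundState lam lam v e ψ) {g : ℝ → ℂ}
    (hg : ψ =ᵐ[volume] fun x => g (‖x‖ ^ 2)) {χ : ℝ → ℝ} (hχ : ContDiff ℝ ∞ χ)
    (hχc : HasCompactSupport χ) :
    ∫ s in Ioi (0 : ℝ), radialOp (radialCoeff lam e v) χ s * (g s).im = 0 := by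
  obtain ⟨h1, h2⟩ := weak_radial hv hgs hg hχ hχc
  have := Complex.imCLM.integral_comp_comm h1
  rw [h2] at this
  simpa using this

/-- Measurability of the profile comes from integrability: multiplied by a Gaussian the square
integrable ψ becomes integrable, `integrable_normSq` carries this to the half line, and the Gaussian
is divided out again. -/
lemma aestronglyMeasurable_radial (hψ : MemLp ψ 2 volume) {g : ℝ → ℂ}
    (hg : ψ =ᵐ[volume] fun x => g (‖x‖ ^ 2)) :
    AEStronglyMeasurable g (volume.restrict (Ioi (0 : ℝ))) := by
  have h1 : MemLp (fun x : Plane => ((Real.exp (-‖x‖ ^ 2) : ℝ) : ℂ)) 2 volume := by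
    rw [memLp_two_iff_integrable_sq_norm (by fun_prop)]
    have h2 : ∀ x : Plane, ‖((Real.exp (-‖x‖ ^ 2) : ℝ) : ℂ)‖ ^ 2
        = (fun s => Real.exp (-2 * s)) (‖x‖ ^ 2) := by
      intro x
      rw [Complex.norm_real, Real.norm_eq_abs, sq_abs, ← Real.exp_nat_mul]
      congr 1; push_cast; ring
    simp only [h2]
    exact (integrable_normSq (h := fun s => Real.exp (-2 * s))).2
      (integrableOn_exp_mul_Ioi (by norm_num) 0)
  have h3 := h1.integrable_mul hψ
  have h4 : Integrable (fun x : Plane =>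
      (fun s => ((Real.exp (-s) : ℝ) : ℂ) * g s) (‖x‖ ^ 2)) := by
    refine h3.congr ?_
    filter_upwards [hg] with x hx
    simp only [Pi.mul_apply, hx]
  have h5 := (integrable_normSq (h := fun s => ((Real.exp (-s) : ℝ) : ℂ) * g s)|>.1 h4).aestronglyMeasurable
  have h6 : g = fun s => ((Real.exp s : ℝ) : ℂ) * (((Real.exp (-s) : ℝ) : ℂ) * g s) := by
    ext s
    rw [← mul_assoc, ← Complex.ofReal_mul, ← Real.exp_add]
    simp
  rw [h6]
  refine AEStronglyMeasurable.mul ?_ h5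
  exact (Complex.continuous_ofReal.comp Real.continuous_exp).aestronglyMeasurable

lemma integrableOn_sq_radial (hψ : MemLp ψ 2 volume) {g : ℝ → ℂ}
    (hg : ψ =ᵐ[volume] fun x => g (‖x‖ ^ 2)) : IntegrableOn (fun s => ‖g s‖ ^ 2) (Ioi 0) := by
  rw [← integrable_normSq]
  refine (hψ.integrable_norm_pow two_ne_zero).congr ?_
  filter_upwards [hg] with x hx
  simp [hx]

lemma integral_sq_radial (hn : ∫ x, ‖ψ x‖ ^ 2 = 1) {g : ℝ → ℂ}
    (hg : ψ =ᵐ[volume] fun x => g (‖x‖ ^ 2)) :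
    Real.pi * ∫ s in Ioi (0 : ℝ), ‖g s‖ ^ 2 = 1 := by
  rw [← hn, ← smul_eq_mul, ← integral_normSq (fun s => ‖g s‖ ^ 2)]
  refine integral_congr_ae ?_
  filter_upwards [hg] with x hx
  simp [hx]

/-- The variational bound is applied to χ(|x|²) and then integrated by parts once. -/
lemma form_nonneg (hv : IsRadialWell v a) (hgs : IsGroundState lam lam v e ψ) {χ : ℝ → ℝ}
    (hχ : ContDiff ℝ ∞ χ) (hχc : HasCompactSupport χ) :
    0 ≤ ∫ s in Ioi (0 : ℝ), (s * deriv χ s ^ 2 + radialCoeff lam e v s * χ s ^ 2) := by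
  set η : Plane → ℂ := fun x => ((χ (‖x‖ ^ 2) : ℝ) : ℂ) with hη
  have hηs : ContDiff ℝ ∞ η := contDiff_radial hχ
  have hηc : HasCompactSupport η := hasCompactSupport_radial hχc
  have hm := memLp_of_smooth hηs.continuous hηc
  have hb := hgs.bottom η _ (isImage_of_smooth (b := lam) (lam := lam) hv.measurable
    hv.abs_bounded hηs hηc)
  have hm2 := memLp_oneWell (lam := lam) (b := lam) hv.measurable hv.abs_bounded hηs hηc
  have i1 := integrable_conj_mul hm hm2
  have i2 : Integrable (fun x => conj (η x) * (e * η x)) := by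
    refine integrable_conj_mul hm (hm.const_mul _)
  have key : ∀ x, conj (η x) * oneWell lam lam v η x - conj (η x) * (e * η x)
      = (fun s => ((4 * (χ s * radialOp (radialCoeff lam e v) χ s) : ℝ) : ℂ)) (‖x‖ ^ 2) := by
    intro x
    have h5 := oneWell_radial_sub hv.radial hχ lam e x
    have h6 : conj (η x) = ((χ (‖x‖ ^ 2) : ℝ) : ℂ) := Complex.conj_ofReal _
    rw [h6]
    push_cast at h5 ⊢
    linear_combination (χ (‖x‖ ^ 2) : ℂ) * h5
  have hI : (∫ x, conj (η x) * (e * η x)) = ((e * ∫ x, ‖η x‖ ^ 2 : ℝ) : ℂ) := by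
    rw [← integral_const_mul, ← integral_complex_ofReal]
    congr 1; ext x
    have := Complex.mul_conj (η x)
    rw [Complex.normSq_eq_norm_sq] at this
    push_cast at this ⊢
    linear_combination (e : ℂ) * this
  have hdiff : ((∫ x, conj (η x) * oneWell lam lam v η x) - ∫ x, conj (η x) * (e * η x))
      = ((Real.pi * (4 * ∫ s in Ioi (0 : ℝ), χ s * radialOp (radialCoeff lam e v) χ s) : ℝ) : ℂ) := by
    rw [← integral_sub i1 i2]
    simp only [key]
    rw [integral_normSq
        (fun s => ((4 * (χ s * radialOp (radialCoeff lam e v) χ s) : ℝ) : ℂ)),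
      integral_complex_ofReal, integral_const_mul, Complex.real_smul]
    push_cast
    ring
  have h0 : 0 ≤ ∫ s in Ioi (0 : ℝ), χ s * radialOp (radialCoeff lam e v) χ s := by
    rw [hI] at hdiff
    have := congrArg Complex.re hdiff
    rw [Complex.sub_re, Complex.ofReal_re, Complex.ofReal_re] at this
    have h7 : 0 ≤ Real.pi * (4 * ∫ s in Ioi (0 : ℝ), χ s * radialOp (radialCoeff lam e v) χ s) := by
      rw [← this, sub_nonneg]; exact hb
    have := nonneg_of_mul_nonneg_right h7 Real.pi_pos
    linarith
  have hχ' : ContDiff ℝ ∞ (deriv χ) := by simpa using (contDiff_infty_iff_deriv.1 hχ).2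
  have hχ'' : ContDiff ℝ ∞ (deriv (deriv χ)) := by simpa using (contDiff_infty_iff_deriv.1 hχ').2
  -- The boundary term s χ' χ vanishes at the origin because of its weight, whatever the value of χ
  -- there.
  have hB : ContDiff ℝ 1 (fun s => s * deriv χ s * χ s) :=
    ((contDiff_id.mul (hχ'.of_le (by simp))).mul (hχ.of_le (by simp)))
  have hBs : HasCompactSupport (fun s => s * deriv χ s * χ s) := hχc.mul_left
  have hBi := hBs.integral_Ioi_deriv_eq hB 0
  have hBd : ∀ s, deriv (fun s => s * deriv χ s * χ s) s
      = (s * deriv (deriv χ) s + deriv χ s) * χ s + s * deriv χ s ^ 2 := by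
    intro s
    have d1 := (hχ.differentiable (by simp) s).hasDerivAt
    have d2 := (hχ'.differentiable (by simp) s).hasDerivAt
    have d3 : deriv (fun s => s * deriv χ s * χ s) s = _ := (((hasDerivAt_id s).mul d2).mul d1).deriv
    rw [d3]
    simp only [id, Pi.mul_apply]; ring
  simp only [zero_mul, neg_zero] at hBi
  have hBint : IntegrableOn (deriv (fun s => s * deriv χ s * χ s)) (Ioi 0) :=
    ((hB.continuous_deriv le_rfl).integrable_of_hasCompactSupport hBs.deriv).integrableOn
  have hRint : IntegrableOn (fun s => χ s * radialOp (radialCoeff lam e v) χ s) (Ioi 0) := by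
    have h8 := i1.sub i2
    have h9 : Integrable (fun x : Plane =>
        (fun s => ((4 * (χ s * radialOp (radialCoeff lam e v) χ s) : ℝ) : ℂ)) (‖x‖ ^ 2)) :=
      h8.congr (ae_of_all _ fun x => key x)
    have h10 : Integrable _ _ := ((integrable_normSq
      (h := fun s => ((4 * (χ s * radialOp (radialCoeff lam e v) χ s) : ℝ) : ℂ))).1 h9)
    replace h10 := h10.re
    have h11 : IntegrableOn (fun s => (4 : ℝ) • (χ s * radialOp (radialCoeff lam e v) χ s))
        (Ioi 0) := by simpa only [RCLike.re_to_complex, Complex.ofReal_re, smul_eq_mul] using! h10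
    exact (integrable_smul_iff (four_ne_zero : (4 : ℝ) ≠ 0) _).1 h11
  calc 0 ≤ ∫ s in Ioi (0 : ℝ), χ s * radialOp (radialCoeff lam e v) χ s := h0
    _ = (∫ s in Ioi (0 : ℝ), χ s * radialOp (radialCoeff lam e v) χ s)
        + ∫ s in Ioi (0 : ℝ), deriv (fun s => s * deriv χ s * χ s) s := by rw [hBi, add_zero]
    _ = ∫ s in Ioi (0 : ℝ), (s * deriv χ s ^ 2 + radialCoeff lam e v s * χ s ^ 2) := by
      rw [← integral_add hRint hBint]
      congr 1; ext s
      rw [hBd, radialOp]; ring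

end Reduction

end MagneticWell

namespace MagneticWell

open Set Topology

/-! ### Primitives, test functions and the du Bois-Reymond lemma -/

section WeakRegularity

/-- Integration by parts for two primitives of integrable functions. -/
lemma integral_primitive_mul_add {k l K L : ℝ → ℝ} {a b : ℝ}
    (hk : IntervalIntegrable k volume a b) (hl : IntervalIntegrable l volume a b)
    (hK : ∀ s ∈ uIcc a b, K s = K a + ∫ t in a..s, k t)
    (hL : ∀ s ∈ uIcc a b, L s = L a + ∫ t in a..s, l t) :
    ∫ s in a..b, (k s * L s + K s * l s) = K b * L b - K a * L a := by
  have aux : ∀ {m : ℝ → ℝ} (c : ℝ), IntervalIntegrable m volume a b →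
      AbsolutelyContinuousOnInterval (fun s => c + ∫ t in a..s, m t) a b := by
    intro m c hm
    have h1 := hm.absolutelyContinuousOnInterval_intervalIntegral (c := a) (by simp)
    have h2 : AbsolutelyContinuousOnInterval (fun _ : ℝ => c) a b :=
      (LipschitzWith.const c).lipschitzOnWith.absolutelyContinuousOnInterval
    exact h2.add h1
  have h := (aux (K a) hk).integral_deriv_mul_eq_sub (aux (L a) hl)
  rw [hK b (by simp), hL b (by simp)]
  have e : ∀ c : ℝ, c + ∫ t in a..a, k t = c := by simp
  simp only [intervalIntegral.integral_same, add_zero] at h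
  rw [← h]
  refine intervalIntegral.integral_congr_ae ?_
  filter_upwards [hk.ae_hasDerivAt_integral, hl.ae_hasDerivAt_integral] with s h1 h2 hs
  have hs' := uIoc_subset_uIcc hs
  rw [((h1 hs' a (by simp)).const_add _).deriv, ((h2 hs' a (by simp)).const_add _).deriv,
    hK s hs', hL s hs']

/-- A smooth compactly supported function with vanishing integral has a smooth compactly supported
primitive. -/
lemma exists_primitive {θ : ℝ → ℝ} {A B : ℝ} (hθ : ContDiff ℝ ∞ θ)
    (hs : Function.support θ ⊆ Icc A B) (h0 : ∫ s, θ s = 0) :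
    ∃ χ : ℝ → ℝ, ContDiff ℝ ∞ χ ∧ Function.support χ ⊆ Icc A B ∧
      ∀ s, HasDerivAt χ (θ s) s := by
  have hc : HasCompactSupport θ := HasCompactSupport.of_support_subset_isCompact isCompact_Icc hs
  have hd : ∀ s, HasDerivAt (fun s => ∫ t in A..s, θ t) (θ s) s := fun s =>
    intervalIntegral.integral_hasDerivAt_right (hθ.continuous.intervalIntegrable _ _)
      (hθ.continuous.stronglyMeasurableAtFilter _ _) hθ.continuous.continuousAt
  have hz : ∀ s, s ∉ Icc A B → θ s = 0 := fun s hs' => by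
    by_contra h; exact hs' (hs h)
  refine ⟨fun s => ∫ t in A..s, θ t, ?_, ?_, hd⟩
  · rw [contDiff_infty_iff_deriv]
    refine ⟨fun s => (hd s).differentiableAt, ?_⟩
    rwa [show deriv (fun s => ∫ t in A..s, θ t) = θ from funext fun s => (hd s).deriv]
  · intro s hs'
    by_contra hcon
    apply hs'
    rcases lt_or_ge s A with h | h
    · change ∫ t in A..s, θ t = 0
      rw [intervalIntegral.integral_symm, intervalIntegral.integral_of_le h.le,
        ← integral_Ioc_eq_integral_Ioo.symm, neg_eq_zero]
      refine setIntegral_eq_zero_of_forall_eq_zero fun t ht => hz t fun h' => ?_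
      exact absurd h'.1 (not_le.2 ht.2)
    · have hB : B < s := by
        by_contra h'; exact hcon ⟨h, not_lt.1 h'⟩
      change ∫ t in A..s, θ t = 0
      rw [intervalIntegral.integral_of_le h, ← integral_Icc_eq_integral_Ioc, ← h0]
      refine setIntegral_eq_integral_of_forall_compl_eq_zero fun t ht => hz t fun h' => ?_
      exact ht ⟨h'.1, h'.2.trans hB.le⟩

lemma exists_support_subset_Icc {θ : ℝ → ℝ} (hc : HasCompactSupport θ) :
    ∃ R, 0 < R ∧ Function.support θ ⊆ Icc (-R) R := by
  obtain ⟨R, hR⟩ := hc.isCompact.isBounded.subset_closedBall 0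
  refine ⟨max R 1, by positivity, fun s hs => ?_⟩
  have := hR (subset_tsupport _ hs)
  rw [mem_closedBall_zero_iff, Real.norm_eq_abs, abs_le] at this
  exact ⟨by have := le_max_left R 1; linarith, by have := le_max_left R 1; linarith⟩

/-- A smooth bump with unit integral supported around `c`. -/
lemma exists_unit_bump (c : ℝ) : ∃ ρ : ℝ → ℝ, ContDiff ℝ ∞ ρ ∧
    Function.support ρ ⊆ Icc (c - 1) (c + 1) ∧ ∫ s, ρ s = 1 := by
  let b : ContDiffBump c := ⟨1 / 2, 1, by norm_num, by norm_num⟩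
  refine ⟨b.normed volume, b.contDiff_normed, ?_, b.integral_normed⟩
  rw [b.support_normed_eq, Real.ball_eq_Ioo]
  exact Ioo_subset_Icc_self

/-- Every test function is, on the half line, the derivative of a test function. -/
lemma exists_halfLine_primitive {θ : ℝ → ℝ} (hθ : ContDiff ℝ ∞ θ) (hc : HasCompactSupport θ) :
    ∃ χ : ℝ → ℝ, ContDiff ℝ ∞ χ ∧ HasCompactSupport χ ∧
      ∀ s, 0 ≤ s → deriv χ =ᶠ[𝓝 s] θ := by
  obtain ⟨R, hR0, hR⟩ := exists_support_subset_Icc hc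
  -- This bump lives in [-3, -1], off the half line. Subtracting (∫ θ) ρ makes the integral vanish,
  -- so the primitive has compact support, while θ is unchanged for s > -1.
  obtain ⟨ρ, hρ, hρs, hρ1⟩ := exists_unit_bump (-2)
  have hρc : HasCompactSupport ρ := HasCompactSupport.of_support_subset_isCompact isCompact_Icc hρs
  have hi : Integrable θ := hθ.continuous.integrable_of_hasCompactSupport hc
  have hρi : Integrable ρ := hρ.continuous.integrable_of_hasCompactSupport hρc
  obtain ⟨χ, h1, h2, h3⟩ := exists_primitive (θ := fun s => θ s - (∫ t, θ t) * ρ s)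
    (A := -(R + 3)) (B := R) (hθ.sub (contDiff_const.mul hρ)) (by
      intro s hs
      by_contra hcon
      apply hs
      have e1 : θ s = 0 := by
        by_contra h; exact hcon ⟨by linarith [(hR h).1], (hR h).2⟩
      have e2 : ρ s = 0 := by
        by_contra h; exact hcon ⟨by linarith [(hρs h).1], by linarith [(hρs h).2]⟩
      simp [e1, e2]) (by
      rw [integral_sub hi (hρi.const_mul _), integral_const_mul, hρ1]; ring)
  refine ⟨χ, h1, HasCompactSupport.of_support_subset_isCompact isCompact_Icc h2, fun s hs => ?_⟩
  filter_upwards [lt_mem_nhds (show (-1 : ℝ) < s by linarith)] with t ht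
  have e2 : ρ t = 0 := by
    by_contra h; linarith [(hρs h).2]
  rw [(h3 t).deriv, e2]; ring

/-- Integrability on every bounded interval `(0, R]`. -/
def LocInt (f : ℝ → ℝ) : Prop := ∀ R : ℝ, IntegrableOn f (Ioc 0 R)

lemma LocInt.intervalIntegrable {f : ℝ → ℝ} (hf : LocInt f) {a b : ℝ} (ha : 0 ≤ a) (hb : 0 ≤ b) :
    IntervalIntegrable f volume a b := by
  rw [intervalIntegrable_iff]
  refine (hf (max a b)).mono_set ?_
  rw [uIoc]
  exact Ioc_subset_Ioc (le_min ha hb) le_rfl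

lemma LocInt.mul_test {f χ : ℝ → ℝ} (hf : LocInt f) (hχ : Continuous χ)
    (hχc : HasCompactSupport χ) : IntegrableOn (fun s => f s * χ s) (Ioi 0) := by
  obtain ⟨R, hR0, hR⟩ := exists_support_subset_Icc hχc
  obtain ⟨C, hC⟩ := hχ.bounded_above_of_compact_support hχc
  have h1 : IntegrableOn (fun s => f s * χ s) (Ioc 0 R) :=
    (hf R).mul_bdd (c := C) hχ.aestronglyMeasurable (ae_of_all _ hC)
  have h2 : IntegrableOn (fun s => f s * χ s) (Ioi R) := by
    refine integrableOn_zero.congr_fun (fun s hs => ?_) measurableSet_Ioi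
    have : χ s = 0 := by
      by_contra h; exact absurd (hR h).2 (not_le.2 hs)
    simp [this]
  have := h1.union h2
  rwa [Ioc_union_Ioi_eq_Ioi hR0.le] at this

lemma setIntegral_Ioi_eq_interval {f : ℝ → ℝ} {R : ℝ} (hR : 0 ≤ R) (h : ∀ s, R < s → f s = 0) :
    ∫ s in Ioi (0 : ℝ), f s = ∫ s in (0 : ℝ)..R, f s := by
  rw [intervalIntegral.integral_of_le hR]
  refine (setIntegral_eq_of_subset_of_forall_sdiff_eq_zero measurableSet_Ioi Ioc_subset_Ioi_self
    fun s hs => h s ?_)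
  by_contra h'
  exact hs.2 ⟨hs.1, not_lt.1 h'⟩

/-- There is no boundary term at the origin because the primitive G starts from 0; χ need not vanish
there. -/
lemma LocInt.integral_mul_test {k G χ : ℝ → ℝ} (hk : LocInt k)
    (hG : ∀ s, 0 ≤ s → G s = ∫ t in (0 : ℝ)..s, k t) (hχ : ContDiff ℝ ∞ χ)
    (hχc : HasCompactSupport χ) :
    ∫ s in Ioi (0 : ℝ), k s * χ s = -∫ s in Ioi (0 : ℝ), G s * deriv χ s := by
  obtain ⟨R, hR0, hR⟩ := exists_support_subset_Icc hχc
  obtain ⟨R', hR0', hR'⟩ := exists_support_subset_Icc hχc.deriv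
  set S := max R R' + 1 with hS
  have hS0 : 0 < S := by positivity
  have hz : ∀ s, S ≤ s → χ s = 0 := fun s hs => by
    by_contra h; have := (hR h).2; have := le_max_left R R'; linarith
  have hz' : ∀ s, S ≤ s → deriv χ s = 0 := fun s hs => by
    by_contra h; have := (hR' h).2; have := le_max_right R R'; linarith
  have hd : Continuous (deriv χ) := hχ.continuous_deriv (by simp)
  have hk' := hk.intervalIntegrable le_rfl hS0.le
  have hl := hd.intervalIntegrable (μ := volume) 0 S
  have hG0 : G 0 = 0 := by rw [hG 0 le_rfl]; simp
  have h := integral_primitive_mul_add (K := G) (L := χ) hk' hl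
    (fun s hs => by
      rw [uIcc_of_le hS0.le] at hs
      rw [hG0, zero_add, hG s hs.1])
    (fun s _ => by
      rw [intervalIntegral.integral_deriv_eq_sub
        (fun t _ => hχ.differentiable (by simp) t) (hd.intervalIntegrable _ _)]
      ring)
  rw [hz S le_rfl, hG0, mul_zero, zero_mul, sub_zero] at h
  have hGc : ContinuousOn G (uIcc 0 S) := by
    refine (intervalIntegral.continuousOn_primitive_interval' hk' left_mem_uIcc).congr fun s hs => ?_
    rw [uIcc_of_le hS0.le] at hs
    exact hG s hs.1
  rw [intervalIntegral.integral_add (hk'.mul_continuousOn hχ.continuous.continuousOn)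
    (hl.continuousOn_mul hGc)] at h
  rw [setIntegral_Ioi_eq_interval hS0.le fun s hs => by rw [hz s hs.le, mul_zero],
    setIntegral_Ioi_eq_interval hS0.le fun s hs => by rw [hz' s hs.le, mul_zero]]
  linarith

/-- The lemma of du Bois-Reymond on the half line. -/
lemma LocInt.ae_eq_const {f : ℝ → ℝ} (hf : LocInt f)
    (h : ∀ τ : ℝ → ℝ, ContDiff ℝ ∞ τ → HasCompactSupport τ → tsupport τ ⊆ Ioi 0 →
      ∫ s in Ioi (0 : ℝ), f s * deriv τ s = 0) :
    ∃ c, ∀ᵐ s ∂volume.restrict (Ioi (0 : ℝ)), f s = c := by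
  obtain ⟨ρ, hρ, hρs, hρ1⟩ := exists_unit_bump 2
  have hρc : HasCompactSupport ρ := HasCompactSupport.of_support_subset_isCompact isCompact_Icc hρs
  have hρi : Integrable ρ := hρ.continuous.integrable_of_hasCompactSupport hρc
  -- The candidate constant is the mean of f against a unit bump in [1, 3]. A test function θ
  -- corrected by (∫ θ) ρ is the derivative of an admissible τ, and testing with τ' gives ∫ f θ = c
  -- ∫ θ.
  set c := ∫ s in Ioi (0 : ℝ), f s * ρ s with hc
  refine ⟨c, ?_⟩
  have hfc : LocInt (fun s => f s - c) := fun R =>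
    (hf R).sub (integrableOn_const (by simp))
  have hloc : LocallyIntegrableOn (fun s => f s - c) (Ioi 0) := by
    intro s hs
    refine ⟨Ioc 0 (s + 1), mem_nhdsWithin_of_mem_nhds (Ioc_mem_nhds hs (by linarith)), hfc _⟩
  have key := isOpen_Ioi.ae_eq_zero_of_integral_contDiff_smul_eq_zero hloc (μ := volume) ?_
  · rw [ae_restrict_iff' measurableSet_Ioi]
    filter_upwards [key] with s hs hs'
    linarith [hs hs']
  intro θ hθ hθc hθs
  have hθi : Integrable θ := hθ.continuous.integrable_of_hasCompactSupport hθc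
  obtain ⟨δ, R, hδ, hδR⟩ : ∃ δ R : ℝ, 0 < δ ∧ Function.support θ ⊆ Icc δ R := by
    obtain ⟨R, hR0, hR⟩ := exists_support_subset_Icc hθc
    rcases (tsupport θ).eq_empty_or_nonempty with he | hne
    · exact ⟨1, R, one_pos, fun s hs => by
        have := subset_tsupport θ hs; rw [he] at this; exact this.elim⟩
    · obtain ⟨δ, hδ, hmin⟩ := hθc.isCompact.exists_isMinOn hne continuous_id.continuousOn
      exact ⟨δ, R, hθs hδ, fun s hs => ⟨hmin (subset_tsupport _ hs), (hR hs).2⟩⟩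
  obtain ⟨τ, h1, h2, h3⟩ := exists_primitive (θ := fun s => θ s - (∫ t, θ t) * ρ s)
    (A := min δ 1) (B := max R 3) (hθ.sub (contDiff_const.mul hρ)) (by
      intro s hs
      by_contra hcon
      apply hs
      have e1 : θ s = 0 := by
        by_contra h
        exact hcon ⟨(min_le_left _ _).trans (hδR h).1, (hδR h).2.trans (le_max_left _ _)⟩
      have e2 : ρ s = 0 := by
        by_contra h
        exact hcon ⟨(min_le_right _ _).trans (by linarith [(hρs h).1]),
          le_trans (by linarith [(hρs h).2]) (le_max_right R 3)⟩
      simp [e1, e2]) (by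
      rw [integral_sub hθi (hρi.const_mul _), integral_const_mul, hρ1]; ring)
  have hτs : tsupport τ ⊆ Ioi 0 := by
    refine (closure_minimal h2 isClosed_Icc).trans fun s hs => ?_
    exact lt_of_lt_of_le (by positivity) hs.1
  have h4 := h τ h1 (HasCompactSupport.of_support_subset_isCompact isCompact_Icc h2) hτs
  simp only [(h3 _).deriv] at h4
  have i1 := hf.mul_test hθ.continuous hθc
  have i2 := hf.mul_test hρ.continuous hρc
  have h5 : (∫ s in Ioi (0 : ℝ), f s * θ s) - (∫ t, θ t) * c = 0 := by
    rw [hc, ← integral_const_mul, ← integral_sub i1 (i2.const_mul _)]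
    refine Eq.trans ?_ h4
    refine integral_congr_ae (ae_of_all _ fun s => ?_)
    simp only; ring
  have h6 : ∫ s in Ioi (0 : ℝ), θ s = ∫ s, θ s := by
    refine setIntegral_eq_integral_of_forall_compl_eq_zero fun s hs => ?_
    by_contra h'; exact hs (hθs (subset_tsupport _ h'))
  have h7 : ∫ s, θ s • (f s - c) = ∫ s in Ioi (0 : ℝ), θ s • (f s - c) := by
    symm
    refine setIntegral_eq_integral_of_forall_compl_eq_zero fun s hs => ?_
    have : θ s = 0 := by
      by_contra h'; exact hs (hθs (subset_tsupport _ h'))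
    simp [this]
  rw [h7]
  refine Eq.trans ?_ h5
  rw [← h6, mul_comm _ c, ← integral_const_mul,
    ← integral_sub i1 (hθi.integrableOn.const_mul _)]
  refine integral_congr_ae (ae_of_all _ fun s => ?_)
  simp only [smul_eq_mul]; ring

end WeakRegularity

end MagneticWell

namespace MagneticWell

open Set Topology

/-! ### Regularity of weak solutions of the radial equation -/

section RadialEquation

/-- A measurable coefficient that is bounded on bounded intervals of the half line. -/
structure LocBdd (q : ℝ → ℝ) : Prop where
  measurable : Measurable q
  bound : ∀ R : ℝ, ∃ M, 0 ≤ M ∧ ∀ s, 0 ≤ s → s ≤ R → |q s| ≤ M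

/-- `φ` solves `(s φ')' = q φ` on the half line, with flux `p = s φ'` vanishing at the origin. -/
structure RadialSol (q φ p : ℝ → ℝ) : Prop where
  cont : ContinuousOn φ (Ici 0)
  flux : ∀ s, 0 ≤ s → p s = ∫ t in (0 : ℝ)..s, q t * φ t
  hasDerivAt : ∀ s, 0 < s → HasDerivAt φ (p s / s) s

lemma LocInt.of_sq {g : ℝ → ℝ} (hm : AEStronglyMeasurable g (volume.restrict (Ioi 0)))
    (hi : IntegrableOn (fun s => g s ^ 2) (Ioi 0)) : LocInt g := by
  intro R
  have h1 : IntegrableOn (fun s => 1 + g s ^ 2) (Ioc 0 R) :=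
    (integrableOn_const (by simp)).add (hi.mono_set Ioc_subset_Ioi_self)
  refine h1.mono' (hm.mono_measure (Measure.restrict_mono Ioc_subset_Ioi_self le_rfl))
    (ae_of_all _ fun s => ?_)
  rw [Real.norm_eq_abs]
  nlinarith [sq_abs (g s), sq_nonneg (|g s| - 1)]

lemma LocBdd.mul_locInt {q g : ℝ → ℝ} (hq : LocBdd q) (hg : LocInt g) :
    LocInt (fun s => q s * g s) := by
  intro R
  obtain ⟨M, -, hM⟩ := hq.bound R
  refine (hg R).bdd_mul (c := M) hq.measurable.aestronglyMeasurable ?_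
  rw [ae_restrict_iff' measurableSet_Ioc]
  exact ae_of_all _ fun s hs => hM s hs.1.le hs.2

lemma LocInt.continuousOn_primitive {k : ℝ → ℝ} (hk : LocInt k) :
    ContinuousOn (fun s => ∫ t in (0 : ℝ)..s, k t) (Ici 0) := by
  intro s hs
  have hs : 0 ≤ s := hs
  have h := intervalIntegral.continuousOn_primitive_interval'
    (hk.intervalIntegrable le_rfl (show (0 : ℝ) ≤ s + 1 by linarith)) left_mem_uIcc
  rw [uIcc_of_le (by linarith)] at h
  refine (h s ⟨hs, by linarith⟩).mono_of_mem_nhdsWithin ?_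
  rw [← Ici_inter_Iic]
  exact inter_mem self_mem_nhdsWithin (mem_nhdsWithin_of_mem_nhds (Iic_mem_nhds (by linarith)))

lemma LocInt.hasDerivAt_primitive {k : ℝ → ℝ} (hk : LocInt k) {s : ℝ} (hs : 0 < s)
    (hc : ContinuousOn k (Ioi 0)) : HasDerivAt (fun s => ∫ t in (0 : ℝ)..s, k t) (k s) s :=
  intervalIntegral.integral_hasDerivAt_right (hk.intervalIntegrable le_rfl hs.le)
    (hc.stronglyMeasurableAtFilter isOpen_Ioi s hs)
    (hc.continuousAt (Ioi_mem_nhds hs))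

/-- A square integrable function has a primitive growing at most like a square root. -/
lemma abs_integral_le_sqrt {q g : ℝ → ℝ} (hq : LocBdd q)
    (hi : IntegrableOn (fun s => g s ^ 2) (Ioi 0)) (R : ℝ) :
    ∃ C, 0 ≤ C ∧ ∀ s, 0 < s → s ≤ R → |∫ t in (0 : ℝ)..s, q t * g t| ≤ C * √s := by
  obtain ⟨M, hM0, hM⟩ := hq.bound R
  set N := ∫ s in Ioi (0 : ℝ), g s ^ 2 with hN
  have hN0 : 0 ≤ N := setIntegral_nonneg measurableSet_Ioi fun s _ => sq_nonneg _
  refine ⟨M * ((N + 1) / 2), by positivity, fun s hs hsR => ?_⟩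
  have hr : 0 < √s := Real.sqrt_pos.2 hs
  -- Weighted inequality 2|g| ≤ √s g² + 1/√s in place of Cauchy–Schwarz; over (0, s) both terms
  -- integrate to O(√s).
  have hb : ∀ t ∈ Ioc 0 s, |q t * g t| ≤ M * ((√s * g t ^ 2 + 1 / √s) / 2) := by
    intro t ht
    rw [abs_mul]
    refine mul_le_mul (hM t ht.1.le (ht.2.trans hsR)) ?_ (abs_nonneg _) hM0
    have h1 : 0 ≤ (√s * |g t| - 1) ^ 2 / √s := by positivity
    have h2 : (√s * |g t| - 1) ^ 2 / √s = √s * g t ^ 2 + 1 / √s - 2 * |g t| := by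
      rw [← sq_abs (g t)]; field_simp; ring
    linarith
  have hi' : IntervalIntegrable (fun t => g t ^ 2) volume 0 s := by
    rw [intervalIntegrable_iff_integrableOn_Ioc_of_le hs.le]
    exact hi.mono_set Ioc_subset_Ioi_self
  have hbi : IntervalIntegrable (fun t => M * ((√s * g t ^ 2 + 1 / √s) / 2)) volume 0 s :=
    (((hi'.const_mul _).add intervalIntegrable_const).div_const _).const_mul _
  have h1 := intervalIntegral.norm_integral_le_of_norm_le hs.le (f := fun t => q t * g t) (ae_of_all _ hb) hbi
  rw [Real.norm_eq_abs] at h1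
  refine h1.trans ?_
  rw [intervalIntegral.integral_const_mul, mul_assoc]
  refine mul_le_mul_of_nonneg_left ?_ hM0
  rw [intervalIntegral.integral_div, intervalIntegral.integral_add (hi'.const_mul _)
    intervalIntegrable_const, intervalIntegral.integral_const_mul, intervalIntegral.integral_const]
  have h2 : ∫ t in (0 : ℝ)..s, g t ^ 2 ≤ N := by
    rw [intervalIntegral.integral_of_le hs.le]
    exact setIntegral_mono_set hi (ae_of_all _ fun s => sq_nonneg _)
      (ae_of_all _ Ioc_subset_Ioi_self)
  have h3 : (s - 0) • (1 / √s) = √s := by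
    rw [smul_eq_mul, sub_zero, mul_one_div, Real.div_sqrt]
  rw [h3]
  nlinarith

lemma contDiff_div_self {τ : ℝ → ℝ} (hτ : ContDiff ℝ ∞ τ) (hs : tsupport τ ⊆ Ioi 0) :
    ContDiff ℝ ∞ (fun s => τ s / s) := by
  rw [contDiff_iff_contDiffAt]
  intro s
  rcases eq_or_ne s 0 with rfl | h
  · have h0 : (0 : ℝ) ∉ tsupport τ := fun h => lt_irrefl (0 : ℝ) (hs h)
    have := notMem_tsupport_iff_eventuallyEq.1 h0
    refine (contDiffAt_const (c := (0 : ℝ))).congr_of_eventuallyEq ?_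
    filter_upwards [this] with t ht
    simp [ht]
  · exact hτ.contDiffAt.div contDiffAt_id h

/-- A square integrable weak solution of the radial equation is a solution. -/
theorem exists_radialSol {q g : ℝ → ℝ} (hq : LocBdd q)
    (hm : AEStronglyMeasurable g (volume.restrict (Ioi 0)))
    (hi : IntegrableOn (fun s => g s ^ 2) (Ioi 0))
    (hw : ∀ χ : ℝ → ℝ, ContDiff ℝ ∞ χ → HasCompactSupport χ →
      ∫ s in Ioi (0 : ℝ), radialOp q χ s * g s = 0) :
    ∃ φ p, RadialSol q φ p ∧ ∀ᵐ s ∂volume.restrict (Ioi (0 : ℝ)), g s = φ s := by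
  have hg : LocInt g := LocInt.of_sq hm hi
  have hk : LocInt (fun s => q s * g s) := hq.mul_locInt hg
  set G : ℝ → ℝ := fun s => ∫ t in (0 : ℝ)..s, q t * g t with hG
  have hGc : ContinuousOn G (Ici 0) := hk.continuousOn_primitive
  have hGc' : ContinuousOn (fun s => G s / s) (Ioi 0) :=
    (hGc.mono Ioi_subset_Ici_self).div continuousOn_id fun s hs => (ne_of_gt hs)
  -- Here square integrability enters: G(s) = O(√s) makes G(s)/s = O(s^(-1/2)) integrable at the
  -- origin, so that H is defined and continuous up to 0.
  have hD : LocInt (fun s => G s / s) := by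
    intro R
    obtain ⟨C, hC0, hC⟩ := abs_integral_le_sqrt hq hi R
    rcases le_or_gt R 0 with hR | hR
    · rw [Ioc_eq_empty (not_lt.2 hR)]; exact integrableOn_empty
    have h1 : IntervalIntegrable (fun t : ℝ => C * t ^ (-(1 / 2) : ℝ)) volume 0 R :=
      (intervalIntegral.intervalIntegrable_rpow' (by norm_num)).const_mul _
    rw [intervalIntegrable_iff_integrableOn_Ioc_of_le hR.le] at h1
    refine h1.mono' ((hGc'.mono Ioc_subset_Ioi_self).aestronglyMeasurable measurableSet_Ioc) ?_
    rw [ae_restrict_iff' measurableSet_Ioc]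
    refine ae_of_all _ fun s hs => ?_
    rw [Real.norm_eq_abs, abs_div, abs_of_pos hs.1, div_le_iff₀ hs.1]
    refine (hC s hs.1 hs.2).trans (le_of_eq ?_)
    rw [mul_assoc, ← Real.rpow_add_one hs.1.ne', Real.sqrt_eq_rpow]
    norm_num
  set H : ℝ → ℝ := fun s => ∫ t in (0 : ℝ)..s, G t / t with hH
  have hHc : ContinuousOn H (Ici 0) := hD.continuousOn_primitive
  have hHl : LocInt H := fun R =>
    (((hHc.mono Icc_subset_Ici_self).integrableOn_compact isCompact_Icc)).mono_set Ioc_subset_Icc_self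
  have hf : LocInt (fun s => g s - H s) := fun R => (hg R).sub (hHl R)
  -- Choose χ with χ' = τ/s, so that (s χ')' = τ' and the weak equation reads ∫ q g χ = ∫ g τ'. Two
  -- integrations by parts give ∫ q g χ = -∫ G χ' = -∫ (G/s) τ = ∫ H τ'. Hence g - H is weakly
  -- constant.
  have hconst : ∃ c, ∀ᵐ s ∂volume.restrict (Ioi (0 : ℝ)), g s - H s = c := by
    refine hf.ae_eq_const fun τ hτ hτc hτs => ?_
    have hθ := contDiff_div_self hτ hτs
    have hθc : HasCompactSupport (fun s => τ s / s) := by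
      simp only [div_eq_mul_inv]; exact hτc.mul_right
    obtain ⟨χ, hχ, hχc, hχd⟩ := exists_halfLine_primitive hθ hθc
    have h1 := hk.integral_mul_test (G := G) (fun s _ => rfl) hχ hχc
    have h2 := hD.integral_mul_test (G := H) (fun s _ => rfl) hτ hτc
    have h3 := hw χ hχ hχc
    have hτ'c : Continuous (deriv τ) := hτ.continuous_deriv (by simp)
    have e1 : ∀ s ∈ Ioi (0 : ℝ), radialOp q χ s * g s
        = q s * g s * χ s - g s * deriv τ s := by
      intro s hs
      have hs : 0 < s := hs
      have h4 : deriv χ s = τ s / s := (hχd s hs.le).eq_of_nhds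
      have h5 : deriv (deriv χ) s = deriv (fun s => τ s / s) s := (hχd s hs.le).deriv_eq
      have h6 : deriv (fun s => τ s / s) s = (deriv τ s * s - τ s * 1) / s ^ 2 :=
        ((hτ.differentiable (by simp) s).hasDerivAt.div (hasDerivAt_id s) hs.ne').deriv
      rw [radialOp, h5, h6, h4]
      field_simp
      ring
    have e2 : ∀ s ∈ Ioi (0 : ℝ), G s * deriv χ s = G s / s * τ s := by
      intro s hs
      have h4 : deriv χ s = τ s / s := (hχd s (le_of_lt hs)).eq_of_nhds
      rw [h4]; ring
    rw [setIntegral_congr_fun measurableSet_Ioi e1,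
      integral_sub (hk.mul_test hχ.continuous hχc) (hg.mul_test hτ'c hτc.deriv), h1,
      setIntegral_congr_fun measurableSet_Ioi e2, h2] at h3
    simp only [sub_mul]
    rw [integral_sub (hg.mul_test hτ'c hτc.deriv) (hHl.mul_test hτ'c hτc.deriv)]
    linarith
  obtain ⟨c, hc⟩ := hconst
  have hae : ∀ᵐ s ∂volume.restrict (Ioi (0 : ℝ)), g s = c + H s := by
    filter_upwards [hc] with s hs
    linarith
  refine ⟨fun s => c + H s, G, ⟨continuousOn_const.add hHc, fun s hs => ?_, fun s hs => ?_⟩, hae⟩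
  · refine intervalIntegral.integral_congr_ae ?_
    rw [ae_restrict_iff' measurableSet_Ioi] at hae
    filter_upwards [hae] with t ht ht'
    rw [uIoc_of_le hs] at ht'
    rw [ht ht'.1]
  · exact (hD.hasDerivAt_primitive hs hGc').const_add c

end RadialEquation

end MagneticWell

namespace MagneticWell

open Set Topology

/-! ### Uniqueness and a priori bounds for solutions -/

section Solutions

variable {q φ p : ℝ → ℝ}

lemma LocInt.of_continuousOn {f : ℝ → ℝ} (hf : ContinuousOn f (Ici 0)) : LocInt f := fun _ =>
  ((hf.mono Icc_subset_Ici_self).integrableOn_compact isCompact_Icc).mono_set Ioc_subset_Icc_self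

lemma RadialSol.locInt (h : RadialSol q φ p) (hq : LocBdd q) : LocInt (fun s => q s * φ s) :=
  hq.mul_locInt (LocInt.of_continuousOn h.cont)

lemma RadialSol.cont_flux (h : RadialSol q φ p) (hq : LocBdd q) : ContinuousOn p (Ici 0) :=
  (h.locInt hq).continuousOn_primitive.congr fun s hs => h.flux s hs

lemma RadialSol.flux_zero (h : RadialSol q φ p) : p 0 = 0 := by
  rw [h.flux 0 le_rfl]; simp

lemma RadialSol.flux_sub (h : RadialSol q φ p) (hq : LocBdd q) {r s : ℝ} (hr : 0 ≤ r) (hs : 0 ≤ s) :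
    p s - p r = ∫ t in r..s, q t * φ t := by
  rw [h.flux s hs, h.flux r hr]
  exact intervalIntegral.integral_interval_sub_left ((h.locInt hq).intervalIntegrable le_rfl hs)
    ((h.locInt hq).intervalIntegrable le_rfl hr)

lemma RadialSol.abs_flux_le (h : RadialSol q φ p) {M B s : ℝ} (hs : 0 ≤ s)
    (hM : ∀ t, 0 ≤ t → t ≤ s → |q t| ≤ M) (hB : ∀ t, 0 ≤ t → t ≤ s → |φ t| ≤ B) :
    |p s| ≤ M * B * s := by
  rw [h.flux s hs]
  have := intervalIntegral.norm_integral_le_of_norm_le_const (a := 0) (b := s) (C := M * B)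
    (f := fun t => q t * φ t) (fun t ht => by
      rw [uIoc_of_le hs] at ht
      rw [Real.norm_eq_abs, abs_mul]
      exact mul_le_mul (hM t ht.1.le ht.2) (hB t ht.1.le ht.2) (abs_nonneg _)
        ((abs_nonneg _).trans (hM t ht.1.le ht.2)))
  rwa [Real.norm_eq_abs, sub_zero, abs_of_nonneg hs] at this

lemma RadialSol.exists_bound (h : RadialSol q φ p) (R : ℝ) :
    ∃ B, 0 ≤ B ∧ ∀ s, 0 ≤ s → s ≤ R → |φ s| ≤ B := by
  obtain ⟨B, hB⟩ := isCompact_Icc.exists_bound_of_continuousOn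
    (h.cont.mono (Icc_subset_Ici_self : Icc 0 R ⊆ Ici 0))
  exact ⟨max B 0, le_max_right _ _, fun s hs hsR => (hB s ⟨hs, hsR⟩).trans (le_max_left _ _)⟩

lemma RadialSol.locInt_slope (h : RadialSol q φ p) (hq : LocBdd q) :
    LocInt (fun s => p s / s) := by
  intro R
  obtain ⟨B, hB0, hB⟩ := h.exists_bound R
  obtain ⟨M, hM0, hM⟩ := hq.bound R
  refine (integrable_const (M * B)).mono' ((((h.cont_flux hq).mono (Ioc_subset_Icc_self.trans Icc_subset_Ici_self)).div continuousOn_id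
      fun s hs => hs.1.ne').aestronglyMeasurable measurableSet_Ioc) ?_
  rw [ae_restrict_iff' measurableSet_Ioc]
  refine ae_of_all _ fun s hs => ?_
  rw [Real.norm_eq_abs, abs_div, abs_of_pos hs.1, div_le_iff₀ hs.1]
  exact h.abs_flux_le hs.1.le (fun t ht ht' => hM t ht (ht'.trans hs.2))
    (fun t ht ht' => hB t ht (ht'.trans hs.2))

lemma RadialSol.sub_eq (h : RadialSol q φ p) (hq : LocBdd q) {r s : ℝ} (hr : 0 ≤ r) (hrs : r ≤ s) :
    φ s - φ r = ∫ t in r..s, p t / t := by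
  refine (intervalIntegral.integral_eq_sub_of_hasDerivAt_of_le hrs
    (h.cont.mono fun t ht => hr.trans ht.1) (fun t ht => h.hasDerivAt t (hr.trans_lt ht.1))
    ((h.locInt_slope hq).intervalIntegrable hr (hr.trans hrs))).symm

/-- A solution vanishing at the origin vanishes. -/
lemma RadialSol.eq_zero (h : RadialSol q φ p) (hq : LocBdd q) (h0 : φ 0 = 0) {s : ℝ}
    (hs : 0 ≤ s) : φ s = 0 := by
  obtain ⟨B, hB0, hB⟩ := h.exists_bound s
  obtain ⟨M, hM0, hM⟩ := hq.bound s
  -- Picard iteration: passing through the flux and then through the slope turns the n-th bound into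
  -- the next one. The second integration gains a further 1/(n+1), which is discarded.
  have key : ∀ n : ℕ, ∀ r, 0 ≤ r → r ≤ s → |φ r| ≤ B * (M * r) ^ n / n.factorial := by
    intro n
    induction n with
    | zero => intro r hr hrs; simpa using hB r hr hrs
    | succ n ih =>
      have hf : (0 : ℝ) < n.factorial := by positivity
      have h1 : ∀ t, 0 ≤ t → t ≤ s →
          |p t| ≤ B * M ^ (n + 1) * t ^ (n + 1) / ((n + 1).factorial) := by
        intro t ht hts
        have hb : ∀ x ∈ Ioc 0 t, ‖q x * φ x‖ ≤ (B * M ^ (n + 1) / n.factorial) * x ^ n := by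
          intro x hx
          rw [Real.norm_eq_abs, abs_mul]
          refine (mul_le_mul (hM x hx.1.le (hx.2.trans hts)) (ih x hx.1.le (hx.2.trans hts))
            (abs_nonneg _) hM0).trans (le_of_eq ?_)
          rw [mul_pow, pow_succ]; ring
        have h2 := intervalIntegral.norm_integral_le_of_norm_le ht (ae_of_all _ hb)
          (((continuous_const.mul (continuous_pow n)).intervalIntegrable (μ := volume) 0 t))
        rw [← h.flux t ht, Real.norm_eq_abs, intervalIntegral.integral_const_mul,
          integral_pow] at h2
        refine h2.trans (le_of_eq ?_)
        rw [Nat.factorial_succ]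
        push_cast
        field_simp
        ring
      intro r hr hrs
      have hb : ∀ x ∈ Ioc 0 r, ‖p x / x‖ ≤ (B * M ^ (n + 1) / (n + 1).factorial) * x ^ n := by
        intro x hx
        rw [Real.norm_eq_abs, abs_div, abs_of_pos hx.1, div_le_iff₀ hx.1]
        refine (h1 x hx.1.le (hx.2.trans hrs)).trans (le_of_eq ?_)
        rw [pow_succ x]; ring
      have h2 := intervalIntegral.norm_integral_le_of_norm_le hr (ae_of_all _ hb)
        (((continuous_const.mul (continuous_pow n)).intervalIntegrable (μ := volume) 0 r))
      rw [← h.sub_eq hq le_rfl hr, h0, sub_zero, Real.norm_eq_abs,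
        intervalIntegral.integral_const_mul, integral_pow] at h2
      refine h2.trans ?_
      rw [mul_pow, zero_pow (by omega), sub_zero]
      have h3 : r ^ (n + 1) / ((n : ℝ) + 1) ≤ r ^ (n + 1) :=
        div_le_self (by positivity) (by linarith [(n.cast_nonneg : (0 : ℝ) ≤ n)])
      have h4 : 0 ≤ B * M ^ (n + 1) / ((n + 1).factorial : ℝ) := by positivity
      calc _ = B * M ^ (n + 1) / ((n + 1).factorial : ℝ) * (r ^ (n + 1) / ((n : ℝ) + 1)) := by ring
        _ ≤ B * M ^ (n + 1) / ((n + 1).factorial : ℝ) * r ^ (n + 1) :=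
          mul_le_mul_of_nonneg_left h3 h4
        _ = _ := by ring
  have hlim : Tendsto (fun n : ℕ => B * (M * s) ^ n / n.factorial) atTop (𝓝 0) := by
    have := (FloorSemiring.tendsto_pow_div_factorial_atTop (M * s)).const_mul B
    simpa [mul_div_assoc] using this
  exact abs_eq_zero.1 (le_antisymm (ge_of_tendsto' hlim fun n => key n s hs le_rfl) (abs_nonneg _))

/-- Backward Grönwall inequality for the radial equation. -/
lemma RadialSol.gronwall (h : RadialSol q φ p) (hq : LocBdd q) {s s₁ M Λ c : ℝ} (hs : 0 < s)
    (hss : s ≤ s₁) (hΛ : 0 ≤ Λ) (hΛc : Λ ≤ c) (hMc : M ≤ c * Λ)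
    (hM : ∀ t, 0 ≤ t → t ≤ s₁ → |q t| ≤ M) :
    Λ * √s * |φ s| + |p s|
      ≤ (Λ * √s₁ * |φ s₁| + |p s₁|) * Real.exp (2 * c * (√s₁ - √s)) := by
  -- Both equations close on this quantity: φ' = p/t contributes at most Λ|p|/√t, and p' = q φ at
  -- most M|φ|; with Λ ≤ c and M ≤ c Λ their sum is at most c Y/√t. For M of order lam² one may take
  -- Λ and c of order lam, so the exponent grows only linearly in lam.
  set Y : ℝ → ℝ := fun t => Λ * √t * |φ t| + |p t| with hY
  have hc0 : 0 ≤ c := hΛ.trans hΛc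
  have hs₁ : 0 < s₁ := hs.trans_le hss
  have hφc : ContinuousOn φ (Icc s s₁) := h.cont.mono fun t ht => hs.le.trans ht.1
  have hpc : ContinuousOn p (Icc s s₁) := (h.cont_flux hq).mono fun t ht => hs.le.trans ht.1
  have hYc : ContinuousOn Y (Icc s s₁) :=
    ((continuousOn_const.mul Real.continuous_sqrt.continuousOn).mul hφc.abs).add hpc.abs
  have hwc : ContinuousOn (fun t => c * Y t / √t) (Icc s s₁) :=
    (continuousOn_const.mul hYc).div Real.continuous_sqrt.continuousOn
      fun t ht => (Real.sqrt_pos.2 (hs.trans_le ht.1)).ne'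
  have hwi : ∀ a ∈ Icc s s₁, ∀ b ∈ Icc s s₁,
      IntervalIntegrable (fun t => c * Y t / √t) volume a b := fun a ha b hb =>
    (hwc.mono (by rw [← uIcc_of_le hss] at ha hb ⊢; exact uIcc_subset_uIcc ha hb)).intervalIntegrable
  have hstep : ∀ t ∈ Icc s s₁, Y t ≤ Y s₁ + ∫ x in t..s₁, c * Y x / √x := by
    intro t ht
    have ht0 : 0 < t := hs.trans_le ht.1
    have hr : 0 < √t := Real.sqrt_pos.2 ht0
    have hsub : Icc t s₁ ⊆ Icc s s₁ := Icc_subset_Icc_left ht.1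
    have i1 : IntervalIntegrable (fun x => Λ * |p x| / √x) volume t s₁ := by
      refine ContinuousOn.intervalIntegrable ?_
      rw [uIcc_of_le ht.2]
      exact (continuousOn_const.mul (hpc.mono hsub).abs).div Real.continuous_sqrt.continuousOn
        fun x hx => (Real.sqrt_pos.2 (ht0.trans_le hx.1)).ne'
    have i2 : IntervalIntegrable (fun x => M * |φ x|) volume t s₁ := by
      refine ContinuousOn.intervalIntegrable ?_
      rw [uIcc_of_le ht.2]
      exact continuousOn_const.mul (hφc.mono hsub).abs
    have h1 : Λ * √t * |φ t| ≤ Λ * √s₁ * |φ s₁| + ∫ x in t..s₁, Λ * |p x| / √x := by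
      have e : |φ s₁ - φ t| ≤ ∫ x in t..s₁, |p x| / x := by
        rw [h.sub_eq hq ht0.le ht.2]
        refine (intervalIntegral.norm_integral_le_integral_norm (f := fun x => p x / x)
          ht.2).trans (le_of_eq (intervalIntegral.integral_congr fun x hx => ?_))
        rw [uIcc_of_le ht.2] at hx
        simp only [Real.norm_eq_abs, abs_div, abs_of_pos (ht0.trans_le hx.1)]
      have e2 : Λ * √t * ∫ x in t..s₁, |p x| / x ≤ ∫ x in t..s₁, Λ * |p x| / √x := by
        rw [← intervalIntegral.integral_const_mul]
        refine intervalIntegral.integral_mono_on ht.2 ?_ i1 fun x hx => ?_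
        · refine ContinuousOn.intervalIntegrable ?_
          rw [uIcc_of_le ht.2]
          exact continuousOn_const.mul ((hpc.mono hsub).abs.div continuousOn_id
            fun x hx => (ht0.trans_le hx.1).ne')
        · have hx0 : 0 < x := ht0.trans_le hx.1
          have hrx : 0 < √x := Real.sqrt_pos.2 hx0
          have : √t ≤ √x := Real.sqrt_le_sqrt hx.1
          rw [div_eq_mul_inv, div_eq_mul_inv]
          have e3 : √t * x⁻¹ ≤ (√x)⁻¹ := by
            rw [← div_eq_mul_inv, div_le_iff₀ hx0]
            nth_rewrite 2 [← Real.mul_self_sqrt hx0.le]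
            rw [← mul_assoc, inv_mul_cancel₀ hrx.ne', one_mul]
            exact this
          calc Λ * √t * (|p x| * x⁻¹) = Λ * |p x| * (√t * x⁻¹) := by ring
            _ ≤ Λ * |p x| * (√x)⁻¹ := mul_le_mul_of_nonneg_left e3 (by positivity)
      have e4 : |φ t| ≤ |φ s₁| + |φ s₁ - φ t| := by
        have := abs_sub_abs_le_abs_sub (φ t) (φ s₁)
        rw [abs_sub_comm] at this
        linarith
      have e5 : √t ≤ √s₁ := Real.sqrt_le_sqrt ht.2
      calc Λ * √t * |φ t| ≤ Λ * √t * (|φ s₁| + ∫ x in t..s₁, |p x| / x) := by gcongr; linarith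
        _ = Λ * √t * |φ s₁| + Λ * √t * ∫ x in t..s₁, |p x| / x := by ring
        _ ≤ _ := by gcongr
    have h2 : |p t| ≤ |p s₁| + ∫ x in t..s₁, M * |φ x| := by
      have e : |p s₁ - p t| ≤ ∫ x in t..s₁, M * |φ x| := by
        rw [h.flux_sub hq ht0.le hs₁.le]
        refine intervalIntegral.norm_integral_le_of_norm_le (f := fun x => q x * φ x) ht.2
          (ae_of_all _ fun x hx => ?_) i2
        rw [Real.norm_eq_abs, abs_mul]
        exact mul_le_mul_of_nonneg_right (hM x (ht0.trans hx.1).le hx.2) (abs_nonneg _)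
      have := abs_sub_abs_le_abs_sub (p t) (p s₁)
      rw [abs_sub_comm] at this
      linarith
    have h3 : (∫ x in t..s₁, Λ * |p x| / √x) + ∫ x in t..s₁, M * |φ x|
        ≤ ∫ x in t..s₁, c * Y x / √x := by
      rw [← intervalIntegral.integral_add i1 i2]
      refine intervalIntegral.integral_mono_on ht.2 (i1.add i2)
        (hwi t ht s₁ ⟨hss, le_rfl⟩) fun x hx => ?_
      have hrx : 0 < √x := Real.sqrt_pos.2 (ht0.trans_le hx.1)
      have e : c * Y x / √x = c * |p x| / √x + c * Λ * |φ x| := by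
        simp only [hY]; field_simp; ring
      rw [e]
      gcongr
    simp only [hY] at h1 h2 h3 ⊢
    linarith
  set Z : ℝ → ℝ := fun t => Y s₁ + ∫ x in t..s₁, c * Y x / √x with hZ
  -- The majorant Z satisfies Z' = -c Y/√t ≥ -c Z/√t, and 2c√t has derivative c/√t, so the product
  -- is nondecreasing.
  have hmono : MonotoneOn (fun t => Z t * Real.exp (2 * c * √t)) (Icc s s₁) := by
    have hZd : ∀ t ∈ Ioo s s₁, HasDerivAt Z (-(c * Y t / √t)) t := by
      intro t ht
      have hmem : t ∈ Icc s s₁ := Ioo_subset_Icc_self ht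
      refine (intervalIntegral.integral_hasDerivAt_left (hwi t hmem s₁ ⟨hss, le_rfl⟩)
        ((hwc.mono Ioo_subset_Icc_self).stronglyMeasurableAtFilter isOpen_Ioo t ht)
        (hwc.continuousAt (Icc_mem_nhds ht.1 ht.2))).const_add _
    have hZc : ContinuousOn Z (Icc s s₁) := by
      have hi := hwi s ⟨le_rfl, hss⟩ s₁ ⟨hss, le_rfl⟩
      have := intervalIntegral.continuousOn_primitive_interval_left (μ := volume) (a := s) (b := s₁)
        (f := fun t => c * Y t / √t) (by
          rw [uIcc_of_le hss]; exact hwc.integrableOn_compact isCompact_Icc)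
      rw [uIcc_of_le hss] at this
      exact continuousOn_const.add this
    have hEd : ∀ t ∈ Ioo s s₁, HasDerivAt (fun t => Z t * Real.exp (2 * c * √t))
        (-(c * Y t / √t) * Real.exp (2 * c * √t)
          + Z t * (Real.exp (2 * c * √t) * (2 * c * (1 / (2 * √t))))) t := fun t ht =>
      (hZd t ht).mul (((Real.hasDerivAt_sqrt (hs.trans ht.1).ne').const_mul (2 * c)).exp)
    refine monotoneOn_of_deriv_nonneg (convex_Icc _ _) (hZc.mul (by fun_prop)) ?_ ?_
    · rw [interior_Icc]
      exact fun t ht => (hEd t ht).differentiableAt.differentiableWithinAt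
    · rw [interior_Icc]
      intro t ht
      rw [(hEd t ht).deriv]
      have hrt : 0 < √t := Real.sqrt_pos.2 (hs.trans ht.1)
      have h1 := hstep t (Ioo_subset_Icc_self ht)
      have e : -(c * Y t / √t) * Real.exp (2 * c * √t)
          + Z t * (Real.exp (2 * c * √t) * (2 * c * (1 / (2 * √t))))
          = c / √t * Real.exp (2 * c * √t) * (Z t - Y t) := by
        field_simp; ring
      rw [e]
      exact mul_nonneg (by positivity) (sub_nonneg.2 h1)
  have h1 := hmono ⟨le_rfl, hss⟩ ⟨hss, le_rfl⟩ hss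
  have h2 := hstep s ⟨le_rfl, hss⟩
  have h3 : Z s₁ = Y s₁ := by simp [hZ]
  simp only [h3] at h1
  have h4 : Y s * Real.exp (2 * c * √s) ≤ Y s₁ * Real.exp (2 * c * √s₁) :=
    (mul_le_mul_of_nonneg_right h2 (Real.exp_pos _).le).trans h1
  rw [mul_sub, Real.exp_sub, mul_div_assoc', le_div_iff₀ (Real.exp_pos _)]
  exact h4

/-- A solution with vanishing Cauchy data at a positive point vanishes at the origin. -/
lemma RadialSol.zero_of_cauchy (h : RadialSol q φ p) (hq : LocBdd q) {s₁ : ℝ} (hs₁ : 0 < s₁)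
    (h1 : φ s₁ = 0) (h2 : p s₁ = 0) : φ 0 = 0 := by
  obtain ⟨M, hM0, hM⟩ := hq.bound s₁
  have hz : ∀ s, 0 < s → s ≤ s₁ → φ s = 0 := by
    intro s hs hss
    have := h.gronwall hq (c := M + 1) (Λ := 1) hs hss zero_le_one (by linarith) (by linarith) hM
    rw [h1, h2] at this
    simp only [abs_zero, mul_zero, add_zero, zero_mul, one_mul] at this
    have h3 : 0 < √s := Real.sqrt_pos.2 hs
    have h4 : √s * |φ s| ≤ 0 := by linarith [abs_nonneg (p s)]
    have h5 : |φ s| ≤ 0 := by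
      by_contra hcon
      push Not at hcon
      linarith [mul_pos h3 hcon]
    exact abs_eq_zero.1 (le_antisymm h5 (abs_nonneg _))
  have hc : Tendsto φ (𝓝[>] 0) (𝓝 (φ 0)) :=
    (h.cont 0 self_mem_Ici).mono_left (nhdsWithin_mono _ Ioi_subset_Ici_self)
  refine tendsto_nhds_unique hc (tendsto_const_nhds.congr' ?_)
  filter_upwards [Ioc_mem_nhdsGT hs₁] with s hs
  exact (hz s hs.1 hs.2).symm

/-- Near the origin a solution is controlled by its value at the outer end. -/
lemma RadialSol.inner_bound (h : RadialSol q φ p) (hq : LocBdd q) {ε M : ℝ} (hε : 0 < ε)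
    (hM : ∀ t, 0 ≤ t → t ≤ ε → |q t| ≤ M) (hεM : M * ε ≤ 1 / 4) {s : ℝ} (hs : 0 ≤ s)
    (hsε : s ≤ ε) : |φ s| ≤ 2 * |φ ε| := by
  -- At a point r where |φ| is maximal on [0, ε], the slope bound |p/t| ≤ M|φ(r)| limits the change
  -- between r and ε to M ε |φ(r)|, a quarter of the maximum.
  obtain ⟨r, hr, hmax⟩ := isCompact_Icc.exists_isMaxOn (nonempty_Icc.2 hε.le)
    ((h.cont.mono (Icc_subset_Ici_self : Icc 0 ε ⊆ Ici 0)).abs)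
  have hB : ∀ t, 0 ≤ t → t ≤ ε → |φ t| ≤ |φ r| := fun t h1 h2 => hmax ⟨h1, h2⟩
  have hM0 : 0 ≤ M := (abs_nonneg _).trans (hM 0 le_rfl hε.le)
  have h1 : |φ ε - φ r| ≤ M * |φ r| * |ε - r| := by
    rw [h.sub_eq hq hr.1 hr.2]
    refine intervalIntegral.norm_integral_le_of_norm_le_const (f := fun x => p x / x)
      fun t ht => ?_
    rw [uIoc_of_le hr.2] at ht
    have ht0 : 0 < t := hr.1.trans_lt ht.1
    rw [Real.norm_eq_abs, abs_div, abs_of_pos ht0, div_le_iff₀ ht0]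
    exact h.abs_flux_le ht0.le (fun x hx hx' => hM x hx (hx'.trans ht.2))
      (fun x hx hx' => hB x hx (hx'.trans ht.2))
  have h2 : |ε - r| ≤ ε := by rw [abs_of_nonneg (by linarith [hr.2])]; linarith [hr.1]
  have h3 : M * |φ r| * |ε - r| ≤ 1 / 4 * |φ r| := by
    calc M * |φ r| * |ε - r| ≤ M * |φ r| * ε := by gcongr
      _ = M * ε * |φ r| := by ring
      _ ≤ _ := by gcongr
  have h4 : |φ r| - |φ ε| ≤ |φ ε - φ r| := by
    rw [abs_sub_comm]; exact abs_sub_abs_le_abs_sub _ _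
  have := hB s hs hsε
  have := abs_nonneg (φ r)
  linarith

end Solutions

end MagneticWell

namespace MagneticWell

open scoped Convolution
open Set Topology

/-! ### Positivity of the ground state -/

section Positivity

variable {q φ p : ℝ → ℝ}

/-- Smooth approximations, almost everywhere and boundedly, of a bounded measurable function with
bounded support. -/
lemma exists_mollification {d : ℝ → ℝ} (hd : Measurable d) {C A : ℝ} (hC : ∀ s, |d s| ≤ C)
    (hs : ∀ s, s ∉ Icc 0 A → d s = 0) :
    ∃ D : ℕ → ℝ → ℝ, (∀ n, ContDiff ℝ ∞ (D n)) ∧ (∀ n s, |D n s| ≤ C) ∧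
      (∀ n s, s ∉ Icc (-1) (A + 1) → D n s = 0) ∧
      ∀ᵐ s, Tendsto (fun n => D n s) atTop (𝓝 (d s)) := by
  have hC0 : 0 ≤ C := (abs_nonneg _).trans (hC 0)
  have hloc : LocallyIntegrable d volume := by
    intro x
    refine ⟨Metric.ball x 1, Metric.ball_mem_nhds x one_pos, ?_⟩
    exact Measure.integrableOn_of_bounded (M := C) measure_ball_lt_top.ne
      hd.aestronglyMeasurable (ae_of_all _ hC)
  -- Outer and inner radii stay in ratio 2; a bounded ratio is what almost everywhere convergence of
  -- the mollifications requires.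
  let b : ℕ → ContDiffBump (0 : ℝ) := fun n =>
    ⟨1 / 2 / ((n : ℝ) + 1), 1 / ((n : ℝ) + 1), by positivity, by gcongr; norm_num⟩
  have hbr : ∀ n, (b n).rOut ≤ 1 := fun n => by
    change 1 / ((n : ℝ) + 1) ≤ 1
    rw [div_le_one (by positivity)]; linarith [(n.cast_nonneg : (0 : ℝ) ≤ n)]
  have happ : ∀ n s (ε : ℝ), 0 ≤ ε → (∀ x ∈ Metric.ball s 1, |d x| ≤ ε) →
      |((b n).normed volume ⋆[ContinuousLinearMap.lsmul ℝ ℝ, volume] d) s| ≤ ε := by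
    intro n s ε hε h
    have := dist_convolution_le (μ := volume) (f := (b n).normed volume) (g := d) (x₀ := s)
      (R := 1) (z₀ := 0) hε (by
        rw [(b n).support_normed_eq]; exact Metric.ball_subset_ball (hbr n))
      (fun x => (b n).nonneg_normed x) (b n).integral_normed hd.aestronglyMeasurable
      (fun x hx => by rw [Real.dist_eq, sub_zero]; exact h x hx)
    rwa [Real.dist_eq, sub_zero] at this
  refine ⟨fun n => (b n).normed volume ⋆[ContinuousLinearMap.lsmul ℝ ℝ, volume] d,
    fun n => ?_, fun n s => happ n s C hC0 fun x _ => hC x, fun n s h => ?_, ?_⟩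
  · exact (b n).hasCompactSupport_normed.contDiff_convolution_left _ (b n).contDiff_normed hloc
  · refine abs_eq_zero.1 (le_antisymm (happ n s 0 le_rfl fun x hx => ?_) (abs_nonneg _))
    rw [hs x, abs_zero]
    intro hx'
    rw [Real.ball_eq_Ioo] at hx
    exact h ⟨by linarith [hx.2, hx'.1], by linarith [hx.1, hx'.2]⟩
  · refine ContDiffBump.ae_convolution_tendsto_right_of_locallyIntegrable (K := 2) ?_ ?_ hloc
    · exact tendsto_one_div_add_atTop_nhds_zero_nat
    · refine Eventually.of_forall fun n => le_of_eq ?_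
      change 1 / ((n : ℝ) + 1) = 2 * (1 / 2 / ((n : ℝ) + 1))
      ring

/-- The form inequality extends from test functions to Lipschitz functions of bounded support,
given through their derivative. -/
lemma form_nonneg_of_bounded (hq : LocBdd q)
    (hform : ∀ χ : ℝ → ℝ, ContDiff ℝ ∞ χ → HasCompactSupport χ →
      0 ≤ ∫ s in Ioi (0 : ℝ), (s * deriv χ s ^ 2 + q s * χ s ^ 2))
    {d : ℝ → ℝ} (hd : Measurable d) {C A : ℝ} (hC : ∀ s, |d s| ≤ C) (hA : 0 ≤ A)
    (hs : ∀ s, s ∉ Icc 0 A → d s = 0) :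
    0 ≤ ∫ s in Ioi (0 : ℝ), (s * d s ^ 2 + q s * (∫ t in Ioi s, d t) ^ 2) := by
  obtain ⟨D, hD, hDC, hDs, hDlim⟩ := exists_mollification hd hC hs
  have hC0 : 0 ≤ C := (abs_nonneg _).trans (hC 0)
  have hDc : ∀ n, HasCompactSupport (D n) := fun n =>
    HasCompactSupport.intro isCompact_Icc fun s hs => hDs n s hs
  -- The derivative is mollified, and the test functions are recovered as -∫ over (s, ∞) of D n. The
  -- sign is immaterial since only squares occur, and bounded convergence of the derivatives gives
  -- that of the functions.
  choose χ hχ hχc hχd using fun n => exists_halfLine_primitive (hD n) (hDc n)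
  have hχv : ∀ n s, 0 ≤ s → χ n s = -∫ t in Ioi s, D n t := by
    intro n s hs
    have h1 := (hχc n).integral_Ioi_deriv_eq ((hχ n).of_le (by simp)) s
    have h2 : ∫ t in Ioi s, deriv (χ n) t = ∫ t in Ioi s, D n t :=
      setIntegral_congr_fun measurableSet_Ioi fun t ht =>
        (hχd n t (hs.trans (le_of_lt ht))).eq_of_nhds
    rw [← h2, h1, neg_neg]
  set bd : ℝ → ℝ := (Icc (-1) (A + 1)).indicator fun _ => C with hbd
  have hbdi : Integrable bd :=
    (integrable_indicator_iff measurableSet_Icc).2 (integrableOn_const (by simp))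
  have hDbd : ∀ n s, ‖D n s‖ ≤ bd s := by
    intro n s
    by_cases h : s ∈ Icc (-1) (A + 1)
    · rw [hbd, indicator_of_mem h]; exact hDC n s
    · rw [hbd, indicator_of_notMem h, hDs n s h, norm_zero]
  have hχlim : ∀ s, 0 ≤ s → Tendsto (fun n => χ n s) atTop (𝓝 (-∫ t in Ioi s, d t)) := by
    intro s hs
    simp only [fun n => hχv n s hs]
    refine Tendsto.neg (tendsto_integral_of_dominated_convergence bd
      (fun n => (hD n).continuous.aestronglyMeasurable) hbdi.integrableOn
      (fun n => ae_of_all _ (hDbd n)) (ae_restrict_of_ae hDlim))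
  have hI : ∀ s, ∫ t in Ioi s, bd t ≤ C * (A + 2) := by
    intro s
    refine (setIntegral_le_integral hbdi (ae_of_all _ fun t => ?_)).trans (le_of_eq ?_)
    · exact indicator_nonneg (fun _ _ => hC0) t
    · rw [hbd, integral_indicator measurableSet_Icc, setIntegral_const, Measure.real,
        Real.volume_Icc, ENNReal.toReal_ofReal (by linarith), smul_eq_mul]
      ring
  have hχb : ∀ n s, 0 ≤ s → |χ n s| ≤ C * (A + 2) := by
    intro n s hs
    rw [hχv n s hs, abs_neg]
    exact (norm_integral_le_of_norm_le hbdi.integrableOn (ae_of_all _ (hDbd n))).trans (hI s)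
  obtain ⟨M, hM0, hM⟩ := hq.bound (A + 1)
  set B := (A + 1) * C ^ 2 + M * (C * (A + 2)) ^ 2 with hB
  have hlim : Tendsto (fun n => ∫ s in Ioi (0 : ℝ), (s * deriv (χ n) s ^ 2 + q s * χ n s ^ 2))
      atTop (𝓝 (∫ s in Ioi (0 : ℝ), (s * d s ^ 2 + q s * (∫ t in Ioi s, d t) ^ 2))) := by
    refine tendsto_integral_of_dominated_convergence ((Icc (-1) (A + 1)).indicator fun _ => B)
      (fun n => ?_) ?_ (fun n => ?_) ?_
    · have h1 : Continuous (deriv (χ n)) := (hχ n).continuous_deriv (by simp)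
      exact ((measurable_id.mul (h1.measurable.pow_const 2)).add
        (hq.measurable.mul ((hχ n).continuous.measurable.pow_const 2))).aestronglyMeasurable
    · exact ((integrable_indicator_iff measurableSet_Icc).2
        (integrableOn_const (by simp))).integrableOn
    · rw [ae_restrict_iff' measurableSet_Ioi]
      refine ae_of_all _ fun s hs => ?_
      have hs : 0 < s := hs
      rw [(hχd n s hs.le).eq_of_nhds]
      by_cases h : s ∈ Icc (-1) (A + 1)
      · rw [indicator_of_mem h]
        have e1 : |s * D n s ^ 2| ≤ (A + 1) * C ^ 2 := by
          rw [abs_mul, abs_of_pos hs, abs_pow]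
          exact mul_le_mul h.2 (pow_le_pow_left₀ (abs_nonneg _) (hDC n s) 2) (by positivity)
            (by linarith)
        have e2 : |q s * χ n s ^ 2| ≤ M * (C * (A + 2)) ^ 2 := by
          rw [abs_mul, abs_pow]
          exact mul_le_mul (hM s hs.le h.2) (pow_le_pow_left₀ (abs_nonneg _) (hχb n s hs.le) 2)
            (by positivity) hM0
        exact (abs_add_le _ _).trans (add_le_add e1 e2)
      · rw [indicator_of_notMem h, hDs n s h, hχv n s hs.le]
        have : ∫ t in Ioi s, D n t = 0 := by
          refine setIntegral_eq_zero_of_forall_eq_zero fun t ht => hDs n t fun ht' => h ?_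
          exact ⟨by linarith, (le_of_lt ht).trans ht'.2⟩
        simp [this]
    · rw [ae_restrict_iff' measurableSet_Ioi]
      filter_upwards [hDlim] with s h1 hs
      have hs : 0 < s := hs
      have h2 := (hχlim s hs.le).pow 2
      rw [neg_sq] at h2
      refine Tendsto.add (Tendsto.const_mul _ (Tendsto.pow (h1.congr fun n => ?_) 2))
        (h2.const_mul _)
      exact ((hχd n s hs.le).eq_of_nhds).symm
  exact ge_of_tendsto' hlim fun n => hform (χ n) (hχ n) (hχc n)

/-- At ε = x/(|c|+1) the linear term outweighs the quadratic one and the expression is negative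
unless x = 0. -/
lemma linear_zero_of_quadratic {x c : ℝ} (h : ∀ ε : ℝ, 0 ≤ -2 * ε * x + ε ^ 2 * c) : x = 0 := by
  have hc : 0 < |c| + 1 := by positivity
  have h1 := h (x / (|c| + 1))
  have h2 : c ≤ |c| := le_abs_self c
  have h3 : -2 * (x / (|c| + 1)) * x + (x / (|c| + 1)) ^ 2 * c
      = x ^ 2 / (|c| + 1) ^ 2 * (c - 2 * (|c| + 1)) := by field_simp; ring
  rw [h3] at h1
  by_contra hx
  have h4 : 0 < x ^ 2 / (|c| + 1) ^ 2 := by positivity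
  have h5 : c - 2 * (|c| + 1) < 0 := by linarith [abs_nonneg c]
  linarith [mul_neg_of_pos_of_neg h4 h5]

/-- If the quadratic form is nonnegative, the flux of a solution vanishes at its zeros. -/
lemma RadialSol.flux_eq_zero_of_zero (h : RadialSol q φ p) (hq : LocBdd q)
    (hform : ∀ χ : ℝ → ℝ, ContDiff ℝ ∞ χ → HasCompactSupport χ →
      0 ≤ ∫ s in Ioi (0 : ℝ), (s * deriv χ s ^ 2 + q s * χ s ^ 2))
    {s₀ : ℝ} (hs₀ : 0 < s₀) (hz : φ s₀ = 0) : p s₀ = 0 := by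
  obtain ⟨B, hB0, hB⟩ := h.exists_bound s₀
  obtain ⟨M, hM0, hM⟩ := hq.bound s₀
  have hpb : ∀ s, 0 < s → s ≤ s₀ → |p s / s| ≤ M * B := by
    intro s hs hss
    rw [abs_div, abs_of_pos hs, div_le_iff₀ hs]
    exact h.abs_flux_le hs.le (fun t ht ht' => hM t ht (ht'.trans hss))
      (fun t ht ht' => hB t ht (ht'.trans hss))
  have hll := h.locInt_slope hq
  have hkl := h.locInt hq
  have hw2c : IntervalIntegrable (fun s => q s * (s₀ + 1 - s) ^ 2) volume s₀ (s₀ + 1) :=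
    (hq.mul_locInt (LocInt.of_continuousOn (by fun_prop))).intervalIntegrable hs₀.le
      (by linarith)
  set c₀ := ∫ s in s₀..(s₀ + 1), (s + q s * (s₀ + 1 - s) ^ 2) with hc
  set c := (∫ s in (0 : ℝ)..s₀, q s) + c₀ with hc'
  refine linear_zero_of_quadratic (c := c) fun ε => ?_
  -- The tail integral of d is ε - φ on [0, s₀] and then the line ε (s₀ + 1 - s) down to 0. The part
  -- of φ on [0, s₀] alone has zero energy, because p φ vanishes at both ends; the form is therefore
  -- -2 ε p(s₀) + ε² c. Nonnegativity for every ε leaves p(s₀) = 0.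
  set d : ℝ → ℝ := fun s => (Ioc 0 s₀).indicator (fun s => p s / s) s
    + (Ioc s₀ (s₀ + 1)).indicator (fun _ => ε) s with hd
  have hd1 : ∀ s ∈ Ioc 0 s₀, d s = p s / s := by
    intro s hs
    have : s ∉ Ioc s₀ (s₀ + 1) := fun h' => absurd hs.2 (not_le.2 h'.1)
    simp only [hd, indicator_of_mem hs, indicator_of_notMem this, add_zero]
  have hd2 : ∀ s ∈ Ioc s₀ (s₀ + 1), d s = ε := by
    intro s hs
    have : s ∉ Ioc 0 s₀ := fun h' => absurd h'.2 (not_le.2 hs.1)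
    simp only [hd, indicator_of_mem hs, indicator_of_notMem this, zero_add]
  have hd3 : ∀ s, s₀ + 1 < s → d s = 0 := by
    intro s hs
    have h1 : s ∉ Ioc 0 s₀ := fun h' => absurd h'.2 (not_le.2 (by linarith))
    have h2 : s ∉ Ioc s₀ (s₀ + 1) := fun h' => absurd h'.2 (not_le.2 hs)
    simp only [hd, indicator_of_notMem h1, indicator_of_notMem h2, add_zero]
  have hd4 : ∀ s, s ≤ 0 → d s = 0 := by
    intro s hs
    have h1 : s ∉ Ioc 0 s₀ := fun h' => absurd h'.1 (not_lt.2 hs)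
    have h2 : s ∉ Ioc s₀ (s₀ + 1) := fun h' => absurd h'.1 (not_lt.2 (by linarith))
    simp only [hd, indicator_of_notMem h1, indicator_of_notMem h2, add_zero]
  have hdm : Measurable d := by
    have hcont : ContinuousOn (fun s => p s / s) (Ioc 0 s₀) :=
      ((h.cont_flux hq).mono fun s hs => hs.1.le).div continuousOn_id fun s hs => hs.1.ne'
    have e : (Ioc 0 s₀).indicator (fun s => p s / s)
        = (Ioc 0 s₀).piecewise (fun s => p s / s) fun _ => 0 := by
      ext s; simp [indicator, piecewise]
    have h1 : Measurable ((Ioc 0 s₀).indicator (fun s => p s / s)) := by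
      rw [e]
      exact hcont.measurable_piecewise continuousOn_const measurableSet_Ioc
    exact h1.add (measurable_const.indicator measurableSet_Ioc)
  have hdC : ∀ s, |d s| ≤ M * B + |ε| := by
    intro s
    have h0 : 0 ≤ M * B := by positivity
    rcases le_or_gt s 0 with h1 | h1
    · rw [hd4 s h1, abs_zero]; positivity
    rcases le_or_gt s s₀ with h2 | h2
    · rw [hd1 s ⟨h1, h2⟩]; linarith [hpb s h1 h2, abs_nonneg ε]
    rcases le_or_gt s (s₀ + 1) with h3 | h3
    · rw [hd2 s ⟨h2, h3⟩]; linarith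
    · rw [hd3 s h3, abs_zero]; positivity
  have hF := form_nonneg_of_bounded hq hform hdm hdC (A := s₀ + 1) (by linarith) (fun s hs => by
    by_contra hcon
    apply hs
    refine ⟨?_, ?_⟩
    · by_contra h'; exact hcon (hd4 s (by linarith))
    · by_contra h'; exact hcon (hd3 s (by linarith)))
  have hdi : ∀ a b, IntervalIntegrable d volume a b := fun a b => by
    rw [intervalIntegrable_iff]
    exact Measure.integrableOn_of_bounded (by simp) hdm.aestronglyMeasurable (ae_of_all _ hdC)
  have hW0 : ∀ s, 0 ≤ s → s ≤ s₀ + 1 → ∫ t in Ioi s, d t = ∫ t in s..(s₀ + 1), d t := by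
    intro s hs hs'
    rw [intervalIntegral.integral_of_le hs']
    refine setIntegral_eq_of_subset_of_forall_sdiff_eq_zero measurableSet_Ioi Ioc_subset_Ioi_self
      fun t ht => hd3 t ?_
    by_contra h'
    exact ht.2 ⟨ht.1, not_lt.1 h'⟩
  have hW2 : ∀ s ∈ Icc s₀ (s₀ + 1), ∫ t in Ioi s, d t = ε * (s₀ + 1 - s) := by
    intro s hs
    rw [hW0 s (hs₀.le.trans hs.1) hs.2]
    rw [intervalIntegral.integral_of_le hs.2, setIntegral_congr_fun (g := fun _ => ε)
      measurableSet_Ioc fun t ht => hd2 t ⟨hs.1.trans_lt ht.1, ht.2⟩,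
      ← intervalIntegral.integral_of_le hs.2, intervalIntegral.integral_const, smul_eq_mul, mul_comm]
  have hW1 : ∀ s ∈ Icc 0 s₀, ∫ t in Ioi s, d t = ε - φ s := by
    intro s hs
    rw [hW0 s hs.1 (by linarith [hs.2]),
      ← intervalIntegral.integral_add_adjacent_intervals (hdi s s₀) (hdi s₀ (s₀ + 1)),
      ← hW0 s₀ hs₀.le (by linarith), hW2 s₀ ⟨le_rfl, by linarith⟩]
    have : ∫ t in s..s₀, d t = φ s₀ - φ s := by
      rw [h.sub_eq hq hs.1 hs.2, intervalIntegral.integral_of_le hs.2,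
        intervalIntegral.integral_of_le hs.2]
      exact setIntegral_congr_fun measurableSet_Ioc fun t ht => hd1 t ⟨hs.1.trans_lt ht.1, ht.2⟩
    rw [this, hz]; ring
  have hfin : ∀ s, s₀ + 1 < s → s * d s ^ 2 + q s * (∫ t in Ioi s, d t) ^ 2 = 0 := by
    intro s hs
    have : ∫ t in Ioi s, d t = 0 :=
      setIntegral_eq_zero_of_forall_eq_zero fun t ht => hd3 t (hs.trans ht)
    rw [this, hd3 s hs]; ring
  rw [setIntegral_Ioi_eq_interval (by linarith : (0 : ℝ) ≤ s₀ + 1) hfin] at hF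
  have j1 : IntervalIntegrable (fun s => q s * φ s * φ s) volume 0 s₀ := by
    refine (hkl.intervalIntegrable le_rfl hs₀.le).mul_continuousOn ?_
    rw [uIcc_of_le hs₀.le]; exact h.cont.mono Icc_subset_Ici_self
  have j2 : IntervalIntegrable (fun s => p s * (p s / s)) volume 0 s₀ := by
    refine (hll.intervalIntegrable le_rfl hs₀.le).continuousOn_mul ?_
    rw [uIcc_of_le hs₀.le]; exact (h.cont_flux hq).mono Icc_subset_Ici_self
  have j3 : IntervalIntegrable q volume 0 s₀ := by
    have := (hq.mul_locInt (LocInt.of_continuousOn (f := fun _ => 1) continuousOn_const))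
      |>.intervalIntegrable le_rfl hs₀.le
    simpa using this
  have j4 := hkl.intervalIntegrable le_rfl hs₀.le
  have e1 : EqOn (fun s => s * d s ^ 2 + q s * (∫ t in Ioi s, d t) ^ 2)
      (fun s => (q s * φ s * φ s + p s * (p s / s)) - 2 * ε * (q s * φ s) + ε ^ 2 * q s)
      (Ioc 0 s₀) := by
    intro s hs
    have hs0 : s ≠ 0 := hs.1.ne'
    simp only
    rw [hd1 s hs, hW1 s (Ioc_subset_Icc_self hs)]
    field_simp
    ring
  have e2 : EqOn (fun s => s * d s ^ 2 + q s * (∫ t in Ioi s, d t) ^ 2)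
      (fun s => ε ^ 2 * (s + q s * (s₀ + 1 - s) ^ 2)) (Ioc s₀ (s₀ + 1)) := by
    intro s hs
    simp only
    rw [hd2 s hs, hW2 s (Ioc_subset_Icc_self hs)]
    ring
  have k1 : IntervalIntegrable
      (fun s => (q s * φ s * φ s + p s * (p s / s)) - 2 * ε * (q s * φ s) + ε ^ 2 * q s)
      volume 0 s₀ := (((j1.add j2).sub (j4.const_mul _)).add (j3.const_mul _))
  have k2 : IntervalIntegrable (fun s => ε ^ 2 * (s + q s * (s₀ + 1 - s) ^ 2))
      volume s₀ (s₀ + 1) :=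
    ((continuous_id.intervalIntegrable _ _).add hw2c).const_mul _
  have k1' : IntervalIntegrable (fun s => s * d s ^ 2 + q s * (∫ t in Ioi s, d t) ^ 2)
      volume 0 s₀ := by
    rw [intervalIntegrable_iff_integrableOn_Ioc_of_le hs₀.le] at k1 ⊢
    exact k1.congr_fun e1.symm measurableSet_Ioc
  have k2' : IntervalIntegrable (fun s => s * d s ^ 2 + q s * (∫ t in Ioi s, d t) ^ 2)
      volume s₀ (s₀ + 1) := by
    rw [intervalIntegrable_iff_integrableOn_Ioc_of_le (by linarith)] at k2 ⊢
    exact k2.congr_fun e2.symm measurableSet_Ioc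
  have l1 : ∫ s in (0 : ℝ)..s₀, (s * d s ^ 2 + q s * (∫ t in Ioi s, d t) ^ 2)
      = -2 * ε * p s₀ + ε ^ 2 * ∫ s in (0 : ℝ)..s₀, q s := by
    rw [intervalIntegral.integral_of_le hs₀.le, setIntegral_congr_fun measurableSet_Ioc e1,
      ← intervalIntegral.integral_of_le hs₀.le,
      intervalIntegral.integral_add ((j1.add j2).sub (j4.const_mul _)) (j3.const_mul _),
      intervalIntegral.integral_sub (j1.add j2) (j4.const_mul _),
      intervalIntegral.integral_const_mul, intervalIntegral.integral_const_mul,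
      ← h.flux s₀ hs₀.le]
    have hibp := integral_primitive_mul_add (K := p) (L := φ) j4
      (hll.intervalIntegrable le_rfl hs₀.le) (fun s hs => by
        rw [uIcc_of_le hs₀.le] at hs
        rw [h.flux_zero, zero_add, h.flux s hs.1]) (fun s hs => by
        rw [uIcc_of_le hs₀.le] at hs
        rw [← h.sub_eq hq le_rfl hs.1]; ring)
    rw [hibp, hz, h.flux_zero]
    ring
  have l2 : ∫ s in s₀..(s₀ + 1), (s * d s ^ 2 + q s * (∫ t in Ioi s, d t) ^ 2) = ε ^ 2 * c₀ := by
    rw [intervalIntegral.integral_of_le (by linarith), setIntegral_congr_fun measurableSet_Ioc e2,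
      ← intervalIntegral.integral_of_le (by linarith), intervalIntegral.integral_const_mul]
  rw [← intervalIntegral.integral_add_adjacent_intervals k1' k2', l1, l2] at hF
  linarith

/-- The solution belonging to a ground state is positive. -/
theorem RadialSol.pos (h : RadialSol q φ p) (hq : LocBdd q)
    (hform : ∀ χ : ℝ → ℝ, ContDiff ℝ ∞ χ → HasCompactSupport χ →
      0 ≤ ∫ s in Ioi (0 : ℝ), (s * deriv χ s ^ 2 + q s * χ s ^ 2))
    (h0 : 0 < φ 0) {s : ℝ} (hs : 0 ≤ s) : 0 < φ s := by
  by_contra hcon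
  push Not at hcon
  -- A nonpositive value would produce a zero r; the flux vanishes there as well, and uniqueness
  -- carries the zero Cauchy data back to φ 0 = 0.
  obtain ⟨r, hr, hr0⟩ := intermediate_value_Icc' hs (h.cont.mono (Icc_subset_Ici_self : Icc 0 s ⊆ _))
    ⟨hcon, h0.le⟩
  have hrpos : 0 < r := lt_of_le_of_ne hr.1 fun h' => by rw [← h'] at hr0; linarith
  have := h.zero_of_cauchy hq hrpos hr0 (h.flux_eq_zero_of_zero hq hform hrpos hr0)
  linarith

end Positivity

end MagneticWell

namespace MagneticWell

open scoped Convolution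
open Set Topology

/-! ### The decaying exterior solution and Kummer's equation -/

section ExteriorProfile

/-- The moments of the Laplace transform of `t^(α-1) (1+t)^(-α)`. -/
noncomputable def laplaceMoment (lam α : ℝ) (n : ℕ) (s : ℝ) : ℝ :=
  ∫ t in Ioi (0 : ℝ), Real.exp (-(lam * s * t / 2)) * t ^ n * (t ^ (α - 1) * (1 + t) ^ (-α))

variable {lam α s : ℝ} {n : ℕ}

lemma kernel_pos {t : ℝ} (ht : 0 < t) : 0 < t ^ (α - 1) * (1 + t) ^ (-α) := by positivity

/-- The kernel is (t/(1+t))^(α-1)/(1+t). Here α ≥ 1 is essential: for smaller α it is singular at t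
= 0. -/
lemma kernel_le_one (hα : 1 ≤ α) {t : ℝ} (ht : 0 < t) : t ^ (α - 1) * (1 + t) ^ (-α) ≤ 1 := by
  have h1 : t ^ (α - 1) ≤ (1 + t) ^ (α - 1) :=
    Real.rpow_le_rpow ht.le (by linarith) (by linarith)
  have h2 : (0 : ℝ) < (1 + t) ^ (-α) := by positivity
  calc t ^ (α - 1) * (1 + t) ^ (-α) ≤ (1 + t) ^ (α - 1) * (1 + t) ^ (-α) := by gcongr
    _ = (1 + t) ^ (-1 : ℝ) := by rw [← Real.rpow_add (by linarith)]; congr 1; ring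
    _ ≤ 1 := Real.rpow_le_one_of_one_le_of_nonpos (by linarith) (by norm_num)

lemma integrableOn_pow_mul_exp (n : ℕ) {c : ℝ} (hc : 0 < c) :
    IntegrableOn (fun t : ℝ => Real.exp (-(c * t)) * t ^ n) (Ioi 0) := by
  have := integrableOn_rpow_mul_exp_neg_mul_rpow (p := 1) (s := n) (b := c)
    (by linarith [(n.cast_nonneg : (0 : ℝ) ≤ n)]) one_pos hc
  refine this.congr_fun (fun t _ => ?_) measurableSet_Ioi
  simp only [Real.rpow_natCast, Real.rpow_one]
  rw [mul_comm, neg_mul]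

lemma continuousOn_moment_integrand (lam α : ℝ) (n : ℕ) (s : ℝ) :
    ContinuousOn (fun t : ℝ => Real.exp (-(lam * s * t / 2)) * t ^ n
      * (t ^ (α - 1) * (1 + t) ^ (-α))) (Ioi 0) := by
  refine ContinuousOn.mul (by fun_prop) (ContinuousOn.mul ?_ ?_)
  · exact continuousOn_id.rpow_const fun t ht => Or.inl (ne_of_gt ht)
  · exact ContinuousOn.rpow_const (f := fun t : ℝ => 1 + t) (by fun_prop) fun t ht =>
      Or.inl (by have : (0 : ℝ) < t := ht; positivity)

lemma integrableOn_moment (hlam : 0 < lam) (hα : 1 ≤ α) (hs : 0 < s) (n : ℕ) :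
    IntegrableOn (fun t : ℝ => Real.exp (-(lam * s * t / 2)) * t ^ n
      * (t ^ (α - 1) * (1 + t) ^ (-α))) (Ioi 0) := by
  refine (integrableOn_pow_mul_exp n (c := lam * s / 2) (by positivity)).mono'
    ((continuousOn_moment_integrand lam α n s).aestronglyMeasurable measurableSet_Ioi) ?_
  rw [ae_restrict_iff' measurableSet_Ioi]
  refine ae_of_all _ fun t ht => ?_
  have ht : 0 < t := ht
  have h1 := kernel_pos (α := α) ht
  rw [Real.norm_eq_abs, abs_of_nonneg (by positivity)]
  have e : lam * s * t / 2 = lam * s / 2 * t := by ring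
  rw [e]
  exact mul_le_of_le_one_right (by positivity) (kernel_le_one hα ht)

lemma hasDerivAt_laplaceMoment (hlam : 0 < lam) (hα : 1 ≤ α) (hs : 0 < s) (n : ℕ) :
    HasDerivAt (laplaceMoment lam α n) (-(lam / 2) * laplaceMoment lam α (n + 1) s) s := by
  -- Differentiation under the integral on (s/2, ∞), dominated by the next moment at s/2.
  have h := hasDerivAt_integral_of_dominated_loc_of_deriv_le
    (μ := volume.restrict (Ioi (0 : ℝ))) (x₀ := s) (s := Ioi (s / 2))
    (F := fun s t => Real.exp (-(lam * s * t / 2)) * t ^ n * (t ^ (α - 1) * (1 + t) ^ (-α)))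
    (F' := fun s t => -(lam / 2) * (Real.exp (-(lam * s * t / 2)) * t ^ (n + 1)
      * (t ^ (α - 1) * (1 + t) ^ (-α))))
    (bound := fun t => lam / 2 * (Real.exp (-(lam * (s / 2) * t / 2)) * t ^ (n + 1)
      * (t ^ (α - 1) * (1 + t) ^ (-α))))
    (Ioi_mem_nhds (by linarith))
    (Eventually.of_forall fun x =>
      (continuousOn_moment_integrand lam α n x).aestronglyMeasurable measurableSet_Ioi)
    (integrableOn_moment hlam hα hs n)
    (((continuousOn_moment_integrand lam α (n + 1) s).aestronglyMeasurable
      measurableSet_Ioi).const_mul _)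
    (by
      rw [ae_restrict_iff' measurableSet_Ioi]
      refine ae_of_all _ fun t ht x hx => ?_
      have ht : 0 < t := ht
      have hx : s / 2 < x := hx
      have h1 := kernel_pos (α := α) ht
      rw [Real.norm_eq_abs, abs_mul, abs_neg, abs_of_pos (by positivity),
        abs_of_pos (a := Real.exp _ * _ * _) (by positivity)]
      gcongr)
    ((integrableOn_moment hlam hα (half_pos hs) (n + 1)).const_mul _)
    (by
      refine ae_of_all _ fun t x _ => ?_
      have h1 : HasDerivAt (fun x : ℝ => -(lam * x * t / 2)) (-(lam * t / 2)) x := by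
        have := (((hasDerivAt_id x).const_mul lam).mul_const t).div_const 2
        refine this.fun_neg.congr_deriv ?_
        ring
      refine ((h1.exp.mul_const (t ^ n)).mul_const _).congr_deriv ?_
      rw [pow_succ]; ring)
  refine h.2.congr_deriv ?_
  rw [integral_const_mul]; rfl

lemma laplaceMoment_pos (hlam : 0 < lam) (hα : 1 ≤ α) (hs : 0 < s) (n : ℕ) :
    0 < laplaceMoment lam α n s := by
  refine (setIntegral_pos_iff_support_of_nonneg_ae ?_ (integrableOn_moment hlam hα hs n)).2 ?_
  · rw [EventuallyLE, ae_restrict_iff' measurableSet_Ioi]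
    refine ae_of_all _ fun t ht => ?_
    have ht : 0 < t := ht
    simp only [Pi.zero_apply]
    positivity
  · have : Ioi (0 : ℝ) ⊆ Function.support (fun t : ℝ => Real.exp (-(lam * s * t / 2)) * t ^ n
      * (t ^ (α - 1) * (1 + t) ^ (-α))) := by
      intro t ht
      have ht : 0 < t := ht
      simp only [Function.mem_support]
      positivity
    rw [inter_eq_self_of_subset_right this]
    simp

lemma laplaceMoment_zero_le (hlam : 0 < lam) (hα : 1 ≤ α) (hs : 0 < s) :
    laplaceMoment lam α 0 s ≤ 2 / (lam * s) := by
  have hc : 0 < lam * s / 2 := by positivity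
  have h1 : IntegrableOn (fun t : ℝ => Real.exp (-(lam * s / 2) * t)) (Ioi 0) :=
    integrableOn_exp_mul_Ioi (by linarith) 0
  have h2 : ∫ t in Ioi (0 : ℝ), Real.exp (-(lam * s / 2) * t) = 2 / (lam * s) := by
    rw [integral_exp_mul_Ioi (by linarith) 0]
    simp only [mul_zero, Real.exp_zero]
    field_simp
  rw [← h2]
  refine setIntegral_mono_on (integrableOn_moment hlam hα hs 0) h1 measurableSet_Ioi fun t ht => ?_
  rw [pow_zero, mul_one]
  have e : -(lam * s * t / 2) = -(lam * s / 2) * t := by ring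
  rw [e]
  exact mul_le_of_le_one_right (Real.exp_pos _).le (kernel_le_one hα ht)

lemma laplaceMoment_antitone (hlam : 0 < lam) (hα : 1 ≤ α) {r s : ℝ} (hr : 0 < r) (hrs : r ≤ s) :
    laplaceMoment lam α n s ≤ laplaceMoment lam α n r := by
  refine setIntegral_mono_on (integrableOn_moment hlam hα (hr.trans_le hrs) n)
    (integrableOn_moment hlam hα hr n) measurableSet_Ioi fun t ht => ?_
  have ht : 0 < t := ht
  gcongr

/-- The contiguity relation of the moments, which is Kummer's equation. -/
lemma laplaceMoment_relation (hlam : 0 < lam) (hα : 1 ≤ α) (hs : 0 < s) :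
    lam * s / 2 * (laplaceMoment lam α 2 s + laplaceMoment lam α 1 s)
      = laplaceMoment lam α 1 s + α * laplaceMoment lam α 0 s := by
  have i0 := integrableOn_moment hlam hα hs 0
  have i1 := integrableOn_moment hlam hα hs 1
  have i2 := integrableOn_moment hlam hα hs 2
  set f' : ℝ → ℝ := fun t =>
    (Real.exp (-(lam * s * t / 2)) * t ^ 1 * (t ^ (α - 1) * (1 + t) ^ (-α))
      + α * (Real.exp (-(lam * s * t / 2)) * t ^ 0 * (t ^ (α - 1) * (1 + t) ^ (-α))))
    - lam * s / 2 * (Real.exp (-(lam * s * t / 2)) * t ^ 2 * (t ^ (α - 1) * (1 + t) ^ (-α))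
      + Real.exp (-(lam * s * t / 2)) * t ^ 1 * (t ^ (α - 1) * (1 + t) ^ (-α))) with hf'
  have hint : IntegrableOn f' (Ioi 0) := (i1.add (i0.const_mul α)).sub ((i2.add i1).const_mul (lam * s / 2))
  -- The relation is ∫ f' = 0. The derivative of t^α (1+t)^(1-α) is (α + t) times the kernel, and f
  -- vanishes at 0 because α > 0 and at infinity by the exponential.
  set f : ℝ → ℝ := fun t => Real.exp (-(lam * s * t / 2)) * (t ^ α * (1 + t) ^ (1 - α)) with hf
  have hd : ∀ t ∈ Ioi (0 : ℝ), HasDerivAt f (f' t) t := by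
    intro t ht
    have ht : 0 < t := ht
    have ht1 : 0 < 1 + t := by positivity
    have h1 : HasDerivAt (fun t : ℝ => -(lam * s * t / 2)) (-(lam * s / 2)) t := by
      have := ((hasDerivAt_id t).const_mul (lam * s)).div_const 2
      refine this.fun_neg.congr_deriv ?_
      ring
    have h2 : HasDerivAt (fun t : ℝ => t ^ α) (α * t ^ (α - 1)) t :=
      Real.hasDerivAt_rpow_const (Or.inl ht.ne')
    have h3 : HasDerivAt (fun t : ℝ => (1 + t) ^ (1 - α)) ((1 - α) * (1 + t) ^ (1 - α - 1)) t := by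
      have := ((hasDerivAt_id t).const_add 1).rpow_const (p := 1 - α) (Or.inl ht1.ne')
      simpa using this
    refine (h1.exp.mul (h2.mul h3)).congr_deriv ?_
    have e1 : t ^ α = t ^ (α - 1) * t := by
      rw [← Real.rpow_add_one ht.ne']; congr 1; ring
    have e2 : (1 + t) ^ (1 - α) = (1 + t) ^ (-α) * (1 + t) := by
      rw [← Real.rpow_add_one ht1.ne']; congr 1; ring
    have e3 : 1 - α - 1 = -α := by ring
    simp only [hf', Pi.mul_apply, e1, e2, e3]
    ring
  have hlim : Tendsto f atTop (𝓝 0) := by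
    have hb : Tendsto (fun t : ℝ => t ^ 1 * Real.exp (-(lam * s / 2) * t)
        + t ^ 2 * Real.exp (-(lam * s / 2) * t)) atTop (𝓝 0) := by
      have hp : ∀ n : ℕ, Tendsto (fun t : ℝ => t ^ n * Real.exp (-(lam * s / 2) * t)) atTop (𝓝 0) := by
        intro n
        have := tendsto_rpow_mul_exp_neg_mul_atTop_nhds_zero n (lam * s / 2) (by positivity)
        simpa only [Real.rpow_natCast] using this
      simpa using (hp 1).add (hp 2)
    refine squeeze_zero' ?_ ?_ hb
    · filter_upwards [eventually_gt_atTop 0] with t ht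
      positivity
    · filter_upwards [eventually_gt_atTop 0] with t ht
      have ht1 : 0 < 1 + t := by positivity
      have h1 : t ^ α ≤ (1 + t) ^ (α - 1) * t := by
        have e1 : t ^ α = t ^ (α - 1) * t := by
          rw [← Real.rpow_add_one ht.ne']; congr 1; ring
        rw [e1]
        gcongr
        linarith
      have h2 : t ^ α * (1 + t) ^ (1 - α) ≤ t := by
        calc _ ≤ (1 + t) ^ (α - 1) * t * (1 + t) ^ (1 - α) := by gcongr
          _ = ((1 + t) ^ (α - 1) * (1 + t) ^ (1 - α)) * t := by ring
          _ = t := by rw [← Real.rpow_add ht1]; simp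
      have e : -(lam * s * t / 2) = -(lam * s / 2) * t := by ring
      have h3 : 0 ≤ t ^ 2 * Real.exp (-(lam * s / 2) * t) := by positivity
      have h4 : Real.exp (-(lam * s / 2) * t) * (t ^ α * (1 + t) ^ (1 - α))
          ≤ Real.exp (-(lam * s / 2) * t) * t := by gcongr
      simp only [hf, e]
      linarith
  have hcont : ContinuousWithinAt f (Ici 0) 0 := by
    refine ContinuousAt.continuousWithinAt ?_
    refine ContinuousAt.mul (by fun_prop) (ContinuousAt.mul ?_ ?_)
    · exact Real.continuousAt_rpow_const _ _ (Or.inr (by linarith))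
    · exact (continuousAt_const.add continuousAt_id).rpow_const (Or.inl (by norm_num))
  have key := integral_Ioi_of_hasDerivAt_of_tendsto hcont hd hint hlim
  have hf0 : f 0 = 0 := by
    simp only [hf]; rw [Real.zero_rpow (by linarith)]; simp
  rw [hf0, sub_zero] at key
  have hsplit : ∫ t in Ioi (0 : ℝ), f' t = (laplaceMoment lam α 1 s + α * laplaceMoment lam α 0 s)
      - lam * s / 2 * (laplaceMoment lam α 2 s + laplaceMoment lam α 1 s) := by
    have := integral_sub (i1.add (i0.const_mul α)) ((i2.add i1).const_mul (lam * s / 2))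
    refine Eq.trans this ?_
    simp only [Pi.add_apply]
    rw [integral_add i1 (i0.const_mul α), integral_const_mul, integral_const_mul,
      integral_add i2 i1]
    rfl
  linarith

/-- The exterior profile in the variable `s = r²`. -/
noncomputable def decayingSol (lam α s : ℝ) : ℝ :=
  Real.exp (-(lam * s / 4)) * laplaceMoment lam α 0 s

/-- The flux `s F'` of the exterior profile. -/
noncomputable def decayingFlux (lam α s : ℝ) : ℝ :=
  s * (Real.exp (-(lam * s / 4)) *
    (-(lam / 2) * laplaceMoment lam α 1 s - lam / 4 * laplaceMoment lam α 0 s))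

lemma hasDerivAt_exp_quarter (lam s : ℝ) :
    HasDerivAt (fun s => Real.exp (-(lam * s / 4))) (Real.exp (-(lam * s / 4)) * (-(lam / 4))) s := by
  have h1 : HasDerivAt (fun s : ℝ => -(lam * s / 4)) (-(lam / 4)) s := by
    have := ((hasDerivAt_id s).const_mul lam).div_const 4
    refine this.fun_neg.congr_deriv ?_
    ring
  exact h1.exp

lemma hasDerivAt_decayingSol (hlam : 0 < lam) (hα : 1 ≤ α) (hs : 0 < s) :
    HasDerivAt (decayingSol lam α) (decayingFlux lam α s / s) s := by
  refine ((hasDerivAt_exp_quarter lam s).mul (hasDerivAt_laplaceMoment hlam hα hs 0)).congr_deriv ?_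
  rw [decayingFlux, mul_div_cancel_left₀ _ hs.ne']
  ring

/-- Two derivatives bring in the moments of order 0, 1 and 2, and the contiguity relation eliminates
the higher ones. The coefficient is that of the radial equation without well at energy e = lam - 2
lam α. -/
lemma hasDerivAt_decayingFlux (hlam : 0 < lam) (hα : 1 ≤ α) (hs : 0 < s) :
    HasDerivAt (decayingFlux lam α)
      ((lam ^ 2 * s / 4 - (lam - 2 * lam * α)) / 4 * decayingSol lam α s) s := by
  have h0 := hasDerivAt_laplaceMoment hlam hα hs 0
  have h1 := hasDerivAt_laplaceMoment hlam hα hs 1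
  refine ((hasDerivAt_id s).mul ((hasDerivAt_exp_quarter lam s).mul
    ((h1.const_mul (-(lam / 2))).sub (h0.const_mul (lam / 4))))).congr_deriv ?_
  have hr := laplaceMoment_relation hlam hα hs
  simp only [decayingSol, id, zero_add, one_add_one_eq_two, Pi.mul_apply, Pi.sub_apply]
  linear_combination (Real.exp (-(lam * s / 4)) * lam / 2) * hr

lemma decayingSol_pos (hlam : 0 < lam) (hα : 1 ≤ α) (hs : 0 < s) : 0 < decayingSol lam α s :=
  mul_pos (Real.exp_pos _) (laplaceMoment_pos hlam hα hs 0)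

lemma exteriorProfile_eq (lam α r : ℝ) :
    exteriorProfile lam α r = decayingSol lam α (r ^ 2) := by
  simp only [exteriorProfile, decayingSol, laplaceMoment, pow_zero, mul_one, mul_assoc]

end ExteriorProfile

/-! ### Uniqueness of the decaying exterior solution -/

section Exterior

/-- `f` solves `(s f')' = q f` on `(s₁, ∞)` in the classical sense, with flux `p = s f'`. -/
structure ExteriorSol (q f p : ℝ → ℝ) (s₁ : ℝ) : Prop where
  hasDerivAt : ∀ s, s₁ < s → HasDerivAt f (p s / s) s
  hasDerivAt_flux : ∀ s, s₁ < s → HasDerivAt p (q s * f s) s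
  pos : ∀ s, s₁ < s → 0 < f s

variable {q f p : ℝ → ℝ} {s₁ : ℝ}

lemma ExteriorSol.monotone_flux (h : ExteriorSol q f p s₁) (hq : ∀ s, s₁ < s → 0 ≤ q s) :
    MonotoneOn p (Ioi s₁) := by
  refine monotoneOn_of_deriv_nonneg (convex_Ioi _)
    (fun s hs => (h.hasDerivAt_flux s hs).continuousAt.continuousWithinAt) ?_ ?_
  · rw [interior_Ioi]
    exact fun s hs => (h.hasDerivAt_flux s hs).differentiableAt.differentiableWithinAt
  · rw [interior_Ioi]
    intro s hs
    rw [(h.hasDerivAt_flux s hs).deriv]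
    exact mul_nonneg (hq s hs) (h.pos s hs).le

/-- The logarithm solves (s f')' = 0 with flux 1, so a bound on the flux compares f with a multiple
of log. -/
lemma ExteriorSol.hasDerivAt_sub_log (h : ExteriorSol q f p s₁) (hs₁ : 0 ≤ s₁) (δ : ℝ) {s : ℝ}
    (hs : s₁ < s) : HasDerivAt (fun s => f s - δ * Real.log s) ((p s - δ) / s) s :=
  ((h.hasDerivAt s hs).fun_sub
    ((Real.hasDerivAt_log (by linarith : 0 < s).ne').const_mul δ)).congr_deriv (by ring)

lemma ExteriorSol.monotone_sub_log (h : ExteriorSol q f p s₁) {r δ : ℝ} (hs₁ : 0 ≤ s₁) (hr : s₁ < r)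
    (hp : ∀ s, r ≤ s → δ ≤ p s) : MonotoneOn (fun s => f s - δ * Real.log s) (Ici r) := by
  have hd := fun s (hs : r ≤ s) => h.hasDerivAt_sub_log hs₁ δ (hr.trans_le hs)
  refine monotoneOn_of_deriv_nonneg (convex_Ici _)
    (fun s hs => (hd s hs).continuousAt.continuousWithinAt) ?_ ?_
  · rw [interior_Ici]
    exact fun s hs => (hd s (le_of_lt hs)).differentiableAt.differentiableWithinAt
  · rw [interior_Ici]
    intro s hs
    have hs : r < s := hs
    rw [(hd s hs.le).deriv]
    exact div_nonneg (sub_nonneg.2 (hp s hs.le)) (by linarith)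

lemma ExteriorSol.antitone_sub_log (h : ExteriorSol q f p s₁) {r δ : ℝ} (hs₁ : 0 ≤ s₁) (hr : s₁ < r)
    (hp : ∀ s, r ≤ s → p s ≤ δ) : AntitoneOn (fun s => f s - δ * Real.log s) (Ici r) := by
  have hd := fun s (hs : r ≤ s) => h.hasDerivAt_sub_log hs₁ δ (hr.trans_le hs)
  refine antitoneOn_of_deriv_nonpos (convex_Ici _)
    (fun s hs => (hd s hs).continuousAt.continuousWithinAt) ?_ ?_
  · rw [interior_Ici]
    exact fun s hs => (hd s (le_of_lt hs)).differentiableAt.differentiableWithinAt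
  · rw [interior_Ici]
    intro s hs
    have hs : r < s := hs
    rw [(hd s hs.le).deriv]
    exact div_nonpos_of_nonpos_of_nonneg (sub_nonpos.2 (hp s hs.le)) (by linarith)

/-- A positive flux at one point persists, the flux being nondecreasing, and forces f to grow at
least logarithmically. -/
lemma ExteriorSol.flux_nonpos (h : ExteriorSol q f p s₁) (hs₁ : 0 ≤ s₁) (hq : ∀ s, s₁ < s → 0 ≤ q s)
    (hf : ¬ Tendsto f atTop atTop) {r : ℝ} (hr : s₁ < r) : p r ≤ 0 := by
  by_contra hcon
  push Not at hcon
  have hm := h.monotone_sub_log hs₁ hr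
    (fun s hs => h.monotone_flux hq hr (hr.trans_le hs : s₁ < s) hs)
  refine hf (tendsto_atTop_mono' atTop ?_ (tendsto_atTop_add_const_left atTop
    (f r - p r * Real.log r) (Real.tendsto_log_atTop.const_mul_atTop hcon)))
  filter_upwards [eventually_ge_atTop r] with s hs
  have := hm self_mem_Ici hs hs
  simp only at this
  linarith

lemma ExteriorSol.antitone (h : ExteriorSol q f p s₁) (hs₁ : 0 ≤ s₁) (hq : ∀ s, s₁ < s → 0 ≤ q s)
    (hf : ¬ Tendsto f atTop atTop) {r s : ℝ} (hr : s₁ < r) (hrs : r ≤ s) : f s ≤ f r := by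
  have := h.antitone_sub_log (δ := 0) hs₁ hr
    (fun s hs => h.flux_nonpos hs₁ hq hf (hr.trans_le hs)) self_mem_Ici hrs hrs
  simpa using this

/-- Were the flux at most -ε forever, f would fall below a negative multiple of log and lose its
positivity. So the flux exceeds -ε somewhere, and by monotonicity it stays in (-ε, 0] from there on.
-/
lemma ExteriorSol.tendsto_flux (h : ExteriorSol q f p s₁) (hs₁ : 0 ≤ s₁)
    (hq : ∀ s, s₁ < s → 0 ≤ q s) (hf : ¬ Tendsto f atTop atTop) : Tendsto p atTop (𝓝 0) := by
  refine Metric.tendsto_atTop.2 fun ε hε => ?_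
  have hex : ∃ r, s₁ < r ∧ -ε < p r := by
    by_contra hcon
    push Not at hcon
    have ha := h.antitone_sub_log (r := s₁ + 1) (δ := -ε) hs₁ (by linarith)
      (fun s hs => hcon s (by linarith))
    have ht : Tendsto (fun s => ε * Real.log s) atTop atTop :=
      Real.tendsto_log_atTop.const_mul_atTop hε
    obtain ⟨s, hs, hs'⟩ := ((eventually_ge_atTop (s₁ + 1)).and
      (ht.eventually_ge_atTop (f (s₁ + 1) + ε * Real.log (s₁ + 1)))).exists
    have h1 := ha self_mem_Ici hs hs
    have h2 := h.pos s (by linarith)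
    simp only at h1
    linarith
  obtain ⟨r, hr, hpr⟩ := hex
  refine ⟨r, fun s hs => ?_⟩
  have h1 := h.monotone_flux hq hr (hr.trans_le hs : s₁ < s) hs
  have h2 := h.flux_nonpos hs₁ hq hf (hr.trans_le hs)
  rw [Real.dist_eq, sub_zero, abs_lt]
  constructor <;> linarith

/-- Two positive exterior solutions that do not blow up are proportional. -/
theorem ExteriorSol.proportional {F P : ℝ → ℝ} (h : ExteriorSol q f p s₁)
    (H : ExteriorSol q F P s₁) (hs₁ : 0 ≤ s₁) (hq : ∀ s, s₁ < s → 0 ≤ q s)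
    (hf : ¬ Tendsto f atTop atTop) (hF : ¬ Tendsto F atTop atTop) :
    ∃ C, 0 < C ∧ ∀ s, s₁ < s → f s = C * F s := by
  -- The Wronskian p F - f P is constant. It tends to 0, since both fluxes do while f and F stay
  -- bounded; hence it vanishes and f/F is constant.
  have hW : ∀ s, s₁ < s → HasDerivAt (fun s => p s * F s - f s * P s) 0 s := by
    intro s hs
    refine (((h.hasDerivAt_flux s hs).fun_mul (H.hasDerivAt s hs)).fun_sub
      ((h.hasDerivAt s hs).fun_mul (H.hasDerivAt_flux s hs))).congr_deriv ?_
    ring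
  obtain ⟨w, hw⟩ := isOpen_Ioi.exists_is_const_of_deriv_eq_zero isPreconnected_Ioi
    (fun s hs => (hW s hs).differentiableAt.differentiableWithinAt) (fun s hs => (hW s hs).deriv)
  have hlim : Tendsto (fun s => p s * F s - f s * P s) atTop (𝓝 0) := by
    have hb : Tendsto (fun s => |p s| * F (s₁ + 1) + f (s₁ + 1) * |P s|) atTop (𝓝 0) := by
      simpa using ((h.tendsto_flux hs₁ hq hf).abs.mul_const (F (s₁ + 1))).add
        ((H.tendsto_flux hs₁ hq hF).abs.const_mul (f (s₁ + 1)))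
    refine squeeze_zero_norm' ?_ hb
    filter_upwards [eventually_ge_atTop (s₁ + 1)] with s hs
    have h1 := h.antitone hs₁ hq hf (by linarith : s₁ < s₁ + 1) hs
    have h2 := H.antitone hs₁ hq hF (by linarith : s₁ < s₁ + 1) hs
    have h3 := h.pos s (by linarith)
    have h4 := H.pos s (by linarith)
    refine (norm_sub_le _ _).trans ?_
    rw [norm_mul, norm_mul, Real.norm_eq_abs, Real.norm_eq_abs, Real.norm_eq_abs, Real.norm_eq_abs,
      abs_of_pos h3, abs_of_pos h4]
    gcongr
  have hw0 : w = 0 := by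
    refine tendsto_nhds_unique (tendsto_const_nhds.congr' ?_) hlim
    filter_upwards [eventually_gt_atTop s₁] with s hs
    exact (hw s hs).symm
  have hQ : ∀ s, s₁ < s → HasDerivAt (fun s => f s / F s) 0 s := by
    intro s hs
    have hFs := (H.pos s hs).ne'
    refine ((h.hasDerivAt s hs).fun_div (H.hasDerivAt s hs) hFs).congr_deriv ?_
    have hs0 : s ≠ 0 := by linarith
    have := hw s hs
    simp only [hw0] at this
    field_simp
    linear_combination this
  obtain ⟨C, hC⟩ := isOpen_Ioi.exists_is_const_of_deriv_eq_zero isPreconnected_Ioi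
    (fun s hs => (hQ s hs).differentiableAt.differentiableWithinAt) (fun s hs => (hQ s hs).deriv)
  refine ⟨C, ?_, fun s hs => ?_⟩
  · have hs : s₁ < s₁ + 1 := by linarith
    rw [← hC (s₁ + 1) hs]
    exact div_pos (h.pos _ hs) (H.pos _ hs)
  · rw [← hC s hs, div_mul_cancel₀ _ (H.pos s hs).ne']

lemma exteriorSol_decayingSol {lam α : ℝ} (hlam : 0 < lam) (hα : 1 ≤ α) (hs₁ : 0 ≤ s₁)
    (hq : ∀ s, s₁ < s → q s = (lam ^ 2 * s / 4 - (lam - 2 * lam * α)) / 4) :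
    ExteriorSol q (decayingSol lam α) (decayingFlux lam α) s₁ where
  hasDerivAt s hs := hasDerivAt_decayingSol hlam hα (by linarith)
  hasDerivAt_flux s hs := by
    rw [hq s hs]
    exact hasDerivAt_decayingFlux hlam hα (by linarith)
  pos s hs := decayingSol_pos hlam hα (by linarith)

lemma decayingSol_le {lam α r s : ℝ} (hlam : 0 < lam) (hα : 1 ≤ α) (hr : 0 < r) (hrs : r ≤ s) :
    decayingSol lam α s ≤ decayingSol lam α r * Real.exp (-(lam * (s - r) / 4)) := by
  have h1 := laplaceMoment_antitone (n := 0) hlam hα hr hrs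
  have e : Real.exp (-(lam * s / 4))
      = Real.exp (-(lam * r / 4)) * Real.exp (-(lam * (s - r) / 4)) := by
    rw [← Real.exp_add]; congr 1; ring
  rw [decayingSol, decayingSol, e]
  have h2 := Real.exp_pos (-(lam * r / 4))
  have h3 := Real.exp_pos (-(lam * (s - r) / 4))
  calc _ ≤ Real.exp (-(lam * r / 4)) * Real.exp (-(lam * (s - r) / 4))
        * laplaceMoment lam α 0 r := by gcongr
    _ = _ := by ring

lemma not_tendsto_decayingSol {lam α : ℝ} (hlam : 0 < lam) (hα : 1 ≤ α) :
    ¬ Tendsto (decayingSol lam α) atTop atTop := by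
  intro h
  obtain ⟨s, hs, hs'⟩ := ((eventually_ge_atTop 1).and
    (h.eventually_gt_atTop (decayingSol lam α 1))).exists
  have h1 := decayingSol_le hlam hα one_pos hs
  have h2 : Real.exp (-(lam * (s - 1) / 4)) ≤ 1 := Real.exp_le_one_iff.2 (by
    have : 0 ≤ lam * (s - 1) := mul_nonneg hlam.le (by linarith)
    linarith)
  have h3 := decayingSol_pos hlam hα one_pos
  nlinarith

/-- A square integrable function is not bounded below near infinity by a positive constant. -/
lemma not_eventually_ge_of_sq (hi : IntegrableOn (fun s => f s ^ 2) (Ioi 0)) {δ : ℝ} (hδ : 0 < δ) :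
    ¬ ∀ᶠ s in atTop, δ ≤ f s := by
  intro h
  obtain ⟨R, hR⟩ := eventually_atTop.1 h
  have h1 : IntegrableOn (fun s => f s ^ 2) (Ioi (max R 0)) :=
    hi.mono_set (Ioi_subset_Ioi (le_max_right _ _))
  have h2 : IntegrableOn (fun _ : ℝ => δ ^ 2) (Ioi (max R 0)) := by
    refine h1.mono' aestronglyMeasurable_const ?_
    rw [ae_restrict_iff' measurableSet_Ioi]
    refine ae_of_all _ fun s hs => ?_
    have := hR s ((le_max_left _ _).trans (le_of_lt hs))
    rw [Real.norm_eq_abs, abs_of_nonneg (sq_nonneg δ)]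
    gcongr
  rw [integrableOn_const_iff] at h2
  simp [hδ.ne'] at h2

end Exterior

end MagneticWell

namespace MagneticWell

open scoped Convolution
open Set Topology

/-! ### Bounds at the edge of the well and for the Laplace integral -/

section Estimates

variable {q φ p : ℝ → ℝ} {s₁ lam α M : ℝ}

/-- A positive normalized solution of the radial equation whose coefficient is that of a well
supported in `[0, s₁]`. -/
structure WellSol (q φ p : ℝ → ℝ) (s₁ lam α M : ℝ) : Prop where
  sol : RadialSol q φ p
  locBdd : LocBdd q
  pos : ∀ s, 0 ≤ s → 0 < φ s
  integrable_sq : IntegrableOn (fun s => φ s ^ 2) (Ioi 0)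
  normalized : Real.pi * ∫ s in Ioi (0 : ℝ), φ s ^ 2 = 1
  radius_pos : 0 < s₁
  one_le_lam : 1 ≤ lam
  one_le_exponent : 1 ≤ α
  exterior : ∀ s, s₁ < s → q s = (lam ^ 2 * s / 4 - (lam - 2 * lam * α)) / 4
  bound : ∀ s, 0 ≤ s → s ≤ s₁ + 1 → |q s| ≤ M * lam ^ 2
  one_le_bound : 1 ≤ M
  one_le_bound_mul : 1 ≤ M * s₁

namespace WellSol

lemma lam_pos (h : WellSol q φ p s₁ lam α M) : 0 < lam := one_pos.trans_le h.one_le_lam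

lemma bound_pos (h : WellSol q φ p s₁ lam α M) : 0 < M := one_pos.trans_le h.one_le_bound

/-- The inequality α ≥ 1 makes the energy lam - 2 lam α negative, so outside the well both terms of
the coefficient are nonnegative. -/
lemma coeff_nonneg (h : WellSol q φ p s₁ lam α M) {s : ℝ} (hs : s₁ < s) : 0 ≤ q s := by
  rw [h.exterior s hs]
  have h1 := h.lam_pos
  have h2 := h.one_le_exponent
  have h3 : 0 ≤ lam ^ 2 * s := mul_nonneg (sq_nonneg _) (h.radius_pos.trans hs).le
  nlinarith

lemma exteriorSol (h : WellSol q φ p s₁ lam α M) : ExteriorSol q φ p s₁ where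
  hasDerivAt s hs := h.sol.hasDerivAt s (h.radius_pos.trans hs)
  hasDerivAt_flux s hs := by
    have hs0 : 0 < s := h.radius_pos.trans hs
    have hk := h.sol.locInt h.locBdd
    have hqc : ContinuousOn q (Ioi s₁) :=
      ContinuousOn.congr (f := fun s => (lam ^ 2 * s / 4 - (lam - 2 * lam * α)) / 4)
        (by fun_prop) h.exterior
    have hc : ContinuousOn (fun s => q s * φ s) (Ioi s₁) :=
      hqc.mul (h.sol.cont.mono fun t ht => (h.radius_pos.trans ht).le)
    have hd : HasDerivAt (fun s => ∫ t in (0 : ℝ)..s, q t * φ t) (q s * φ s) s :=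
      intervalIntegral.integral_hasDerivAt_right (hk.intervalIntegrable le_rfl hs0.le)
        (hc.stronglyMeasurableAtFilter isOpen_Ioi s hs) (hc.continuousAt (Ioi_mem_nhds hs))
    refine hd.congr_of_eventuallyEq ?_
    filter_upwards [Ioi_mem_nhds hs0] with t ht
    exact h.sol.flux t (le_of_lt ht)
  pos s hs := h.pos s (h.radius_pos.trans hs).le

lemma not_tendsto (h : WellSol q φ p s₁ lam α M) : ¬ Tendsto φ atTop atTop := fun H =>
  not_eventually_ge_of_sq h.integrable_sq one_pos (H.eventually_ge_atTop 1)

lemma flux_nonpos (h : WellSol q φ p s₁ lam α M) {s : ℝ} (hs : s₁ < s) : p s ≤ 0 :=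
  h.exteriorSol.flux_nonpos h.radius_pos.le (fun _ ht => h.coeff_nonneg ht) h.not_tendsto hs

lemma flux_mono (h : WellSol q φ p s₁ lam α M) {r s : ℝ} (hr : s₁ ≤ r) (hrs : r ≤ s) : p r ≤ p s := by
  have h1 := h.sol.flux_sub h.locBdd (h.radius_pos.le.trans hr) ((h.radius_pos.le.trans hr).trans hrs)
  have h2 : 0 ≤ ∫ t in r..s, q t * φ t := by
    rw [intervalIntegral.integral_of_le hrs]
    refine setIntegral_nonneg measurableSet_Ioc fun t ht => ?_
    exact mul_nonneg (h.coeff_nonneg (hr.trans_lt ht.1))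
      (h.pos t ((h.radius_pos.le.trans hr).trans ht.1.le)).le
  linarith

/-- Outside the well the solution is the decaying exterior solution. -/
lemma exists_eq_decayingSol (h : WellSol q φ p s₁ lam α M) :
    ∃ C, 0 < C ∧ ∀ s, s₁ ≤ s → φ s = C * decayingSol lam α s := by
  obtain ⟨C, hC, hCs⟩ := h.exteriorSol.proportional
    (exteriorSol_decayingSol h.lam_pos h.one_le_exponent h.radius_pos.le h.exterior)
    h.radius_pos.le (fun _ ht => h.coeff_nonneg ht) h.not_tendsto
    (not_tendsto_decayingSol h.lam_pos h.one_le_exponent)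
  refine ⟨C, hC, fun s hs => ?_⟩
  rcases hs.eq_or_lt with rfl | hs
  · have h1 : Tendsto φ (𝓝[>] s₁) (𝓝 (φ s₁)) :=
      (h.sol.hasDerivAt s₁ h.radius_pos).continuousAt.tendsto.mono_left nhdsWithin_le_nhds
    have h2 : Tendsto (fun s => C * decayingSol lam α s) (𝓝[>] s₁) (𝓝 (C * decayingSol lam α s₁)) :=
      (((hasDerivAt_decayingSol h.lam_pos h.one_le_exponent
        h.radius_pos).continuousAt.tendsto).const_mul C).mono_left nhdsWithin_le_nhds
    refine tendsto_nhds_unique h1 (h2.congr' ?_)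
    filter_upwards [self_mem_nhdsWithin] with s hs
    exact (hCs s hs).symm
  · exact hCs s hs

lemma decay (h : WellSol q φ p s₁ lam α M) {s : ℝ} (hs : s₁ ≤ s) :
    φ s ≤ φ s₁ * Real.exp (-(lam * (s - s₁) / 4)) := by
  obtain ⟨C, hC, hCs⟩ := h.exists_eq_decayingSol
  rw [hCs s hs, hCs s₁ le_rfl, mul_assoc]
  exact mul_le_mul_of_nonneg_left
    (decayingSol_le h.lam_pos h.one_le_exponent h.radius_pos hs) hC.le

lemma le_boundary (h : WellSol q φ p s₁ lam α M) {s : ℝ} (hs : s₁ ≤ s) : φ s ≤ φ s₁ := by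
  refine (h.decay hs).trans (mul_le_of_le_one_right (h.pos s₁ h.radius_pos.le).le ?_)
  rw [Real.exp_le_one_iff]
  have := mul_nonneg h.lam_pos.le (sub_nonneg.2 hs)
  linarith

/-- On [s₁, s₁ + 1/lam] the solution drops by at most φ(s₁), so at some point the flux is O(lam
φ(s₁)). Over the same interval the flux changes by at most M lam² φ(s₁) · (1/lam). The length 1/lam
≤ 1 balances the two contributions and stays within the margin where the coefficient is bounded. -/
lemma abs_flux_boundary (h : WellSol q φ p s₁ lam α M) :
    |p s₁| ≤ (s₁ + 1 + M) * lam * φ s₁ := by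
  have hl := h.lam_pos
  have hs₁ := h.radius_pos
  obtain ⟨δ, hδ⟩ : ∃ δ, δ = lam⁻¹ := ⟨_, rfl⟩
  have hδ0 : 0 < δ := hδ ▸ inv_pos.2 hl
  have hδ1 : δ ≤ 1 := hδ ▸ inv_le_one_of_one_le₀ h.one_le_lam
  have hδl : δ * lam = 1 := by rw [hδ, inv_mul_cancel₀ hl.ne']
  have hlt : s₁ < s₁ + δ := by linarith
  have hφ1 := h.pos s₁ hs₁.le
  obtain ⟨ξ, hξ, hξe⟩ := exists_hasDerivAt_eq_slope φ (fun t => p t / t) hlt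
    (h.sol.cont.mono fun t ht => hs₁.le.trans ht.1)
    fun t ht => h.sol.hasDerivAt t (hs₁.trans ht.1)
  obtain ⟨ζ, hζ, hζe⟩ := exists_hasDerivAt_eq_slope p (fun t => q t * φ t) hlt
    ((h.sol.cont_flux h.locBdd).mono fun t ht => hs₁.le.trans ht.1)
    fun t ht => h.exteriorSol.hasDerivAt_flux t ht.1
  rw [add_sub_cancel_left, eq_div_iff hδ0.ne'] at hξe hζe
  have hφ2 := h.pos (s₁ + δ) (by linarith)
  have hξ0 : 0 < ξ := hs₁.trans hξ.1
  have h1 : -p (s₁ + δ) ≤ (s₁ + 1) * lam * φ s₁ := by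
    have h2 : p ξ ≤ p (s₁ + δ) := h.flux_mono hξ.1.le hξ.2.le
    have h3 : -(p ξ) * δ ≤ φ s₁ * ξ := by
      have : p ξ / ξ * δ * ξ = p ξ * δ := by field_simp
      nlinarith
    have h4 : -(p ξ) ≤ φ s₁ * ξ * lam := by
      have := mul_le_mul_of_nonneg_right h3 hl.le
      rwa [mul_assoc, hδl, mul_one] at this
    have h5 : φ s₁ * ξ * lam ≤ φ s₁ * (s₁ + 1) * lam := by
      have := hξ.2
      gcongr
      linarith
    linarith
  have h6 : p (s₁ + δ) - p s₁ ≤ M * lam * φ s₁ := by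
    rw [← hζe]
    have h7 : q ζ ≤ M * lam ^ 2 :=
      (le_abs_self _).trans (h.bound ζ (hs₁.trans hζ.1).le (by linarith [hζ.2]))
    have h8 := h.le_boundary hζ.1.le
    have h9 := h.pos ζ (hs₁.trans hζ.1).le
    have hM := h.bound_pos
    calc q ζ * φ ζ * δ ≤ M * lam ^ 2 * φ s₁ * δ := by gcongr
      _ = M * lam * φ s₁ * (δ * lam) := by ring
      _ = _ := by rw [hδl, mul_one]
  have h10 : p s₁ ≤ 0 := (h.flux_mono le_rfl hlt.le).trans (h.flux_nonpos hlt)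
  rw [abs_of_nonpos h10]
  linarith

lemma integral_sq (h : WellSol q φ p s₁ lam α M) :
    ∫ s in Ioi (0 : ℝ), φ s ^ 2 = Real.pi⁻¹ :=
  eq_inv_of_mul_eq_one_right h.normalized

/-- The flux bound keeps φ ≥ φ(s₁)/2 on an exterior interval of length of order 1/lam, so
normalization bounds φ(s₁)²/lam. -/
lemma boundary_le (h : WellSol q φ p s₁ lam α M) :
    φ s₁ ≤ √(8 * (s₁ + 1 + M) / (s₁ * Real.pi)) * √lam := by
  have hl := h.lam_pos
  have hs₁ := h.radius_pos
  have hM := h.bound_pos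
  obtain ⟨κ, hκ⟩ : ∃ κ, κ = s₁ + 1 + M := ⟨_, rfl⟩
  have hκ0 : 0 < κ := by rw [hκ]; positivity
  have hp := h.abs_flux_boundary
  rw [← hκ] at hp ⊢
  have hφ1 := h.pos s₁ hs₁.le
  -- Chosen so that the slope bound κ lam φ(s₁)/s₁ times d equals φ(s₁)/2.
  obtain ⟨d, hd⟩ : ∃ d, d = s₁ / (2 * κ * lam) := ⟨_, rfl⟩
  have hd0 : 0 < d := by rw [hd]; positivity
  have hdκ : κ * lam * d = s₁ / 2 := by rw [hd]; field_simp
  have hlow : ∀ s ∈ Ioc s₁ (s₁ + d), φ s₁ / 2 ≤ φ s := by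
    intro s hs
    obtain ⟨ξ, hξ, hξe⟩ := exists_hasDerivAt_eq_slope φ (fun t => p t / t) hs.1
      (h.sol.cont.mono fun t ht => hs₁.le.trans ht.1)
      fun t ht => h.sol.hasDerivAt t (hs₁.trans ht.1)
    have hsub : 0 < s - s₁ := sub_pos.2 hs.1
    have hξ0 : 0 < ξ := hs₁.trans hξ.1
    rw [eq_div_iff hsub.ne'] at hξe
    have h1 : -(κ * lam * φ s₁) ≤ p ξ :=
      ((neg_le_neg hp).trans (neg_abs_le _)).trans (h.flux_mono le_rfl hξ.1.le)
    have h2 : -(κ * lam * φ s₁ / s₁) ≤ p ξ / ξ := by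
      rw [le_div_iff₀ hξ0]
      have : κ * lam * φ s₁ ≤ κ * lam * φ s₁ / s₁ * ξ := by
        rw [div_mul_eq_mul_div, le_div_iff₀ hs₁]
        have := hξ.1
        gcongr
      linarith
    have h3 : κ * lam * φ s₁ / s₁ * (s - s₁) ≤ φ s₁ / 2 := by
      have h4 : s - s₁ ≤ d := by linarith [hs.2]
      calc _ ≤ κ * lam * φ s₁ / s₁ * d := by gcongr
        _ = κ * lam * d * φ s₁ / s₁ := by ring
        _ = _ := by rw [hdκ]; field_simp
    nlinarith
  have hint : (φ s₁ / 2) ^ 2 * d ≤ Real.pi⁻¹ := by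
    rw [← h.integral_sq]
    have h1 : ∫ s in Ioc s₁ (s₁ + d), (φ s₁ / 2) ^ 2 ≤ ∫ s in Ioc s₁ (s₁ + d), φ s ^ 2 := by
      refine setIntegral_mono_on (integrableOn_const (by simp)) (h.integrable_sq.mono_set ?_)
        measurableSet_Ioc fun s hs => ?_
      · exact fun s hs => hs₁.trans hs.1
      · have := hlow s hs
        gcongr
    have h2 : ∫ s in Ioc s₁ (s₁ + d), φ s ^ 2 ≤ ∫ s in Ioi (0 : ℝ), φ s ^ 2 :=
      setIntegral_mono_set h.integrable_sq (ae_of_all _ fun s => sq_nonneg _)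
        (LE.le.eventuallyLE fun s hs => hs₁.trans hs.1)
    refine le_trans (le_of_eq ?_) (h1.trans h2)
    simp [Measure.real, hd0.le, mul_comm]
  have hsq : φ s₁ ^ 2 ≤ 8 * κ / (s₁ * Real.pi) * lam := by
    have hpi := Real.pi_pos
    rw [hd] at hint
    have : φ s₁ ^ 2 = (φ s₁ / 2) ^ 2 * (s₁ / (2 * κ * lam)) * (8 * κ * lam / s₁) := by
      field_simp; norm_num
    rw [this]
    calc _ ≤ Real.pi⁻¹ * (8 * κ * lam / s₁) := by gcongr
      _ = _ := by field_simp
  rw [← Real.sqrt_mul (by positivity)]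
  exact Real.le_sqrt_of_sq_le hsq

/-- Backward Grönwall from the edge with Λ = lam and c = M lam; by the flux bound both parts of the
initial quantity are O(lam φ(s₁)), and one factor lam cancels. -/
lemma le_interior (h : WellSol q φ p s₁ lam α M) {s : ℝ} (hs : 0 < s) (hss : s ≤ s₁) :
    √s * φ s ≤ (√s₁ + (s₁ + 1 + M)) * φ s₁ * Real.exp (2 * M * √s₁ * lam) := by
  have hl := h.lam_pos
  have hM := h.bound_pos
  have hφ1 := h.pos s₁ h.radius_pos.le
  have hφ := h.pos s hs.le
  have hs₁ := h.radius_pos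
  have hg := h.sol.gronwall h.locBdd (M := M * lam ^ 2) (Λ := lam) (c := M * lam) hs hss hl.le
    (by nlinarith [h.one_le_bound]) (le_of_eq (by ring))
    (fun t ht hts => h.bound t ht (by linarith))
  rw [abs_of_pos hφ, abs_of_pos hφ1] at hg
  have h1 : Real.exp (2 * (M * lam) * (√s₁ - √s)) ≤ Real.exp (2 * M * √s₁ * lam) := by
    rw [Real.exp_le_exp]
    have : 0 ≤ M * lam * √s := by positivity
    nlinarith
  have h2 := h.abs_flux_boundary
  refine le_of_mul_le_mul_left (a := lam) ?_ hl
  calc lam * (√s * φ s) ≤ lam * √s * φ s + |p s| := by rw [← mul_assoc]; linarith [abs_nonneg (p s)]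
    _ ≤ _ := hg
    _ ≤ (lam * √s₁ * φ s₁ + (s₁ + 1 + M) * lam * φ s₁) * Real.exp (2 * M * √s₁ * lam) := by gcongr
    _ = _ := by ring

/-- Removes the weight √s, which degenerates at the origin. Beyond ε = 1/(4 M lam²) it is divided
out; below ε the value is at most twice that at ε by `RadialSol.inner_bound`, whence 16 = 2² · 4.
The condition M s₁ ≥ 1 places ε inside the well. -/
lemma sq_le_interior (h : WellSol q φ p s₁ lam α M) {s : ℝ} (hs : 0 < s) (hss : s ≤ s₁) :
    φ s ^ 2 ≤ 16 * M * lam ^ 2 * ((√s₁ + (s₁ + 1 + M)) * φ s₁ * Real.exp (2 * M * √s₁ * lam)) ^ 2 := by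
  have hl := h.lam_pos
  have hM := h.bound_pos
  have hφ := h.pos s hs.le
  obtain ⟨ε, hε⟩ : ∃ ε, ε = (4 * M * lam ^ 2)⁻¹ := ⟨_, rfl⟩
  have hε0 : 0 < ε := by rw [hε]; positivity
  have hMε : M * lam ^ 2 * ε = 1 / 4 := by rw [hε]; field_simp
  have hεs : ε ≤ s₁ := by
    have h1 := h.one_le_bound_mul
    have h2 : M ≤ M * lam ^ 2 := le_mul_of_one_le_right hM.le (one_le_pow₀ h.one_le_lam)
    have h3 : 0 < M * lam ^ 2 := by positivity
    have h4 : M * s₁ ≤ M * lam ^ 2 * s₁ := mul_le_mul_of_nonneg_right h2 h.radius_pos.le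
    by_contra hcon
    push Not at hcon
    nlinarith
  set X := (√s₁ + (s₁ + 1 + M)) * φ s₁ * Real.exp (2 * M * √s₁ * lam) with hX
  have hfar : ∀ r, ε ≤ r → r ≤ s₁ → φ r ^ 2 ≤ 4 * M * lam ^ 2 * X ^ 2 := by
    intro r hr hrs
    have hr0 : 0 < r := hε0.trans_le hr
    have h1 : r * φ r ^ 2 ≤ X ^ 2 := by
      have := pow_le_pow_left₀ (mul_nonneg (Real.sqrt_nonneg r) (h.pos r hr0.le).le)
        (h.le_interior hr0 hrs) 2
      rwa [mul_pow, Real.sq_sqrt hr0.le] at this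
    have h2 : 4 * M * lam ^ 2 * ε = 1 := by linarith
    calc φ r ^ 2 = 4 * M * lam ^ 2 * (ε * φ r ^ 2) := by rw [← mul_assoc, h2, one_mul]
      _ ≤ 4 * M * lam ^ 2 * (r * φ r ^ 2) := by gcongr
      _ ≤ _ := by gcongr
  rcases le_total ε s with hcase | hcase
  · refine (hfar s hcase hss).trans ?_
    have : 0 ≤ M * lam ^ 2 * X ^ 2 := by positivity
    linarith
  · have h1 := h.sol.inner_bound h.locBdd (M := M * lam ^ 2) hε0
      (fun t ht hte => h.bound t ht (by linarith)) hMε.le hs.le hcase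
    have h2 := hfar ε le_rfl hεs
    have h3 := h.pos ε hε0.le
    rw [abs_of_pos hφ, abs_of_pos h3] at h1
    nlinarith

/-- The whole L² mass is bounded by φ(s₁)² times a factor exponential in lam: inside by the Grönwall
estimate, outside by Gaussian decay in |x|. Since the mass is fixed, φ(s₁) cannot be smaller than
the reciprocal. -/
lemma boundary_ge (h : WellSol q φ p s₁ lam α M) :
    (√(Real.pi * (16 * M * s₁ * (√s₁ + (s₁ + 1 + M)) ^ 2 + 2)))⁻¹
      * Real.exp (-((2 * M * √s₁ + 1) * lam)) ≤ φ s₁ := by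
  have hl := h.lam_pos
  have hl1 := h.one_le_lam
  have hM := h.bound_pos
  have hs₁ := h.radius_pos
  have hφ1 := h.pos s₁ hs₁.le
  have hpi := Real.pi_pos
  obtain ⟨D, hD⟩ : ∃ D, D = 16 * M * s₁ * (√s₁ + (s₁ + 1 + M)) ^ 2 + 2 := ⟨_, rfl⟩
  obtain ⟨E, hE⟩ : ∃ E, E = Real.exp (2 * M * √s₁ * lam) := ⟨_, rfl⟩
  have hE1 : 1 ≤ E := by rw [hE]; exact Real.one_le_exp (by positivity)
  have hin : ∫ s in Ioc 0 s₁, φ s ^ 2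
      ≤ 16 * M * s₁ * (√s₁ + (s₁ + 1 + M)) ^ 2 * (lam ^ 2 * φ s₁ ^ 2 * E ^ 2) := by
    have h1 : ∫ s in Ioc 0 s₁, φ s ^ 2 ≤ ∫ s in Ioc 0 s₁,
        16 * M * lam ^ 2 * ((√s₁ + (s₁ + 1 + M)) * φ s₁ * E) ^ 2 :=
      setIntegral_mono_on (h.integrable_sq.mono_set Ioc_subset_Ioi_self)
        (integrableOn_const (by simp)) measurableSet_Ioc
        fun s hs => hE ▸ h.sq_le_interior hs.1 hs.2
    refine h1.trans (le_of_eq ?_)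
    simp only [integral_const, MeasurableSet.univ, Measure.real, Measure.restrict_apply,
      univ_inter, Real.volume_Ioc, sub_zero, smul_eq_mul, ENNReal.toReal_ofReal hs₁.le]
    ring
  have hout : ∫ s in Ioi s₁, φ s ^ 2 ≤ 2 * (lam ^ 2 * φ s₁ ^ 2 * E ^ 2) := by
    have hi : IntegrableOn (fun s => Real.exp (-(lam / 2) * s)) (Ioi s₁) :=
      integrableOn_exp_mul_Ioi (by linarith) s₁
    have h1 : ∫ s in Ioi s₁, φ s ^ 2
        ≤ ∫ s in Ioi s₁, φ s₁ ^ 2 * Real.exp (lam / 2 * s₁) * Real.exp (-(lam / 2) * s) := by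
      refine setIntegral_mono_on (h.integrable_sq.mono_set (Ioi_subset_Ioi hs₁.le))
        (hi.const_mul _) measurableSet_Ioi fun s hs => ?_
      have h2 := pow_le_pow_left₀ (h.pos s (hs₁.trans hs).le).le (h.decay (le_of_lt hs)) 2
      refine h2.trans (le_of_eq ?_)
      rw [mul_pow, mul_assoc, ← Real.exp_add, ← Real.exp_nat_mul]
      congr 2
      push_cast
      ring
    have h3 : ∫ s in Ioi s₁, φ s₁ ^ 2 * Real.exp (lam / 2 * s₁) * Real.exp (-(lam / 2) * s)
        = φ s₁ ^ 2 * (2 / lam) := by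
      rw [integral_const_mul, integral_exp_mul_Ioi (by linarith) s₁, neg_div_neg_eq, mul_assoc]
      congr 1
      rw [← mul_div_assoc, ← Real.exp_add]
      have : lam / 2 * s₁ + -(lam / 2) * s₁ = 0 := by ring
      rw [this, Real.exp_zero]
      field_simp
    rw [h3] at h1
    refine h1.trans ?_
    have h4 : 2 / lam ≤ 2 := div_le_self (by norm_num) hl1
    have h5 : 1 ≤ lam ^ 2 * E ^ 2 := one_le_mul_of_one_le_of_one_le (one_le_pow₀ hl1) (one_le_pow₀ hE1)
    calc φ s₁ ^ 2 * (2 / lam) ≤ φ s₁ ^ 2 * 2 := by gcongr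
      _ = φ s₁ ^ 2 * 2 * 1 := by ring
      _ ≤ φ s₁ ^ 2 * 2 * (lam ^ 2 * E ^ 2) := by gcongr
      _ = _ := by ring
  have hsplit : Real.pi⁻¹ ≤ D * (lam ^ 2 * φ s₁ ^ 2 * E ^ 2) := by
    rw [← h.integral_sq, ← Ioc_union_Ioi_eq_Ioi hs₁.le,
      setIntegral_union Ioc_disjoint_Ioi_same measurableSet_Ioi
        (h.integrable_sq.mono_set Ioc_subset_Ioi_self)
        (h.integrable_sq.mono_set (Ioi_subset_Ioi hs₁.le)), hD]
    linarith
  -- The polynomial factor lam is absorbed into an exponential; this is the +1 in the exponent.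
  have hlE : lam ≤ Real.exp lam := by linarith [Real.add_one_le_exp lam]
  have hD0 : 0 < D := by rw [hD]; positivity
  rw [← hD]
  have hfin : 1 ≤ √(Real.pi * D) * (Real.exp lam * φ s₁ * E) := by
    have h1 : 1 ≤ Real.pi * D * (Real.exp lam * φ s₁ * E) ^ 2 := by
      have h2 : 1 ≤ Real.pi * (D * (lam ^ 2 * φ s₁ ^ 2 * E ^ 2)) := by
        have := mul_le_mul_of_nonneg_left hsplit hpi.le
        rwa [mul_inv_cancel₀ hpi.ne'] at this
      refine h2.trans ?_
      calc Real.pi * (D * (lam ^ 2 * φ s₁ ^ 2 * E ^ 2))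
          ≤ Real.pi * (D * (Real.exp lam ^ 2 * φ s₁ ^ 2 * E ^ 2)) := by gcongr
        _ = _ := by ring
    rw [← Real.sqrt_sq (by positivity : 0 ≤ Real.exp lam * φ s₁ * E),
      ← Real.sqrt_mul (by positivity)]
    exact Real.one_le_sqrt.2 h1
  have hexp : Real.exp (-((2 * M * √s₁ + 1) * lam)) = (Real.exp lam * E)⁻¹ := by
    rw [hE, ← Real.exp_add, ← Real.exp_neg]; congr 1; ring
  have hr : 0 < √(Real.pi * D) := Real.sqrt_pos.2 (by positivity)
  rw [hexp, ← mul_inv, inv_le_iff_one_le_mul₀ (by positivity)]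
  refine hfin.trans (le_of_eq (by ring))

end WellSol

/-- Lower bound for the Laplace integral, from the window `[t₀, 6t₀/5]`. -/
lemma laplaceMoment_zero_ge {w s : ℝ} (hlam : 0 < lam) (hα : 1 ≤ α) (hs₁ : 0 < s₁) (hw : 0 < w)
    (hαw : α ≤ 1 / 2 + lam * w) (hs : s₁ ≤ s) :
    (6 * Real.exp (7 / 10 * (w / s₁) ^ (-(1 / 4) : ℝ)))⁻¹
      * Real.exp (-(2 * lam * (w / s₁) ^ (3 / 4 : ℝ) * s)) ≤ laplaceMoment lam α 0 s := by
  have hs0 : 0 < s := hs₁.trans_le hs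
  -- With t₀ = u^(3/4) and y = u^(-1/4) one has y³ = 1/t₀ and y w = t₀ s₁. On the window the Laplace
  -- factor costs at most (3/5) lam t₀ s, and (1 + 1/t)^(-α) costs at most (7/5) y α ≤ (7/10) y +
  -- (7/5) lam t₀ s₁. Since s₁ ≤ s these add up to 2 lam t₀ s plus the constant (7/10) y.
  obtain ⟨u, hu⟩ : ∃ u, u = w / s₁ := ⟨_, rfl⟩
  have hu0 : 0 < u := by rw [hu]; positivity
  rw [← hu]
  obtain ⟨y, hy⟩ : ∃ y, y = u ^ (-(1 / 4) : ℝ) := ⟨_, rfl⟩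
  obtain ⟨t₀, ht₀⟩ : ∃ t₀, t₀ = u ^ (3 / 4 : ℝ) := ⟨_, rfl⟩
  rw [← hy, ← ht₀]
  have hy0 : 0 < y := by rw [hy]; positivity
  have ht0 : 0 < t₀ := by rw [ht₀]; positivity
  have hty : t₀ * y ^ 3 = 1 := by
    rw [hy, ht₀, ← Real.rpow_natCast, ← Real.rpow_mul hu0.le, ← Real.rpow_add hu0]
    norm_num
  have huy : u * y = t₀ := by
    rw [hy, ht₀]
    nth_rewrite 1 [← Real.rpow_one u]
    rw [← Real.rpow_add hu0]
    norm_num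
  -- The Taylor polynomial of degree 4 suffices; its deficit in the cubic term is absorbed by
  -- completing a square between the quartic and quadratic terms, centred near 17/10.
  have hlog : 1 + y ^ 3 ≤ Real.exp (7 / 5 * y) := by
    have := Real.sum_le_exp_of_nonneg (x := 7 / 5 * y) (by positivity) 5
    simp only [Finset.sum_range_succ, Finset.sum_range_zero, Nat.factorial] at this
    norm_num at this
    refine le_trans ?_ this
    have h1 : 0 ≤ y ^ 2 * (y - 17 / 10) ^ 2 := by positivity
    nlinarith [sq_nonneg (y - 17 / 10), sq_nonneg y]
  have hker : ∀ t ∈ Ioc t₀ (6 / 5 * t₀),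
      Real.exp (-(2 * lam * t₀ * s)) * Real.exp (-(7 / 10 * y)) / (6 / 5 * t₀)
        ≤ Real.exp (-(lam * s * t / 2)) * t ^ 0 * (t ^ (α - 1) * (1 + t) ^ (-α)) := by
    intro t ht
    have htp : 0 < t := ht0.trans ht.1
    have h1 : t ^ (α - 1) * (1 + t) ^ (-α) = (1 + 1 / t) ^ (-α) / t := by
      have : 1 + t = t * (1 + 1 / t) := by field_simp; ring
      rw [this, Real.mul_rpow htp.le (by positivity), ← mul_assoc, ← Real.rpow_add htp]
      have e : α - 1 + -α = -1 := by ring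
      rw [e, Real.rpow_neg_one]; ring
    have h2 : 1 + 1 / t ≤ Real.exp (7 / 5 * y) := by
      refine le_trans ?_ hlog
      have : y ^ 3 = 1 / t₀ := by field_simp; linarith
      rw [this]
      have := ht.1
      gcongr
    have h3 : Real.exp (-(7 / 5 * y * α)) ≤ (1 + 1 / t) ^ (-α) := by
      have := Real.rpow_le_rpow_of_nonpos (z := -α) (by positivity) h2 (by linarith)
      rwa [← Real.exp_mul, mul_neg] at this
    have h4 : Real.exp (-(2 * lam * t₀ * s)) * Real.exp (-(7 / 10 * y))
        ≤ Real.exp (-(lam * s * t / 2)) * Real.exp (-(7 / 5 * y * α)) := by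
      rw [← Real.exp_add, ← Real.exp_add, Real.exp_le_exp]
      have h5 : y * α ≤ y * (1 / 2 + lam * w) := by gcongr
      have h6 : y * w = t₀ * s₁ := by
        rw [← huy, hu]; field_simp
      have h7 : lam * (t₀ * s₁) ≤ lam * (t₀ * s) := by gcongr
      have h8 : lam * s * t ≤ lam * s * (6 / 5 * t₀) := by
        have := ht.2
        gcongr
      have h9 : y * (lam * w) = lam * (t₀ * s₁) := by rw [← h6]; ring
      nlinarith
    rw [h1, pow_zero, mul_one, ← mul_div_assoc]
    have := ht.2
    have hE : 0 ≤ Real.exp (-(2 * lam * t₀ * s)) * Real.exp (-(7 / 10 * y)) := by positivity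
    calc _ ≤ Real.exp (-(2 * lam * t₀ * s)) * Real.exp (-(7 / 10 * y)) / t := by gcongr
      _ ≤ Real.exp (-(lam * s * t / 2)) * Real.exp (-(7 / 5 * y * α)) / t := by gcongr
      _ ≤ _ := by gcongr
  have hi := integrableOn_moment hlam hα hs0 0
  have h1 : ∫ t in Ioc t₀ (6 / 5 * t₀),
      Real.exp (-(2 * lam * t₀ * s)) * Real.exp (-(7 / 10 * y)) / (6 / 5 * t₀)
        ≤ ∫ t in Ioc t₀ (6 / 5 * t₀),
          Real.exp (-(lam * s * t / 2)) * t ^ 0 * (t ^ (α - 1) * (1 + t) ^ (-α)) :=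
    setIntegral_mono_on (integrableOn_const (by simp))
      (hi.mono_set fun t ht => ht0.trans ht.1) measurableSet_Ioc hker
  have h2 : ∫ t in Ioc t₀ (6 / 5 * t₀),
      Real.exp (-(lam * s * t / 2)) * t ^ 0 * (t ^ (α - 1) * (1 + t) ^ (-α))
        ≤ laplaceMoment lam α 0 s := by
    refine setIntegral_mono_set hi ?_ (LE.le.eventuallyLE fun t ht => ht0.trans ht.1)
    rw [EventuallyLE, ae_restrict_iff' measurableSet_Ioi]
    refine ae_of_all _ fun t ht => ?_
    have ht : 0 < t := ht
    simp only [Pi.zero_apply]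
    positivity
  refine le_trans (le_of_eq ?_) (h1.trans h2)
  -- Window length t₀/5 against the bound 1/t ≥ 1/(6 t₀/5) leaves the factor 1/6.
  have h3 : 6 / 5 * t₀ - t₀ = t₀ / 5 := by ring
  simp only [integral_const, MeasurableSet.univ, Measure.real, Measure.restrict_apply,
    univ_inter, Real.volume_Ioc, smul_eq_mul, h3,
    ENNReal.toReal_ofReal (by positivity : 0 ≤ t₀ / 5)]
  rw [Real.exp_neg (7 / 10 * y)]
  field_simp

end Estimates

end MagneticWell

namespace MagneticWell

open scoped Convolution
open Set Topology

/-! ### From the ground state to a positive radial solution -/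

section GroundState

lemma RadialSol.linear_comb {q φ p φ' p' : ℝ → ℝ} (h : RadialSol q φ p) (h' : RadialSol q φ' p')
    (hq : LocBdd q) (c d : ℝ) :
    RadialSol q (fun s => c * φ s + d * φ' s) (fun s => c * p s + d * p' s) where
  cont := (h.cont.const_smul c).add (h'.cont.const_smul d)
  flux s hs := by
    rw [h.flux s hs, h'.flux s hs, ← intervalIntegral.integral_const_mul,
      ← intervalIntegral.integral_const_mul, ← intervalIntegral.integral_add
        (((h.locInt hq).intervalIntegrable le_rfl hs).const_mul c)
        (((h'.locInt hq).intervalIntegrable le_rfl hs).const_mul d)]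
    exact intervalIntegral.integral_congr fun t _ => by ring
  hasDerivAt s hs :=
    (((h.hasDerivAt s hs).const_mul c).add ((h'.hasDerivAt s hs).const_mul d)).congr_deriv (by ring)

variable {lam e a : ℝ} {v : Plane → ℝ} {ψ : Plane → ℂ}

lemma locBdd_radialCoeff (hv : IsRadialWell v a) (lam e : ℝ) : LocBdd (radialCoeff lam e v) where
  measurable := measurable_radialCoeff hv.measurable lam e
  bound R := by
    obtain ⟨B, hB⟩ := hv.abs_bounded
    refine ⟨(lam ^ 2 * |R| / 4 + lam ^ 2 * |B| + |e|) / 4, by positivity, fun s hs hsR => ?_⟩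
    have h1 : |profile v s| ≤ |B| := (hB _).trans (le_abs_self B)
    have h2 : s ≤ |R| := hsR.trans (le_abs_self R)
    rw [radialCoeff, abs_div, abs_of_pos (four_pos : (0 : ℝ) < 4)]
    gcongr
    refine (abs_sub _ _).trans (add_le_add_left ((abs_add_le _ _).trans ?_) _)
    rw [abs_mul, abs_of_nonneg (sq_nonneg lam), abs_of_nonneg (by positivity)]
    gcongr

/-- A radial ground state is, up to a phase, a solution of the radial equation that is positive at
the origin. -/
lemma exists_phase (hv : IsRadialWell v a) (hgs : IsGroundState lam lam v e ψ) {f : ℝ → ℂ}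
    (hf : ψ =ᵐ[volume] fun x => f ‖x‖) :
    ∃ (c : ℂ) (φ p : ℝ → ℝ), ‖c‖ = 1 ∧ RadialSol (radialCoeff lam e v) φ p ∧
      (fun x => ((φ (‖x‖ ^ 2) : ℝ) : ℂ)) =ᵐ[volume] (fun x => c * ψ x) ∧ 0 < φ 0 := by
  have hq := locBdd_radialCoeff hv lam e
  set g : ℝ → ℂ := fun s => f (√s) with hgdef
  have hg : ψ =ᵐ[volume] fun x => g (‖x‖ ^ 2) := by
    filter_upwards [hf] with x hx
    rw [hx, hgdef]
    simp only [Real.sqrt_sq (norm_nonneg x)]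
  have hm := aestronglyMeasurable_radial hgs.eigen.1 hg
  have hi := integrableOn_sq_radial hgs.eigen.1 hg
  have hmr : AEStronglyMeasurable (fun s => (g s).re) (volume.restrict (Ioi 0)) :=
    Complex.continuous_re.comp_aestronglyMeasurable hm
  have hmi : AEStronglyMeasurable (fun s => (g s).im) (volume.restrict (Ioi 0)) :=
    Complex.continuous_im.comp_aestronglyMeasurable hm
  have hir : IntegrableOn (fun s => (g s).re ^ 2) (Ioi 0) := by
    refine hi.mono' (hmr.pow 2) (ae_of_all _ fun s => ?_)
    rw [Real.norm_eq_abs, abs_pow]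
    exact pow_le_pow_left₀ (abs_nonneg _) (Complex.abs_re_le_norm _) 2
  have hii : IntegrableOn (fun s => (g s).im ^ 2) (Ioi 0) := by
    refine hi.mono' (hmi.pow 2) (ae_of_all _ fun s => ?_)
    rw [Real.norm_eq_abs, abs_pow]
    exact pow_le_pow_left₀ (abs_nonneg _) (Complex.abs_im_le_norm _) 2
  obtain ⟨φ₁, p₁, h₁, he₁⟩ := exists_radialSol hq hmr hir
    (fun χ hχ hχc => weak_radial_re hv hgs hg hχ hχc)
  obtain ⟨φ₂, p₂, h₂, he₂⟩ := exists_radialSol hq hmi hii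
    (fun χ hχ hχc => weak_radial_im hv hgs hg hχ hχc)
  obtain ⟨A, hA⟩ : ∃ A, A = φ₁ 0 := ⟨_, rfl⟩
  obtain ⟨B, hB⟩ : ∃ B, B = φ₂ 0 := ⟨_, rfl⟩
  -- If both values at the origin vanished, uniqueness would make ψ zero, against normalization.
  have hne : 0 < A ^ 2 + B ^ 2 := by
    by_contra hcon
    have hA0 : A = 0 := by nlinarith [sq_nonneg A, sq_nonneg B]
    have hB0 : B = 0 := by nlinarith [sq_nonneg A, sq_nonneg B]
    have hn := integral_sq_radial hgs.normalized hg
    have hz : ∫ s in Ioi (0 : ℝ), ‖g s‖ ^ 2 = 0 := by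
      refine integral_eq_zero_of_ae ?_
      filter_upwards [he₁, he₂, ae_restrict_mem measurableSet_Ioi] with s h1 h2 hs
      rw [h₁.eq_zero hq (hA ▸ hA0) (le_of_lt hs)] at h1
      rw [h₂.eq_zero hq (hB ▸ hB0) (le_of_lt hs)] at h2
      have : g s = 0 := Complex.ext h1 h2
      simp [this]
    rw [hz] at hn
    simp at hn
  obtain ⟨ρ, hρ⟩ : ∃ ρ, ρ = √(A ^ 2 + B ^ 2) := ⟨_, rfl⟩
  have hρ0 : 0 < ρ := by rw [hρ]; exact Real.sqrt_pos.2 hne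
  have hρ2 : ρ ^ 2 = A ^ 2 + B ^ 2 := by rw [hρ, Real.sq_sqrt hne.le]
  -- The combination A φ₂ - B φ₁ is a solution vanishing at the origin, hence zero. Multiplying by
  -- the phase (A - iB)/ρ therefore removes the imaginary part and leaves the value ρ > 0 at the
  -- origin.
  have hperp : ∀ s, 0 ≤ s → A * φ₂ s = B * φ₁ s := by
    intro s hs
    have := (h₁.linear_comb h₂ hq (-B) A).eq_zero hq (by rw [← hA, ← hB]; ring) hs
    linarith
  refine ⟨⟨A / ρ, -(B / ρ)⟩, fun s => A / ρ * φ₁ s + B / ρ * φ₂ s, _, ?_,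
    h₁.linear_comb h₂ hq (A / ρ) (B / ρ), ?_, ?_⟩
  · have h1 : ‖(⟨A / ρ, -(B / ρ)⟩ : ℂ)‖ ^ 2 = 1 := by
      rw [← Complex.normSq_eq_norm_sq, Complex.normSq_apply]
      simp only
      have : A / ρ * (A / ρ) + -(B / ρ) * -(B / ρ) = (A ^ 2 + B ^ 2) / ρ ^ 2 := by
        field_simp
      rw [this, hρ2, div_self hne.ne']
    exact (pow_eq_one_iff_of_nonneg (norm_nonneg _) two_ne_zero).1 h1
  · have h1 := ae_normSq_iff.2 he₁
    have h2 := ae_normSq_iff.2 he₂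
    filter_upwards [hg, h1, h2] with x hx hx1 hx2
    rw [hx]
    have hp := hperp (‖x‖ ^ 2) (sq_nonneg _)
    rw [← hx1, ← hx2] at hp ⊢
    apply Complex.ext
    · simp only [Complex.ofReal_re, Complex.mul_re]
      ring
    · simp only [Complex.ofReal_im, Complex.mul_im]
      field_simp
      linarith
  · simp only [← hA, ← hB]
    have : A / ρ * A + B / ρ * B = ρ := by
      field_simp
      linarith
    rwa [this]

/-- The ground state energy lies above the minimum of the potential. -/
lemma essInf_le_energy (hv : IsRadialWell v a) {φ p : ℝ → ℝ}
    (h : RadialSol (radialCoeff lam e v) φ p) (hpos : ∀ s, 0 ≤ s → 0 < φ s)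
    (hi : IntegrableOn (fun s => φ s ^ 2) (Ioi 0)) : lam ^ 2 * essInf v volume ≤ e := by
  -- Below lam² v_min the coefficient is nonnegative almost everywhere, so the flux is nonnegative
  -- and φ stays above φ 0 > 0, which contradicts square integrability.
  by_contra hcon
  push Not at hcon
  have hq := locBdd_radialCoeff hv lam e
  have hbd : IsBoundedUnder (· ≥ ·) (ae volume) v := by
    obtain ⟨M, hM⟩ := hv.bounded
    exact isBoundedUnder_of ⟨-M, hM⟩
  have h1 : ∀ᵐ s ∂volume.restrict (Ioi (0 : ℝ)), essInf v volume ≤ profile v s := by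
    rw [← ae_normSq_iff]
    filter_upwards [ae_essInf_le hbd] with x hx
    rwa [profile_normSq hv.radial]
  have hq0 : ∀ᵐ s ∂volume.restrict (Ioi (0 : ℝ)), 0 ≤ radialCoeff lam e v s * φ s := by
    filter_upwards [h1, ae_restrict_mem measurableSet_Ioi] with s hs hs0
    have hs0 : 0 < s := hs0
    refine mul_nonneg ?_ (hpos s hs0.le).le
    rw [radialCoeff]
    have h2 : lam ^ 2 * essInf v volume ≤ lam ^ 2 * profile v s := by gcongr
    have h3 : 0 ≤ lam ^ 2 * s := by positivity
    linarith
  have hp : ∀ s, 0 ≤ s → 0 ≤ p s := by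
    intro s hs
    rw [h.flux s hs, intervalIntegral.integral_of_le hs]
    refine setIntegral_nonneg_of_ae_restrict ?_
    exact ae_restrict_of_ae_restrict_of_subset Ioc_subset_Ioi_self hq0
  refine not_eventually_ge_of_sq hi (hpos 0 le_rfl) ?_
  filter_upwards [eventually_ge_atTop 0] with s hs
  have h2 := h.sub_eq hq le_rfl hs
  have h3 : 0 ≤ ∫ t in (0 : ℝ)..s, p t / t :=
    intervalIntegral.integral_nonneg hs fun t ht => div_nonneg (hp t ht.1) ht.1
  linarith

lemma profile_eq_zero (hv : IsRadialWell v a) {s : ℝ} (hs : a ^ 2 < s) : profile v s = 0 := by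
  by_contra hcon
  have h1 : √s • EuclideanSpace.single (0 : Fin 2) (1 : ℝ) ∈ Metric.closedBall (0 : Plane) a :=
    hv.support hcon
  rw [mem_closedBall_zero_iff, norm_smul, PiLp.norm_single, norm_one, mul_one,
    Real.norm_eq_abs, abs_of_nonneg (Real.sqrt_nonneg _)] at h1
  have := Real.lt_sqrt_of_sq_lt hs
  linarith

/-- A bound for the coefficient of the radial equation in the well, in units of `lam²`. -/
lemma abs_radialCoeff_le {B s : ℝ} (hB : ∀ x, |v x| ≤ B) (hs : 0 ≤ s) (hsa : s ≤ a ^ 2 + 1)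
    (he : e ≤ 0) (he' : lam ^ 2 * essInf v volume ≤ e) :
    |radialCoeff lam e v s| ≤ (a ^ 2 + 1 + B + |essInf v volume|) * lam ^ 2 := by
  have h1 : |e| ≤ lam ^ 2 * |essInf v volume| := by
    rw [abs_of_nonpos he]
    have := mul_le_mul_of_nonneg_left (neg_abs_le (essInf v volume)) (sq_nonneg lam)
    linarith
  have hB0 : 0 ≤ B := (abs_nonneg _).trans (hB 0)
  rw [radialCoeff, abs_div, abs_of_pos (four_pos : (0 : ℝ) < 4)]
  have h2 : |lam ^ 2 * s / 4 + lam ^ 2 * profile v s - e|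
      ≤ lam ^ 2 * s / 4 + lam ^ 2 * |profile v s| + |e| := by
    refine (abs_sub _ _).trans (add_le_add_left ((abs_add_le _ _).trans (le_of_eq ?_)) _)
    rw [abs_mul, abs_of_nonneg (sq_nonneg lam), abs_of_nonneg (by positivity)]
  have h3 : lam ^ 2 * s ≤ lam ^ 2 * (a ^ 2 + 1) := by gcongr
  have h4 : lam ^ 2 * |profile v s| ≤ lam ^ 2 * B := by gcongr; exact hB _
  have h5 : 0 ≤ lam ^ 2 * B := by positivity
  have h6 : 0 ≤ lam ^ 2 * |essInf v volume| := by positivity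
  have h7 : 0 ≤ lam ^ 2 * (a ^ 2 + 1) := by positivity
  have h8 : 0 ≤ lam ^ 2 * s := by positivity
  linarith

/-- For `lam` large the ground state is given by a positive solution of the radial equation, with
bounds that do not depend on `lam`. -/
theorem eventually_wellSol (hv : IsRadialWell v a) (hrad : RadialGroundState v) :
    ∃ M : ℝ, ∀ᶠ lam : ℝ in atTop, ∀ (e : ℝ) (ψ : Plane → ℂ), IsGroundState lam lam v e ψ →
      (lam - e) / (2 * lam) ≤ 1 / 2 + lam * (|essInf v volume| / 2) ∧
      ∃ (c : ℂ) (φ p q : ℝ → ℝ), ‖c‖ = 1 ∧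
        (fun x => ((φ (‖x‖ ^ 2) : ℝ) : ℂ)) =ᵐ[volume] (fun x => c * ψ x) ∧
        WellSol q φ p (a ^ 2) lam ((lam - e) / (2 * lam)) M := by
  obtain ⟨B, hB⟩ := hv.abs_bounded
  have hB0 : 0 ≤ B := (abs_nonneg _).trans (hB 0)
  have ha := hv.radius_pos
  -- The last summand only serves to make M a² ≥ 1; the others bound the coefficient up to a² + 1.
  refine ⟨a ^ 2 + 1 + B + |essInf v volume| + (a ^ 2)⁻¹, ?_⟩
  filter_upwards [hrad, eventually_energy_le hv, eventually_ge_atTop 1]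
    with lam hr hen hlam e ψ hgs
  obtain ⟨f, hf⟩ := hr e ψ hgs
  have he := hen e ψ hgs
  have hl : 0 < lam := by linarith
  obtain ⟨c, φ, p, hc, hsol, hψ, h0⟩ := exists_phase hv hgs hf
  have hq := locBdd_radialCoeff hv lam e
  have hpos : ∀ s, 0 ≤ s → 0 < φ s := fun s hs =>
    hsol.pos hq (fun χ hχ hχc => form_nonneg hv hgs hχ hχc) h0 hs
  have hnorm : ∀ᵐ x : Plane, φ (‖x‖ ^ 2) ^ 2 = ‖ψ x‖ ^ 2 := by
    filter_upwards [hψ] with x hx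
    have := congrArg (‖·‖ ^ 2) hx
    simpa [hc] using this
  have hi : IntegrableOn (fun s => φ s ^ 2) (Ioi 0) := by
    rw [← integrable_normSq]
    exact (hgs.eigen.1.integrable_norm_pow two_ne_zero).congr
      (hnorm.mono fun x hx => hx.symm)
  have hn : Real.pi * ∫ s in Ioi (0 : ℝ), φ s ^ 2 = 1 := by
    rw [← smul_eq_mul, ← integral_normSq (fun s => φ s ^ 2), integral_congr_ae hnorm]
    exact hgs.normalized
  have hlow := essInf_le_energy hv hsol hpos hi
  have hneg : essInf v volume < 0 := hv.min_neg
  refine ⟨?_, c, φ, p, radialCoeff lam e v, hc, hψ, ?_⟩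
  · rw [div_le_iff₀ (by positivity), abs_of_neg hneg]
    linarith
  · exact
    { sol := hsol
      locBdd := hq
      pos := hpos
      integrable_sq := hi
      normalized := hn
      radius_pos := by positivity
      one_le_lam := hlam
      -- α ≥ 1 is the same as e ≤ -lam.
      one_le_exponent := by rw [le_div_iff₀ (by positivity)]; linarith
      exterior := fun s hs => by
        rw [radialCoeff, profile_eq_zero hv hs]
        field_simp
        ring
      bound := fun s hs hsa => by
        refine (abs_radialCoeff_le hB hs hsa (by linarith) hlow).trans ?_
        refine mul_le_mul_of_nonneg_right ?_ (sq_nonneg _)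
        have : 0 ≤ (a ^ 2)⁻¹ := by positivity
        linarith
      one_le_bound := by
        have : 0 ≤ (a ^ 2)⁻¹ := by positivity
        have : 0 ≤ a ^ 2 := by positivity
        linarith [abs_nonneg (essInf v volume)]
      one_le_bound_mul := by
        rw [add_mul, inv_mul_cancel₀ (by positivity)]
        have : 0 ≤ (a ^ 2 + 1 + B + |essInf v volume|) * a ^ 2 := by positivity
        linarith }

end GroundState

end MagneticWell

namespace MagneticWell

open Set Topology

/-! ### Pointwise lower bound outside the well -/

section Bounds

variable {q φ p : ℝ → ℝ} {s₁ lam α M : ℝ}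

/-- Pointwise lower bound outside the well. -/
lemma WellSol.gaussian_lower (h : WellSol q φ p s₁ lam α M) {w : ℝ} (hw : 0 < w)
    (hαw : α ≤ 1 / 2 + lam * w) {s : ℝ} (hs : s₁ ≤ s) :
    φ s₁ * (s₁ / 2) * (6 * Real.exp (7 / 10 * (w / s₁) ^ (-(1 / 4) : ℝ)))⁻¹
      * Real.exp (-(lam * (s - s₁) / 4 + 2 * lam * (w / s₁) ^ (3 / 4 : ℝ) * s)) ≤ φ s := by
  have hl := h.lam_pos
  have hs₁ := h.radius_pos
  have hφ1 := h.pos s₁ hs₁.le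
  obtain ⟨C, hC, hCs⟩ := h.exists_eq_decayingSol
  have hI := laplaceMoment_zero_ge hl h.one_le_exponent hs₁ hw hαw hs
  set L := (6 * Real.exp (7 / 10 * (w / s₁) ^ (-(1 / 4) : ℝ)))⁻¹ with hL
  have hL0 : 0 < L := by rw [hL]; positivity
  set T := (w / s₁) ^ (3 / 4 : ℝ) with hT
  -- The constant C is recovered from the edge value: there the Laplace integral is at most 2/(lam
  -- s₁) ≤ 2/s₁.
  have h1 : φ s₁ * (s₁ / 2) ≤ C * Real.exp (-(lam * s₁ / 4)) := by
    have h2 : laplaceMoment lam α 0 s₁ * (s₁ / 2) ≤ 1 := by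
      have h3 := laplaceMoment_zero_le hl h.one_le_exponent hs₁
      calc _ ≤ 2 / (lam * s₁) * (s₁ / 2) := by gcongr
        _ = lam⁻¹ := by field_simp
        _ ≤ 1 := inv_le_one_of_one_le₀ h.one_le_lam
    rw [hCs s₁ le_rfl, decayingSol]
    calc _ = C * Real.exp (-(lam * s₁ / 4)) * (laplaceMoment lam α 0 s₁ * (s₁ / 2)) := by ring
      _ ≤ _ := mul_le_of_le_one_right (by positivity) h2
  have h4 : Real.exp (-(lam * (s - s₁) / 4 + 2 * lam * T * s)) * Real.exp (-(lam * s₁ / 4))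
      = Real.exp (-(lam * s / 4)) * Real.exp (-(2 * lam * T * s)) := by
    rw [← Real.exp_add, ← Real.exp_add]; congr 1; ring
  calc _ ≤ C * Real.exp (-(lam * s₁ / 4)) * L
        * Real.exp (-(lam * (s - s₁) / 4 + 2 * lam * T * s)) := by gcongr
    _ = C * L * (Real.exp (-(lam * (s - s₁) / 4 + 2 * lam * T * s))
        * Real.exp (-(lam * s₁ / 4))) := by ring
    _ = C * (Real.exp (-(lam * s / 4)) * (L * Real.exp (-(2 * lam * T * s)))) := by rw [h4]; ring
    _ ≤ C * (Real.exp (-(lam * s / 4)) * laplaceMoment lam α 0 s) := by gcongr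
    _ = φ s := by rw [hCs s hs, decayingSol]

end Bounds

end MagneticWell


/-! ### Choice of constants and assembly -/

theorem theorem2p1 (v : MagneticWell.Plane → ℝ) (a : ℝ)
    (hv : MagneticWell.IsRadialWell v a)
    (hrad : MagneticWell.RadialGroundState v)
    (hgap : MagneticWell.SpectralGap v) :
    ∃ μ₀ μ₁ lamStar K : ℝ, 0 < μ₀ ∧ 0 < μ₁ ∧ 0 < lamStar ∧ 0 < K ∧
      ∀ lam : ℝ, lamStar < lam → ∀ (e : ℝ) (ψ : MagneticWell.Plane → ℂ),
        MagneticWell.IsGroundState lam lam v e ψ →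
        -- the positive, radial, continuous version of the ground state
        ∃ (c : ℂ) (φ : MagneticWell.Plane → ℝ), ‖c‖ = 1 ∧
          (fun x => (φ x : ℂ)) =ᵐ[volume] (fun x => c * ψ x) ∧
          Continuous φ ∧ (∀ x, 0 < φ x) ∧ (∀ x y, ‖x‖ = ‖y‖ → φ x = φ y) ∧
          -- two-sided Gaussian bounds
          (∀ z : MagneticWell.Plane, a < ‖z‖ →
            lam⁻¹ * Real.exp (-((1 / 4 + μ₀) * lam * ((‖z‖ ^ 2 - a ^ 2) + μ₁))) ≤ K * φ z ∧
            φ z ≤ K * (Real.sqrt lam * Real.exp (-(1 / 4 * lam * (‖z‖ ^ 2 - a ^ 2))))) ∧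
          -- exterior representation, which fixes the constant, and the intermediate bounds
          0 < (lam - e) / (2 * lam) ∧
          ∃ C : ℝ, 0 < C ∧ ∀ z : MagneticWell.Plane, a < ‖z‖ →
            MeasureTheory.IntegrableOn (fun t : ℝ =>
              Real.exp (-(lam * ‖z‖ ^ 2 * t / 2)) * t ^ ((lam - e) / (2 * lam) - 1) *
                (1 + t) ^ (-((lam - e) / (2 * lam)))) (Set.Ioi 0) MeasureTheory.volume ∧
            φ z = C * MagneticWell.exteriorProfile lam ((lam - e) / (2 * lam)) ‖z‖ ∧
            Real.exp (-(2 * lam * (|essInf v volume| / 2) ^ (3 / 4 : ℝ) *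
                a ^ (-(3 / 2) : ℝ) * ‖z‖ ^ 2)) ≤
              K * (φ z / (C / Real.sqrt lam * Real.exp (-(1 / 4 * lam * ‖z‖ ^ 2)))) ∧
            φ z / (C / Real.sqrt lam * Real.exp (-(1 / 4 * lam * ‖z‖ ^ 2))) ≤ K := by
  have ha := hv.radius_pos
  obtain ⟨M, hM⟩ := MagneticWell.eventually_wellSol hv hrad
  obtain ⟨lam₀, hlam₀⟩ := eventually_atTop.1 hM
  obtain ⟨s₁, hs₁⟩ : ∃ s₁, s₁ = a ^ 2 := ⟨_, rfl⟩
  obtain ⟨w, hw⟩ : ∃ w, w = |essInf v volume| / 2 := ⟨_, rfl⟩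
  have hs0 : 0 < s₁ := by rw [hs₁]; positivity
  have hw0 : 0 < w := by
    rw [hw]
    exact half_pos (abs_pos.2 hv.min_neg.ne)
  obtain ⟨T, hT⟩ : ∃ T : ℝ, T = (w / s₁) ^ (3 / 4 : ℝ) := ⟨_, rfl⟩
  have hT0 : 0 < T := by rw [hT]; positivity
  -- T is the rate (|v_min|/2)^(3/4) a^(-3/2) of the statement, since s₁ = a².
  have hTa : w ^ (3 / 4 : ℝ) * a ^ (-(3 / 2) : ℝ) = T := by
    rw [hT, Real.div_rpow hw0.le hs0.le, hs₁, ← Real.rpow_natCast, ← Real.rpow_mul ha.le]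
    have e1 : ((2 : ℕ) : ℝ) * (3 / 4) = 3 / 2 := by norm_num
    rw [e1, Real.rpow_neg ha.le]
    exact (div_eq_mul_inv _ _).symm
  obtain ⟨L, hL⟩ : ∃ L, L = (6 * Real.exp (7 / 10 * (w / s₁) ^ (-(1 / 4) : ℝ)))⁻¹ := ⟨_, rfl⟩
  have hL0 : 0 < L := by rw [hL]; positivity
  -- That M ≥ 1 is known only once a ground state is given. The maximum makes the constants positive
  -- beforehand, and it equals M afterwards.
  obtain ⟨M', hM'⟩ : ∃ M', M' = max M 1 := ⟨_, rfl⟩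
  have hM'0 : 0 < M' := by rw [hM']; exact lt_max_of_lt_right one_pos
  obtain ⟨b, hb⟩ : ∃ b, b = (√(Real.pi * (16 * M' * s₁ * (√s₁ + (s₁ + 1 + M')) ^ 2 + 2)))⁻¹ :=
    ⟨_, rfl⟩
  have hb0 : 0 < b := by
    rw [hb]
    have := Real.pi_pos
    exact inv_pos.2 (Real.sqrt_pos.2 (by positivity))
  obtain ⟨U, hU⟩ : ∃ U, U = √(8 * (s₁ + 1 + M') / (s₁ * Real.pi)) := ⟨_, rfl⟩
  have hU0 : 0 ≤ U := by rw [hU]; positivity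
  obtain ⟨k, hk⟩ : ∃ k, k = 2 * M' * √s₁ + 1 := ⟨_, rfl⟩
  have hk0 : 0 < k := by rw [hk]; positivity
  obtain ⟨N, hN⟩ : ∃ N, N = b * (s₁ / 2) * L := ⟨_, rfl⟩
  have hN0 : 0 < N := by rw [hN]; positivity
  -- The four requirements serve, in order, the lower Gaussian bound, the lower intermediate bound,
  -- the upper Gaussian bound and the upper intermediate bound.
  obtain ⟨K, hKN, hKL, hKU, hKs⟩ : ∃ K, N⁻¹ ≤ K ∧ L⁻¹ ≤ K ∧ U ≤ K ∧ 2 / s₁ ≤ K :=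
    ⟨N⁻¹ + L⁻¹ + U + 2 / s₁, by
      have h1 : 0 < N⁻¹ := inv_pos.2 hN0
      have h2 : 0 < L⁻¹ := inv_pos.2 hL0
      have h3 : 0 < 2 / s₁ := by positivity
      refine ⟨?_, ?_, ?_, ?_⟩ <;> linarith⟩
  have hK0 : 0 < K := (inv_pos.2 hN0).trans_le hKN
  -- The lower bound decays at rate lam/4 in s - s₁ but 2 lam T in s itself, and it loses exp(-k
  -- lam) at the edge. Taking μ₀ = 2T, the summand s₁ of μ₁ turns s - s₁ into s, and k/(1/4 + 2T)
  -- absorbs the edge loss.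
  refine ⟨2 * T, s₁ + k / (1 / 4 + 2 * T), max lam₀ 1, K, by positivity, by positivity,
    lt_max_of_lt_right one_pos, hK0, fun lam hlam e ψ hgs => ?_⟩
  obtain ⟨hα, c, φ, p, q, hc, hψ, h⟩ := hlam₀ lam ((le_max_left _ _).trans hlam.le) e ψ hgs
  rw [← hs₁] at h
  rw [← hw] at hα
  obtain ⟨α, hαe⟩ : ∃ α, α = (lam - e) / (2 * lam) := ⟨_, rfl⟩
  rw [← hαe] at hα h
  have hMM : M' = M := by rw [hM', max_eq_left h.one_le_bound]
  rw [← hMM] at h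
  have hl := h.lam_pos
  obtain ⟨C, hC, hCs⟩ := h.exists_eq_decayingSol
  have hz : ∀ z : MagneticWell.Plane, a < ‖z‖ → s₁ < ‖z‖ ^ 2 := fun z hz => by
    rw [hs₁]; gcongr
  -- The Gaussian and C cancel, so the intermediate bounds concern √lam times the Laplace integral
  -- alone.
  have hratio : ∀ s, s₁ < s →
      φ s / (C / √lam * Real.exp (-(1 / 4 * lam * s))) = √lam * MagneticWell.laplaceMoment lam α 0 s := by
    intro s hs
    have hsq : 0 < √lam := Real.sqrt_pos.2 hl
    have hE := Real.exp_pos (-(1 / 4 * lam * s))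
    have e1 : -(lam * s / 4) = -(1 / 4 * lam * s) := by ring
    rw [hCs s hs.le, MagneticWell.decayingSol, e1]
    field_simp
  have hint : ∀ s, s₁ < s → IntegrableOn (fun t : ℝ =>
      Real.exp (-(lam * s * t / 2)) * t ^ (α - 1) * (1 + t) ^ (-α)) (Set.Ioi 0) := by
    intro s hs
    have := MagneticWell.integrableOn_moment hl h.one_le_exponent (hs0.trans hs) 0
    simpa only [pow_zero, mul_one, ← mul_assoc] using this
  refine ⟨c, fun x => φ (‖x‖ ^ 2), hc, hψ, ?_, fun x => h.pos _ (sq_nonneg _),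
    fun x y hxy => by simp only [hxy], fun z hza => ?_, ?_, C, hC, fun z hza => ?_⟩
  · exact h.sol.cont.comp_continuous (by fun_prop) fun x => Set.mem_Ici.2 (sq_nonneg _)
  · have hs := hz z hza
    rw [← hs₁]
    constructor
    · have h1 := h.gaussian_lower hw0 hα hs.le
      have h2 := h.boundary_ge
      rw [← hL, ← hT] at h1
      rw [← hb, ← hk] at h2
      have e1 : (1 / 4 + 2 * T) * lam * (‖z‖ ^ 2 - s₁ + (s₁ + k / (1 / 4 + 2 * T)))
          = lam * (‖z‖ ^ 2 - s₁) / 4 + 2 * lam * T * ‖z‖ ^ 2 + lam * s₁ / 4 + k * lam := by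
        field_simp
        ring
      have h3 : Real.exp (-((1 / 4 + 2 * T) * lam * (‖z‖ ^ 2 - s₁ + (s₁ + k / (1 / 4 + 2 * T)))))
          ≤ Real.exp (-(k * lam))
            * Real.exp (-(lam * (‖z‖ ^ 2 - s₁) / 4 + 2 * lam * T * ‖z‖ ^ 2)) := by
        rw [← Real.exp_add, Real.exp_le_exp, e1]
        have : 0 ≤ lam * s₁ := by positivity
        linarith
      have h4 : N * (Real.exp (-(k * lam))
          * Real.exp (-(lam * (‖z‖ ^ 2 - s₁) / 4 + 2 * lam * T * ‖z‖ ^ 2))) ≤ φ (‖z‖ ^ 2) := by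
        refine le_trans ?_ h1
        calc _ = b * Real.exp (-(k * lam)) * (s₁ / 2) * L
              * Real.exp (-(lam * (‖z‖ ^ 2 - s₁) / 4 + 2 * lam * T * ‖z‖ ^ 2)) := by rw [hN]; ring
          _ ≤ _ := by gcongr
      have hφ := h.pos (‖z‖ ^ 2) (sq_nonneg _)
      calc _ ≤ 1 * (Real.exp (-(k * lam))
            * Real.exp (-(lam * (‖z‖ ^ 2 - s₁) / 4 + 2 * lam * T * ‖z‖ ^ 2))) := by
            gcongr
            exact inv_le_one_of_one_le₀ h.one_le_lam
        _ = N⁻¹ * (N * (Real.exp (-(k * lam))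
            * Real.exp (-(lam * (‖z‖ ^ 2 - s₁) / 4 + 2 * lam * T * ‖z‖ ^ 2)))) := by
            rw [← mul_assoc N⁻¹, inv_mul_cancel₀ hN0.ne']
        _ ≤ N⁻¹ * φ (‖z‖ ^ 2) := by gcongr
        _ ≤ _ := by gcongr
    · have h1 := h.decay hs.le
      have h2 := h.boundary_le
      rw [← hU] at h2
      have e1 : lam * (‖z‖ ^ 2 - s₁) / 4 = 1 / 4 * lam * (‖z‖ ^ 2 - s₁) := by ring
      rw [e1] at h1
      refine h1.trans ?_
      rw [← mul_assoc]
      gcongr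
      exact h2.trans (by gcongr)
  · rw [← hαe]
    linarith [h.one_le_exponent]
  · have hs := hz z hza
    have hsz : 0 < ‖z‖ ^ 2 := hs0.trans hs
    rw [← hαe]
    refine ⟨hint _ hs, ?_, ?_, ?_⟩
    · rw [MagneticWell.exteriorProfile_eq]
      exact hCs _ hs.le
    · rw [hratio _ hs, ← hw]
      have e1 : 2 * lam * w ^ (3 / 4 : ℝ) * a ^ (-(3 / 2) : ℝ) * ‖z‖ ^ 2
          = 2 * lam * T * ‖z‖ ^ 2 := by rw [← hTa]; ring
      rw [e1]
      have h1 := MagneticWell.laplaceMoment_zero_ge hl h.one_le_exponent hs0 hw0 hα hs.le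
      rw [← hL, ← hT] at h1
      have hI := MagneticWell.laplaceMoment_pos hl h.one_le_exponent hsz 0
      calc _ = L⁻¹ * (L * Real.exp (-(2 * lam * T * ‖z‖ ^ 2))) := by
            rw [← mul_assoc, inv_mul_cancel₀ hL0.ne', one_mul]
        _ ≤ L⁻¹ * MagneticWell.laplaceMoment lam α 0 (‖z‖ ^ 2) := by gcongr
        _ ≤ K * (√lam * MagneticWell.laplaceMoment lam α 0 (‖z‖ ^ 2)) := by
            gcongr
            exact le_mul_of_one_le_left hI.le (Real.one_le_sqrt.2 h.one_le_lam)
    · rw [hratio _ hs]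
      refine le_trans ?_ hKs
      have h1 := MagneticWell.laplaceMoment_zero_le hl h.one_le_exponent hsz
      -- Bounding √lam by lam is affordable because the Laplace integral is at most 2/(lam s); the
      -- product is at most 2/s ≤ 2/s₁.
      have h2 : √lam ≤ lam := by
        rw [Real.sqrt_le_left hl.le]
        exact le_self_pow₀ h.one_le_lam two_ne_zero
      calc _ ≤ lam * (2 / (lam * ‖z‖ ^ 2)) :=
            mul_le_mul h2 h1 (MagneticWell.laplaceMoment_pos hl h.one_le_exponent hsz 0).le hl.le
        _ = 2 / ‖z‖ ^ 2 := by field_simp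
        _ ≤ _ := by gcongr
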